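/- Let $k$ be an algebraically closed field. All modules are finite-dimensional over $k$. Let $H$ be a finite-dimensional Hopf algebra over $k$ with antipode $S$, and let ${}_H\mathrm{Mod}$ be the monoidal category of left $H$-modules, in which the dual $X^*=\mathrm{Hom}_k(X,k)$ carries the action $\langle hf,x\rangle=\langle f,S(h)x\rangle$ and the evaluation $X^*\otimes X\to k$. Let $L$ be a finite-dimensional left $H$-comodule algebra with coaction $a\mapsto a_{(-1)}\otimes a_{(0)}$. Then ${}_L\mathrm{Mod}$ is a left ${}_H\mathrm{Mod}$-module category by $X\rhd M=X\otimes M$, $a(x\otimes m)=a_{(-1)}x\otimes a_{(0)}m$. Its internal Hom is $[M,N]=\mathrm{Hom}_L(H\rhd M,N)$ with $(hf)(h'\otimes m)=f(h'h\otimes m)$ and evaluation $f\otimes m\mapsto f(1\otimes m)$. Assume that $L$ is exact: $P\rhd M$ is projective whenever $P\in{}_H\mathrm{Mod}$ is projective and $M\in{}_L\mathrm{Mod}$. A relative Serre functor is an endofunctor $\mathrm{Ser}$ of ${}_L\mathrm{Mod}$ together with an isomorphism $\phi_{M,N}\colon[M,N]^*\cong[N,\mathrm{Ser}(M)]$ of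 $H$-modules, natural in $M$ and $N$. Its twisted module structure is the unique twisted ${}_H\mathrm{Mod}$-module structure $\mathrm{Ser}(X\rhd M)\cong X^{**}\rhd\mathrm{Ser}(M)$ for which $\phi$ is an isomorphism of ${}_H\mathrm{Mod}$-bimodule functors; here the left and right module structures of $[M,N]^*$ are dual to the canonical structures $[M,N]\otimes X^*\to[X\rhd M,N]$ and $X\otimes[M,N]\to[M,X\rhd N]$, and the left one of $[N,\mathrm{Ser}(M)]$ comes from the twisted module structure of $\mathrm{Ser}$. Choose a non-zero right integral $\Lambda\in H$ (i.e. $\Lambda h=\varepsilon(h)\Lambda$ for all $h$), the right cointegral $\lambda_H\colon H\to k$ (i.e. $\lambda_H(h_{(1)})h_{(2)}=\lambda_H(h)1$ for all $h$) with $\lambda_H(\Lambda)=1$, and let $\alpha_H\colon H\to k$ be the algebra map with $h\Lambda=\alpha_H(h)\Lambda$. The algebra $L$ is Frobenius; choose a Frobenius form $\lambda_L\colon L\to k$, i.e. a linear form such that $a\mapsto\lambda_L(a\,\cdot\,)$ is a bijection $L\to L^*$. Let $\nu_L$ be the Nakayama automorphism of $L$, determined by $\lambda_L(\nu_L(a)c)=\lambda_L(ca)$,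 and put $$\nu_L'(a)=\langle\alpha_H,\nu_L(a)_{(-1)}\rangle\,\nu_L(a)_{(0)}.$$ Let $\{a_j\}_{j=1}^r$ be a basis of $L$ and let $\{b_j\}$ be the elements of $L$ with $\lambda_L(a_ib_j)=\delta_{ij}$. **Theorem.** Such data $\Lambda,\lambda_H,\alpha_H,\lambda_L$ exist, and for every choice of them $\nu_L'$ is an algebra automorphism of $L$. Let $\mathrm{Ser}(M)$ be the vector space $M$ with the action $a*m=\nu_L'(a)m$, for $M\in{}_L\mathrm{Mod}$, and let $\mathrm{Ser}(f)=f$ on morphisms. Then $\mathrm{Ser}$ is a relative Serre functor of the ${}_H\mathrm{Mod}$-module category ${}_L\mathrm{Mod}$, with an isomorphism $\phi$ and a twisted module structure as follows. 1. The twisted module structure $\mathrm{Ser}(X\rhd M)\to X^{**}\rhd\mathrm{Ser}(M)$ determined by $\phi$ is $$x\otimes m\mapsto\sum_{j=1}^r\Phi_X\Big(S^3\big(S(\Lambda_{(1)})b_{j(-1)}\big)S(\Lambda_{(3)})x\Big)\otimes\langle\lambda_L,b_{j(0)}\rangle\langle\lambda_H,a_{j(-1)}\Lambda_{(2)}\rangle\,a_{j(0)}m,$$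 where $\Phi_X\colon X\to X^{**}$ is given by $\langle\Phi_X(x),f\rangle=f(x)$. 2. The isomorphism $\phi_{M,N}\colon[M,N]^*\cong[N,\mathrm{Ser}(M)]$ is induced by the non-degenerate pairing $$[N,\mathrm{Ser}(M)]\otimes[M,N]\to[M,\mathrm{Ser}(M)]\xrightarrow{\ \mathrm{tr}_M\ }k,$$ where the first arrow is the composition of internal Homs and $\mathrm{tr}_M$ is the following morphism of $H$-modules. Put $P=H\rhd M$. There are a natural number $n$ and elements $t_i\in P$, $t^i\in\mathrm{Hom}_L(P,L)$ ($i=1,\dots,n$) such that $\sum_i t^i(x)t_i=x$ for all $x\in P$; for every such choice, $$\mathrm{tr}_M(\xi)=\sum_{i=1}^n\big\langle\lambda_L,t^i(\Lambda\otimes\xi(t_i))\big\rangle\qquad(\xi\in[M,\mathrm{Ser}(M)]).$$ -/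

import Mathlib

open CategoryTheory MonoidalCategory MonoidalLeftAction
open scoped TensorProduct

universe v₁ v₂ u₁ u₂ u

noncomputable section

/-! ### Left duals in a rigid monoidal category

The left dual `X^*` of `X` comes with an evaluation `X^* ⊗ X ⟶ 𝟙` and a coevaluation
`𝟙 ⟶ X ⊗ X^*`.  In Mathlib's terminology, such an object is called a *right* dual `Xᘁ`. -/

namespace LDual

variable {C : Type u₁} [Category.{v₁} C] [MonoidalCategory C] [RightRigidCategory C]

/-- The left dual object `X^*`. -/
abbrev obj (X : C) : C := (RightRigidCategory.rightDual X).rightDual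

/-- The evaluation `X^* ⊗ X ⟶ 𝟙`. -/
abbrev ev (X : C) : obj X ⊗ X ⟶ 𝟙_ C := (RightRigidCategory.rightDual X).exact.evaluation'

/-- The coevaluation `𝟙 ⟶ X ⊗ X^*`. -/
abbrev coev (X : C) : 𝟙_ C ⟶ X ⊗ obj X := (RightRigidCategory.rightDual X).exact.coevaluation'

/-- The morphism `A ⟶ B^*` induced by a pairing `p : A ⊗ B ⟶ 𝟙`, i.e. the unique morphism `q`
with `(q ⊗ B) ≫ ev = p`. -/
def ofPairing {A B : C} (p : A ⊗ B ⟶ 𝟙_ C) : A ⟶ obj B :=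
  (ρ_ A).inv ≫ A ◁ coev B ≫ (α_ A B (obj B)).inv ≫ p ▷ obj B ≫ (λ_ (obj B)).hom

/-- The dual (transpose) `f^* : Y^* ⟶ X^*` of a morphism `f : X ⟶ Y`. -/
def map {X Y : C} (f : X ⟶ Y) : obj Y ⟶ obj X := ofPairing (obj Y ◁ f ≫ ev Y)

/-- The canonical (iso)morphism `Y^* ⊗ X^* ⟶ (X ⊗ Y)^*`. -/
def tensor (X Y : C) : obj Y ⊗ obj X ⟶ obj (X ⊗ Y) :=
  ofPairing ((α_ (obj Y) (obj X) (X ⊗ Y)).hom ≫ obj Y ◁ (α_ (obj X) X Y).inv ≫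
    obj Y ◁ ev X ▷ Y ≫ obj Y ◁ (λ_ Y).hom ≫ ev Y)

variable (C) in
/-- The canonical (iso)morphism `𝟙 ⟶ 𝟙^*`. -/
def unit : 𝟙_ C ⟶ obj (𝟙_ C) := ofPairing (λ_ (𝟙_ C)).hom

end LDual

/-! ### Module categories, internal Homs and relative Serre functors -/

section ModuleCategory

variable (C : Type u₁) [Category.{v₁} C] [MonoidalCategory C]
variable (D : Type u₂) [Category.{v₂} D] [MonoidalLeftAction C D]

/-- A left `C`-module category `D` such that `P ⊙ₗ M` is projective for every projective object `P`
of `C` and every object `M` of `D`. -/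
def IsExactModuleCategory : Prop :=
  ∀ (P : C) (M : D), Projective P → Projective (P ⊙ₗ M)

/-- A choice of right adjoints `[M, -]` of the functors `X ↦ X ⊙ₗ M`: the left `C`-module category
`D` is closed. -/
class ClosedModuleCategory where
  /-- the functor `[M, -]` -/
  homFunctor : D → D ⥤ C
  /-- the adjunction `(-) ⊙ₗ M ⊣ [M, -]` -/
  adj (M : D) : actionRight C M ⊣ homFunctor M

end ModuleCategory

namespace IHom

variable {C : Type u₁} [Category.{v₁} C] [MonoidalCategory C]
variable {D : Type u₂} [Category.{v₂} D] [MonoidalLeftAction C D] [ClosedModuleCategory C D]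

variable (C) in
/-- The internal Hom object `[M, N]`. -/
abbrev obj (M N : D) : C := (ClosedModuleCategory.homFunctor (C := C) M).obj N

variable (C) in
/-- The map `[M, N] ⟶ [M, N']` induced by `g : N ⟶ N'`. -/
abbrev post (M : D) {N N' : D} (g : N ⟶ N') : obj C M N ⟶ obj C M N' :=
  (ClosedModuleCategory.homFunctor (C := C) M).map g

/-- The morphism `X ⟶ [M, N]` corresponding to `X ⊙ₗ M ⟶ N`. -/
def curry {X : C} {M N : D} (f : X ⊙ₗ M ⟶ N) : X ⟶ obj C M N :=
  (ClosedModuleCategory.adj (C := C) M).homEquiv X N f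

variable (C) in
/-- The evaluation `[M, N] ⊙ₗ M ⟶ N`, the counit of the adjunction. -/
def ev (M N : D) : obj C M N ⊙ₗ M ⟶ N :=
  (ClosedModuleCategory.adj (C := C) M).counit.app N

variable (C) in
/-- The map `[M', N] ⟶ [M, N]` induced by `f : M ⟶ M'`. -/
def pre {M M' : D} (f : M ⟶ M') (N : D) : obj C M' N ⟶ obj C M N :=
  curry (obj C M' N ⊴ₗ f ≫ ev C M' N)

variable (C) in
/-- The composition `[M₂, M₃] ⊗ [M₁, M₂] ⟶ [M₁, M₃]`. -/
def comp (M₁ M₂ M₃ : D) : obj C M₂ M₃ ⊗ obj C M₁ M₂ ⟶ obj C M₁ M₃ :=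
  curry ((αₗ (obj C M₂ M₃) (obj C M₁ M₂) M₁).hom ≫
    obj C M₂ M₃ ⊴ₗ ev C M₁ M₂ ≫ ev C M₂ M₃)

/-- The left `C`-module structure `X ⊗ [M, N] ⟶ [M, X ⊙ₗ N]` of the internal Hom functor. -/
def leftStr (X : C) (M N : D) : X ⊗ obj C M N ⟶ obj C M (X ⊙ₗ N) :=
  curry ((αₗ X (obj C M N) M).hom ≫ X ⊴ₗ ev C M N)

/-- The right `C`-module structure `[M, N] ⊗ X^* ⟶ [X ⊙ₗ M, N]` of the internal Hom functor.
(The right dual of `X^*` is `X`.) -/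
def rightStr [RightRigidCategory C] (M N : D) (X : C) :
    obj C M N ⊗ LDual.obj X ⟶ obj C (X ⊙ₗ M) N :=
  curry ((αₗ (obj C M N) (LDual.obj X) (X ⊙ₗ M)).hom ≫
    obj C M N ⊴ₗ (αₗ (LDual.obj X) X M).inv ≫
    obj C M N ⊴ₗ (LDual.ev X ⊵ₗ M) ≫
    obj C M N ⊴ₗ (λₗ M).hom ≫ ev C M N)

end IHom

section RelativeSerre

variable (C : Type u₁) [Category.{v₁} C] [MonoidalCategory C] [RightRigidCategory C]
variable {D : Type u₂} [Category.{v₂} D] [MonoidalLeftAction C D] [ClosedModuleCategory C D]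

/-- The structure of a relative Serre functor on an endofunctor `S` of `D`: an isomorphism
`[M, N]^* ≅ [N, S M]` in `C`, natural in `M` and `N`. -/
structure RelativeSerreStructure (S : D ⥤ D) where
  /-- the isomorphism `[M, N]^* ≅ [N, S M]` -/
  iso (M N : D) : LDual.obj (IHom.obj C M N) ≅ IHom.obj C N (S.obj M)
  naturality_right (M : D) {N N' : D} (g : N ⟶ N') :
    LDual.map (IHom.post C M g) ≫ (iso M N).hom =
      (iso M N').hom ≫ IHom.pre C g (S.obj M)
  naturality_left {M M' : D} (f : M ⟶ M') (N : D) :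
    LDual.map (IHom.pre C f N) ≫ (iso M' N).hom =
      (iso M N).hom ≫ IHom.post C N (S.map f)

/-- A twisted left `C`-module structure `S (X ⊙ₗ M) ≅ X^{**} ⊙ₗ S M` on an endofunctor `S` of `D`,
i.e. the structure of a left `C`-module functor from `D` to `D` with its action twisted by the
monoidal functor `(-)^{**}`. -/
structure TwistedModuleStructure (S : D ⥤ D) where
  /-- the structure isomorphism `S (X ⊙ₗ M) ≅ X^{**} ⊙ₗ S M` -/
  iso (X : C) (M : D) : S.obj (X ⊙ₗ M) ≅ LDual.obj (LDual.obj X) ⊙ₗ S.obj M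
  naturality_left {X X' : C} (f : X ⟶ X') (M : D) :
    S.map (f ⊵ₗ M) ≫ (iso X' M).hom = (iso X M).hom ≫ LDual.map (LDual.map f) ⊵ₗ S.obj M
  naturality_right (X : C) {M M' : D} (g : M ⟶ M') :
    S.map (X ⊴ₗ g) ≫ (iso X M').hom = (iso X M).hom ≫ LDual.obj (LDual.obj X) ⊴ₗ S.map g
  /-- Compatibility with `(X ⊗ Y) ⊙ₗ M ≅ X ⊙ₗ (Y ⊙ₗ M)`; the objects `(X ⊗ Y)^{**}` and
  `X^{**} ⊗ Y^{**}` are compared through `(Y^* ⊗ X^*)^*`. -/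
  associativity (X Y : C) (M : D) :
    (iso (X ⊗ Y) M).hom ≫ LDual.map (LDual.tensor X Y) ⊵ₗ S.obj M =
      S.map (αₗ X Y M).hom ≫ (iso X (Y ⊙ₗ M)).hom ≫
        LDual.obj (LDual.obj X) ⊴ₗ (iso Y M).hom ≫
        (αₗ (LDual.obj (LDual.obj X)) (LDual.obj (LDual.obj Y)) (S.obj M)).inv ≫
        LDual.tensor (LDual.obj Y) (LDual.obj X) ⊵ₗ S.obj M
  /-- Compatibility with `𝟙 ⊙ₗ M ≅ M`; the objects `𝟙^{**}` and `𝟙` are compared through `𝟙^*`. -/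
  unitality (M : D) :
    (iso (𝟙_ C) M).hom ≫ LDual.map (LDual.unit C) ⊵ₗ S.obj M =
      S.map (λₗ[C] M).hom ≫ (λₗ[C] (S.obj M)).inv ≫ LDual.unit C ⊵ₗ S.obj M

variable {C}

/-- The natural isomorphism `φ : [M, N]^* ≅ [N, S M]` is an isomorphism of `C`-bimodule functors,
where the module structures of the source are dual to those of the internal Hom functor and the left
module structure of the target is induced by the twisted module structure `s` of `S`. The first
equation is the compatibility with the left structures
`X^{**} ⊗ [M, N]^* ≅ ([M, N] ⊗ X^*)^* ≅ [X ⊙ₗ M, N]^*` and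
`X^{**} ⊗ [N, S M] ≅ [N, X^{**} ⊙ₗ S M] ≅ [N, S (X ⊙ₗ M)]`, the second one is the compatibility
with the right structures `[M, N]^* ⊗ X^* ≅ (X ⊗ [M, N])^* ≅ [M, X ⊙ₗ N]^*` and
`[N, S M] ⊗ X^* ≅ [X ⊙ₗ N, S M]`. -/
def RelativeSerreStructure.IsBimoduleIso {S : D ⥤ D} (φ : RelativeSerreStructure C S)
    (s : TwistedModuleStructure C S) : Prop :=
  (∀ (X : C) (M N : D),
    LDual.tensor (IHom.obj C M N) (LDual.obj X) =
      LDual.obj (LDual.obj X) ◁ (φ.iso M N).hom ≫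
        IHom.leftStr (LDual.obj (LDual.obj X)) N (S.obj M) ≫
        IHom.post C N (s.iso X M).inv ≫
        (φ.iso (X ⊙ₗ M) N).inv ≫ LDual.map (IHom.rightStr M N X)) ∧
  (∀ (X : C) (M N : D),
    LDual.tensor X (IHom.obj C M N) =
      (φ.iso M N).hom ▷ LDual.obj X ≫
        IHom.rightStr N (S.obj M) X ≫
        (φ.iso M (X ⊙ₗ N)).inv ≫ LDual.map (IHom.leftStr X M N))

/-- The pairing `[N, S M] ⊗ [M, N] ⟶ 𝟙` associated with `φ : [M, N]^* ≅ [N, S M]`. -/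
def RelativeSerreStructure.pairing {S : D ⥤ D} (φ : RelativeSerreStructure C S) (M N : D) :
    IHom.obj C N (S.obj M) ⊗ IHom.obj C M N ⟶ 𝟙_ C :=
  (φ.iso M N).inv ▷ IHom.obj C M N ≫ LDual.ev (IHom.obj C M N)

end RelativeSerre

/-! ### Finite-dimensional modules -/

/-- A finite-dimensional left module over a `k`-algebra `A`: a finite-dimensional vector space with
an algebra map from `A` to its endomorphism algebra. -/
structure FDMod (k : Type u) [Field k] (A : Type u) [Ring A] [Algebra k A] where
  carrier : Type u
  [addCommGroup : AddCommGroup carrier]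
  [module : Module k carrier]
  [finite : FiniteDimensional k carrier]
  /-- the action of `A` -/
  ρ : A →ₐ[k] Module.End k carrier

namespace FDMod

section Basic

variable {k : Type u} [Field k] {A : Type u} [Ring A] [Algebra k A]

instance : CoeSort (FDMod k A) (Type u) := ⟨FDMod.carrier⟩

attribute [instance] FDMod.addCommGroup FDMod.module FDMod.finite

/-- `A`-linear maps. -/
@[ext]
structure Hom (M N : FDMod k A) where
  toLin : M →ₗ[k] N
  comm : ∀ (a : A) (x : M), toLin (M.ρ a x) = N.ρ a (toLin x)

instance : Category (FDMod k A) where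
  Hom M N := Hom M N
  id M := ⟨LinearMap.id, fun _ _ => rfl⟩
  comp f g := ⟨g.toLin ∘ₗ f.toLin, fun a x => by simp [f.comm, g.comm]⟩

/-- The underlying linear map of a morphism. -/
def lin {M N : FDMod k A} (f : M ⟶ N) : M →ₗ[k] N := Hom.toLin f

lemma lin_comm {M N : FDMod k A} (f : M ⟶ N) (a : A) (x : M) :
    lin f (M.ρ a x) = N.ρ a (lin f x) := Hom.comm f a x

/-- Constructor for morphisms. -/
def ofLin {M N : FDMod k A} (f : M →ₗ[k] N) (h : ∀ a x, f (M.ρ a x) = N.ρ a (f x)) : M ⟶ N :=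
  Hom.mk f h

@[simp] lemma lin_ofLin {M N : FDMod k A} (f : M →ₗ[k] N) (h) : lin (ofLin f h) = f := rfl

@[ext] lemma hom_ext {M N : FDMod k A} {f g : M ⟶ N} (h : lin f = lin g) : f = g := Hom.ext h

@[simp] lemma lin_id (M : FDMod k A) : lin (𝟙 M) = LinearMap.id := rfl

@[simp] lemma lin_comp {M N P : FDMod k A} (f : M ⟶ N) (g : N ⟶ P) :
    lin (f ≫ g) = lin g ∘ₗ lin f := rfl

/-- Constructor for isomorphisms. -/
@[simps]
def isoOfEquiv {M N : FDMod k A} (e : M ≃ₗ[k] N) (h : ∀ a x, e (M.ρ a x) = N.ρ a (e x)) :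
    M ≅ N where
  hom := ofLin e.toLinearMap h
  inv := ofLin e.symm.toLinearMap (fun a x => by
    apply e.injective
    have := h a (e.symm x)
    simp_all)
  hom_inv_id := by ext x; simp
  inv_hom_id := by ext x; simp

variable (k A) in
/-- The regular module. -/
def regular [FiniteDimensional k A] : FDMod k A where
  carrier := A
  ρ := Algebra.lmul k A

/-- The map `a ↦ a x`. -/
def orbit (M : FDMod k A) (x : M) : A →ₗ[k] M := LinearMap.flip M.ρ.toLinearMap x

@[simp] lemma orbit_apply (M : FDMod k A) (x : M) (a : A) : M.orbit x a = M.ρ a x := rfl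

/-- The functor sending a module `M` to the vector space `M` with the action
`a * m = f(a) m` twisted by an algebra endomorphism `f`. -/
def twist (f : A →ₐ[k] A) : FDMod k A ⥤ FDMod k A where
  obj M := { carrier := M, ρ := M.ρ.comp f }
  map {M N} g := Hom.mk (Hom.toLin (M := M) (N := N) g)
    (fun a x => Hom.comm (M := M) (N := N) g (f a) x)

/-- The `A`-linear maps from `M` to `N`, as a subspace of the linear maps. -/
def homSubmodule (M N : FDMod k A) : Submodule k (M →ₗ[k] N) where
  carrier := {f | ∀ a x, f (M.ρ a x) = N.ρ a (f x)}
  add_mem' {f g} hf hg a x := by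
    rw [LinearMap.add_apply, LinearMap.add_apply, hf a x, hg a x, map_add]
  zero_mem' a x := by simp
  smul_mem' c f hf a x := by
    rw [LinearMap.smul_apply, LinearMap.smul_apply, hf a x, map_smul]

end Basic

end FDMod

/-! ### Comodule algebras and the module category of modules -/

/-- A left `H`-comodule algebra: an algebra `L` with a left `H`-coaction `L → H ⊗ L` that is an
algebra map. -/
class LeftComoduleAlgebra (k : Type u) [Field k] (H : Type u) [Ring H] [Bialgebra k H]
    (L : Type u) [Ring L] [Algebra k L] where
  coact : L →ₐ[k] H ⊗[k] L
  coassoc (a : L) :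
    TensorProduct.assoc k H H L
        ((Coalgebra.comul : H →ₗ[k] H ⊗[k] H).rTensor L (coact a)) =
      coact.toLinearMap.lTensor H (coact a)
  counit_coact (a : L) :
    TensorProduct.lid k L ((Coalgebra.counit : H →ₗ[k] k).rTensor L (coact a)) = a

namespace FDMod

variable {k : Type u} [Field k] {H : Type u} [Ring H]
variable {L : Type u} [Ring L] [Algebra k L]

/-- For an `H`-module `X`, an `L`-module `M` and an algebra map `δ : L → H ⊗ L`, the vector space
`X ⊗ M` with the action `a (x ⊗ m) = a_{(-1)} x ⊗ a_{(0)} m`, where `δ a = a_{(-1)} ⊗ a_{(0)}`. -/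
def tens [Algebra k H] (δ : L →ₐ[k] H ⊗[k] L) (X : FDMod k H) (M : FDMod k L) : FDMod k L where
  carrier := X ⊗[k] M
  ρ := (Module.endTensorEndAlgHom (R := k) (S := k) (A := k) (M := X) (N := M)).comp
    ((Algebra.TensorProduct.map X.ρ M.ρ).comp δ)

lemma tens_ρ_tmul [Algebra k H] (δ : L →ₐ[k] H ⊗[k] L) (X : FDMod k H) (M : FDMod k L) (a : L)
    (x : X) (m : M) :
    (tens δ X M).ρ a (x ⊗ₜ[k] m : X ⊗[k] M) = TensorProduct.map (X.orbit x) (M.orbit m) (δ a) := by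
  change (Module.endTensorEndAlgHom (R := k) (S := k) (A := k) (M := X) (N := M))
    (Algebra.TensorProduct.map X.ρ M.ρ (δ a)) (x ⊗ₜ[k] m) = _
  induction δ a with
  | zero => simp
  | tmul h l => rfl
  | add s t hs ht => simp only [map_add, LinearMap.add_apply, hs, ht]

/-- `f ⊗ g` is a morphism. -/
def tensMap [Algebra k H] (δ : L →ₐ[k] H ⊗[k] L) {X X' : FDMod k H} {M M' : FDMod k L}
    (f : X ⟶ X') (g : M ⟶ M') : tens δ X M ⟶ tens δ X' M' :=
  ofLin (TensorProduct.map (lin f) (lin g)) (fun a z =>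
    LinearMap.congr_fun (f := TensorProduct.map (lin f) (lin g) ∘ₗ (tens δ X M).ρ a)
      (g := (tens δ X' M').ρ a ∘ₗ TensorProduct.map (lin f) (lin g))
      (TensorProduct.ext' fun x m => by
        have key : ∀ t : H ⊗[k] L, TensorProduct.map (lin f) (lin g)
            (TensorProduct.map (X.orbit x) (M.orbit m) t) =
            TensorProduct.map (X'.orbit (lin f x)) (M'.orbit (lin g m)) t := fun t => by
          induction t with
          | zero => simp
          | add s t hs ht => simp only [map_add, hs, ht]
          | tmul h l => simp [lin_comm]
        exact (congrArg (TensorProduct.map (lin f) (lin g)) (tens_ρ_tmul δ X M a x m)).trans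
          ((key _).trans (tens_ρ_tmul δ X' M' a (lin f x) (lin g m)).symm)) z)

variable [Bialgebra k H]

/-- `(X ⊗ Y) ⊗ M ≅ X ⊗ (Y ⊗ M)`, the associativity isomorphism of vector spaces. -/
def tensAssoc (δ : L →ₐ[k] H ⊗[k] L)
    (hδ : ∀ a, TensorProduct.assoc k H H L
        ((Coalgebra.comul : H →ₗ[k] H ⊗[k] H).rTensor L (δ a)) =
      δ.toLinearMap.lTensor H (δ a)) (X Y : FDMod k H) (M : FDMod k L) :
    tens δ (tens (Bialgebra.comulAlgHom k H) X Y) M ≅ tens δ X (tens δ Y M) :=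
  isoOfEquiv (TensorProduct.assoc k X Y M) (fun a z =>
    LinearMap.congr_fun
      (f := (TensorProduct.assoc k X Y M).toLinearMap ∘ₗ
        (tens δ (tens (Bialgebra.comulAlgHom k H) X Y) M).ρ a)
      (g := (tens δ X (tens δ Y M)).ρ a ∘ₗ (TensorProduct.assoc k X Y M).toLinearMap)
      (TensorProduct.ext_threefold fun x y m => by
        have h1 := tens_ρ_tmul δ (tens (Bialgebra.comulAlgHom k H) X Y) M a
          (x ⊗ₜ[k] y : X ⊗[k] Y) m
        have h2 := tens_ρ_tmul δ X (tens δ Y M) a x (y ⊗ₜ[k] m : Y ⊗[k] M)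
        have e1 : (tens (Bialgebra.comulAlgHom k H) X Y).orbit (x ⊗ₜ[k] y : X ⊗[k] Y) =
            TensorProduct.map (X.orbit x) (Y.orbit y) ∘ₗ Coalgebra.comul := by
          ext b; exact tens_ρ_tmul (Bialgebra.comulAlgHom k H) X Y b x y
        have e2 : (tens δ Y M).orbit (y ⊗ₜ[k] m : Y ⊗[k] M) =
            TensorProduct.map (Y.orbit y) (M.orbit m) ∘ₗ δ.toLinearMap := by
          ext b; exact tens_ρ_tmul δ Y M b y m
        rw [e1] at h1
        rw [e2] at h2
        refine (congrArg (TensorProduct.assoc k X Y M) h1).trans (Eq.trans ?_ h2.symm)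
        have h3 := congrArg (TensorProduct.map (X.orbit x)
          (TensorProduct.map (Y.orbit y) (M.orbit m))) (hδ a)
        have f1 : ∀ t : (H ⊗[k] H) ⊗[k] L, TensorProduct.assoc k X Y M
            (TensorProduct.map (TensorProduct.map (X.orbit x) (Y.orbit y)) (M.orbit m) t) =
            TensorProduct.map (X.orbit x) (TensorProduct.map (Y.orbit y) (M.orbit m))
              (TensorProduct.assoc k H H L t) := fun t =>
          LinearMap.congr_fun (f := (TensorProduct.assoc k X Y M).toLinearMap ∘ₗ
            TensorProduct.map (TensorProduct.map (X.orbit x) (Y.orbit y)) (M.orbit m))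
            (g := TensorProduct.map (X.orbit x) (TensorProduct.map (Y.orbit y) (M.orbit m)) ∘ₗ
              (TensorProduct.assoc k H H L).toLinearMap)
            (TensorProduct.ext_threefold fun _ _ _ => rfl) t
        have f2 : ∀ t : H ⊗[k] L, TensorProduct.map
            (TensorProduct.map (X.orbit x) (Y.orbit y) ∘ₗ Coalgebra.comul) (M.orbit m) t =
            TensorProduct.map (TensorProduct.map (X.orbit x) (Y.orbit y)) (M.orbit m)
              ((Coalgebra.comul : H →ₗ[k] H ⊗[k] H).rTensor L t) := fun t => by
          rw [LinearMap.rTensor, ← LinearMap.comp_apply, ← TensorProduct.map_comp,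
            LinearMap.comp_id]
        have f3 : ∀ t : H ⊗[k] L, TensorProduct.map (X.orbit x)
            (TensorProduct.map (Y.orbit y) (M.orbit m) ∘ₗ δ.toLinearMap) t =
            TensorProduct.map (X.orbit x) (TensorProduct.map (Y.orbit y) (M.orbit m))
              (δ.toLinearMap.lTensor H t) := fun t => by
          rw [LinearMap.lTensor, ← LinearMap.comp_apply, ← TensorProduct.map_comp,
            LinearMap.comp_id]
        exact ((congrArg _ (f2 _)).trans (f1 _)).trans (h3.trans (f3 _).symm)) z)

variable (k H) in
/-- The trivial module `k`, with action through the counit. -/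
def unit : FDMod k H where
  carrier := k
  ρ := (Algebra.ofId k (Module.End k k)).comp (Bialgebra.counitAlgHom k H)

lemma unit_ρ (h : H) (c : k) :
    (unit k H).ρ h c = (Coalgebra.counit (R := k) h * c : k) := rfl

/-- `k ⊗ M ≅ M`. -/
def tensUnit (δ : L →ₐ[k] H ⊗[k] L)
    (hδ : ∀ a, TensorProduct.lid k L ((Coalgebra.counit : H →ₗ[k] k).rTensor L (δ a)) = a)
    (M : FDMod k L) : tens δ (unit k H) M ≅ M :=
  isoOfEquiv (TensorProduct.lid k M) (fun a z =>
    LinearMap.congr_fun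
      (f := (TensorProduct.lid k M).toLinearMap ∘ₗ (tens δ (unit k H) M).ρ a)
      (g := M.ρ a ∘ₗ (TensorProduct.lid k M).toLinearMap)
      (TensorProduct.ext' fun (c : k) m => by
        have key : ∀ t : H ⊗[k] L, TensorProduct.lid k M
            (TensorProduct.map (LinearMap.mulRight k c ∘ₗ Coalgebra.counit) (M.orbit m) t) =
            M.ρ (TensorProduct.lid k L ((Coalgebra.counit : H →ₗ[k] k).rTensor L t)) (c • m) := by
          intro t
          induction t with
          | zero => simp
          | add s t hs ht => simp only [map_add, hs, ht, LinearMap.add_apply]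
          | tmul h l => simpa [mul_smul] using smul_comm _ _ _
        have h1 := congrArg (TensorProduct.lid k M) (tens_ρ_tmul δ (unit k H) M a c m)
        refine h1.trans ((key (δ a)).trans ?_)
        rw [hδ]
        exact congrArg (M.ρ a) (TensorProduct.lid_tmul m c).symm) z)

/-- `X ⊗ k ≅ X`. -/
def unitTens (X : FDMod k H) : tens (Bialgebra.comulAlgHom k H) X (unit k H) ≅ X :=
  isoOfEquiv (TensorProduct.rid k X) (fun a z =>
    LinearMap.congr_fun
      (f := (TensorProduct.rid k X).toLinearMap ∘ₗ
        (tens (Bialgebra.comulAlgHom k H) X (unit k H)).ρ a)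
      (g := X.ρ a ∘ₗ (TensorProduct.rid k X).toLinearMap)
      (TensorProduct.ext' fun x (c : k) => by
        have key : ∀ t : H ⊗[k] H, TensorProduct.rid k X
            (TensorProduct.map (X.orbit x) (LinearMap.mulRight k c ∘ₗ Coalgebra.counit) t) =
            X.ρ (TensorProduct.rid k H ((Coalgebra.counit : H →ₗ[k] k).lTensor H t)) (c • x) := by
          intro t
          induction t with
          | zero => simp
          | add s t hs ht => simp only [map_add, hs, ht, LinearMap.add_apply]
          | tmul h l => simpa [mul_smul] using smul_comm _ _ _
        have h1 := congrArg (TensorProduct.rid k X)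
          (tens_ρ_tmul (Bialgebra.comulAlgHom k H) X (unit k H) a x c)
        refine h1.trans ((key (Coalgebra.comul a)).trans ?_)
        rw [Coalgebra.lTensor_counit_comul, TensorProduct.rid_tmul, one_smul]
        exact congrArg (X.ρ a) (TensorProduct.rid_tmul x c).symm) z)

/-! ### The monoidal category of finite-dimensional `H`-modules -/

instance : MonoidalCategory (FDMod k H) where
  tensorObj X Y := tens (Bialgebra.comulAlgHom k H) X Y
  tensorUnit := unit k H
  whiskerLeft X _ _ f := tensMap (Bialgebra.comulAlgHom k H) (𝟙 X) f
  whiskerRight f Y := tensMap (Bialgebra.comulAlgHom k H) f (𝟙 Y)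
  tensorHom f g := tensMap (Bialgebra.comulAlgHom k H) f g
  associator X Y Z := tensAssoc (Bialgebra.comulAlgHom k H) Coalgebra.coassoc_apply X Y Z
  leftUnitor X := tensUnit (Bialgebra.comulAlgHom k H)
    (fun a => by
      change TensorProduct.lid k H (Coalgebra.counit.rTensor H (Coalgebra.comul a)) = a
      rw [Coalgebra.rTensor_counit_comul, TensorProduct.lid_tmul, one_smul]) X
  rightUnitor X := unitTens X
  tensorHom_def _ _ := hom_ext (TensorProduct.ext' fun _ _ => rfl)
  id_tensorHom_id X Y := hom_ext (TensorProduct.ext' fun _ _ => rfl)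
  tensorHom_comp_tensorHom f g f' g' := hom_ext (TensorProduct.ext' fun _ _ => rfl)
  whiskerLeft_id X Y := hom_ext (TensorProduct.ext' fun _ _ => rfl)
  id_whiskerRight X Y := hom_ext (TensorProduct.ext' fun _ _ => rfl)
  associator_naturality f g h := hom_ext (TensorProduct.ext_threefold fun _ _ _ => rfl)
  leftUnitor_naturality f := hom_ext (TensorProduct.ext' fun c x => by
    exact ((lin f).map_smul c x).symm)
  rightUnitor_naturality f := hom_ext (TensorProduct.ext' fun x c => by
    exact ((lin f).map_smul c x).symm)
  pentagon W X Y Z := hom_ext (TensorProduct.ext_fourfold fun _ _ _ _ => rfl)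
  triangle X Y := hom_ext (TensorProduct.ext_threefold fun x (c : k) y => by
    exact (TensorProduct.smul_tmul c x y).symm)

/-! ### The module category of finite-dimensional `L`-modules -/

instance [LeftComoduleAlgebra k H L] : MonoidalLeftAction (FDMod k H) (FDMod k L) where
  actionObj X M := tens (LeftComoduleAlgebra.coact (H := H)) X M
  actionHomLeft f M := tensMap LeftComoduleAlgebra.coact f (𝟙 M)
  actionHomRight X _ _ g := tensMap LeftComoduleAlgebra.coact (𝟙 X) g
  actionHom f g := tensMap LeftComoduleAlgebra.coact f g
  actionAssocIso X Y M := tensAssoc _ LeftComoduleAlgebra.coassoc X Y M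
  actionUnitIso M := tensUnit _ LeftComoduleAlgebra.counit_coact M
  actionHom_def _ _ := hom_ext (TensorProduct.ext' fun _ _ => rfl)
  actionHomRight_id X M := hom_ext (TensorProduct.ext' fun _ _ => rfl)
  id_actionHomLeft X M := hom_ext (TensorProduct.ext' fun _ _ => rfl)
  actionHom_comp f g f' g' := hom_ext (TensorProduct.ext' fun _ _ => rfl)
  actionAssocIso_hom_naturality f g h := hom_ext (TensorProduct.ext_threefold fun _ _ _ => rfl)
  actionUnitIso_hom_naturality g := hom_ext (TensorProduct.ext' fun c x => by
    exact (lin g).map_smul c x)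
  whiskerLeft_actionHomLeft X _ _ f M := hom_ext (TensorProduct.ext_threefold fun _ _ _ => rfl)
  whiskerRight_actionHomLeft X f M := hom_ext (TensorProduct.ext_threefold fun _ _ _ => rfl)
  associator_actionHom X Y Z M := hom_ext (TensorProduct.ext_fourfold fun _ _ _ _ => rfl)
  leftUnitor_actionHom X M := hom_ext (TensorProduct.ext_threefold fun (c : k) x m => by
    exact TensorProduct.smul_tmul' c x m)
  rightUnitor_actionHom X M := hom_ext (TensorProduct.ext_threefold fun x (c : k) m => by
    exact TensorProduct.smul_tmul c x m)

end FDMod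

namespace FDMod

variable {k : Type u} [Field k] {H : Type u} [Ring H] [HopfAlgebra k H]

/-! ### Left duals of finite-dimensional `H`-modules -/

/-- The action `⟨h f, x⟩ = ⟨f, S(h) x⟩` on the dual of a representation. -/
def dualRep {V : Type u} [AddCommGroup V] [Module k V] (ρ : H →ₐ[k] Module.End k V) :
    H →ₐ[k] Module.End k (Module.Dual k V) :=
  AlgHom.ofLinearMap
    (Module.Dual.transpose ∘ₗ ρ.toLinearMap ∘ₗ HopfAlgebra.antipode k)
    (by ext f x; simp [Module.Dual.transpose_apply])
    (fun a b => by ext f x; simp [Module.Dual.transpose_apply, HopfAlgebra.antipode_mul_antidistrib])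

lemma dualRep_apply {V : Type u} [AddCommGroup V] [Module k V] (ρ : H →ₐ[k] Module.End k V)
    (h : H) (f : Module.Dual k V) (x : V) :
    dualRep ρ h f x = f (ρ (HopfAlgebra.antipode k h) x) := rfl

lemma dualRep_ev {V : Type u} [AddCommGroup V] [Module k V] (ρ : H →ₐ[k] Module.End k V)
    (f : Module.Dual k V) (x : V) (t : H ⊗[k] H) :
    contractLeft k V (TensorProduct.map (LinearMap.flip (dualRep ρ).toLinearMap f)
        (LinearMap.flip ρ.toLinearMap x) t) =
      f (ρ (LinearMap.mul' k H ((HopfAlgebra.antipode k).rTensor H t)) x) := by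
  induction t with
  | zero => simp
  | add s t hs ht => simp only [map_add, hs, ht, LinearMap.add_apply]
  | tmul a b =>
    rw [LinearMap.rTensor_tmul, LinearMap.mul'_apply, map_mul]
    rfl

lemma dualRep_coev {V : Type u} [AddCommGroup V] [Module k V] (ρ : H →ₐ[k] Module.End k V)
    (z : V ⊗[k] Module.Dual k V) (t : H ⊗[k] H) :
    dualTensorHom k V V (TensorProduct.comm k V (Module.Dual k V)
      ((Module.endTensorEndAlgHom (R := k) (S := k) (A := k) (M := V) (N := Module.Dual k V))
        (Algebra.TensorProduct.map ρ (dualRep ρ) t) z)) =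
      LinearMap.mul' k (Module.End k V) (TensorProduct.map
        (LinearMap.mulRight k
          (dualTensorHom k V V (TensorProduct.comm k V (Module.Dual k V) z) : Module.End k V) ∘ₗ
            ρ.toLinearMap)
        (ρ.toLinearMap ∘ₗ HopfAlgebra.antipode k) t) := by
  induction t with
  | zero => simp
  | add s t hs ht => simp only [map_add, hs, ht, LinearMap.add_apply]
  | tmul a b =>
    induction z with
    | zero => ext y; simp
    | add s t hs ht =>
      simp only [map_add, hs, ht]
      ext y; simp
    | tmul x f =>
      ext y
      have e1 : (Module.endTensorEndAlgHom (R := k) (S := k) (A := k) (M := V)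
        (N := Module.Dual k V)) (Algebra.TensorProduct.map ρ (dualRep ρ) (a ⊗ₜ b))
        (x ⊗ₜ f) = ρ a x ⊗ₜ (dualRep ρ b f) := rfl
      rw [e1]
      simp [dualRep_apply]

/-- The dual space `X^*` with the action `⟨h f, x⟩ = ⟨f, S(h) x⟩`. -/
def ldual (X : FDMod k H) : FDMod k H where
  carrier := Module.Dual k X
  ρ := dualRep X.ρ

/-- The evaluation `X^* ⊗ X ⟶ k`, `f ⊗ x ↦ f(x)`. -/
def ldualEv (X : FDMod k H) : ldual X ⊗ X ⟶ 𝟙_ (FDMod k H) :=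
  ofLin (M := tens (Bialgebra.comulAlgHom k H) (ldual X) X) (N := unit k H)
    (contractLeft k X) (fun h z =>
    LinearMap.congr_fun
      (f := contractLeft k X ∘ₗ (tens (Bialgebra.comulAlgHom k H) (ldual X) X).ρ h)
      (g := (Coalgebra.counit h : k) • contractLeft k X)
      (TensorProduct.ext' fun (f : Module.Dual k X) x => by
        refine (congrArg (contractLeft k X)
          (tens_ρ_tmul (Bialgebra.comulAlgHom k H) (ldual X) X h f x)).trans ?_
        refine (dualRep_ev X.ρ f x (Coalgebra.comul h)).trans ?_
        rw [HopfAlgebra.mul_antipode_rTensor_comul_apply, AlgHom.commutes]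
        exact map_smul f _ x) z)

/-- The coevaluation `k ⟶ X ⊗ X^*`, `1 ↦ ∑ x_i ⊗ x^i`. -/
def ldualCoev (X : FDMod k H) : 𝟙_ (FDMod k H) ⟶ X ⊗ ldual X :=
  ofLin (M := unit k H) (N := tens (Bialgebra.comulAlgHom k H) X (ldual X))
    (coevaluation k X) (fun h c =>
    LinearMap.congr_fun
      (f := coevaluation k X ∘ₗ (unit k H).ρ h)
      (g := (tens (Bialgebra.comulAlgHom k H) X (ldual X)).ρ h ∘ₗ coevaluation k X)
      (LinearMap.ext_ring (by
        let E : X ⊗[k] Module.Dual k X →ₗ[k] (X →ₗ[k] X) :=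
          dualTensorHom k X X ∘ₗ (TensorProduct.comm k X (Module.Dual k X)).toLinearMap
        have hE : Function.Injective E :=
          (dualTensorHom_bijective (R := k) (M := X) (N := X)).1.comp
            (TensorProduct.comm k X (Module.Dual k X)).injective
        have hE1 : E (coevaluation k X 1) = LinearMap.id := by
          rw [coevaluation_apply_one]
          ext y
          simp only [E, LinearMap.comp_apply, map_sum, LinearMap.sum_apply,
            LinearEquiv.coe_coe, TensorProduct.comm_tmul, dualTensorHom_apply, LinearMap.id_apply]
          exact (Module.Basis.ofVectorSpace k X).sum_repr y
        apply hE
        refine Eq.trans ?_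
          (dualRep_coev X.ρ (coevaluation k X 1) (Coalgebra.comul h)).symm
        have hE1' : dualTensorHom k X X (TensorProduct.comm k X (Module.Dual k X)
          (coevaluation k X 1)) = LinearMap.id := hE1
        rw [hE1']
        have h3 : ∀ t : H ⊗[k] H, LinearMap.mul' k (Module.End k X) (TensorProduct.map
              (LinearMap.mulRight k (LinearMap.id : Module.End k X) ∘ₗ X.ρ.toLinearMap)
              (X.ρ.toLinearMap ∘ₗ HopfAlgebra.antipode k) t) =
            X.ρ (LinearMap.mul' k H ((HopfAlgebra.antipode k).lTensor H t)) := by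
          intro t
          induction t with
          | zero => simp
          | add s t hs ht => simp only [map_add, hs, ht]
          | tmul a b =>
            ext y
            simp
        rw [h3, HopfAlgebra.mul_antipode_lTensor_comul_apply, AlgHom.commutes]
        have h4 : (coevaluation k X ∘ₗ (unit k H).ρ h) (1 : k) =
            (Coalgebra.counit h : k) • coevaluation k X 1 := by
          have : (unit k H).ρ h (1 : k) = (Coalgebra.counit (R := k) h : k) • (1 : k) := by
            rw [unit_ρ]; rfl
          exact (congrArg (coevaluation k X) this).trans (map_smul _ _ _)
        refine (congrArg E h4).trans ?_
        rw [map_smul, hE1]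
        rfl)) c)

instance (X : FDMod k H) : HasRightDual X where
  rightDual := ldual X
  exact :=
    { coevaluation' := ldualCoev X
      evaluation' := ldualEv X
      coevaluation_evaluation' := hom_ext (contractLeft_assoc_coevaluation k X)
      evaluation_coevaluation' := hom_ext (contractLeft_assoc_coevaluation' k X) }

instance : RightRigidCategory (FDMod k H) where

end FDMod

/-! ### The internal Hom functor -/

namespace FDMod

variable {k : Type u} [Field k] {H : Type u} [Ring H] [Bialgebra k H] [FiniteDimensional k H]
variable {L : Type u} [Ring L] [Algebra k L] [LeftComoduleAlgebra k H L]

/-- The right multiplication by `h` is an endomorphism of the left regular module. -/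
def rmul (h : H) : regular k H ⟶ regular k H :=
  ofLin (M := regular k H) (N := regular k H) (LinearMap.mulRight k h)
    (fun a x => by exact mul_assoc a x h)

/-- The morphism `H ⟶ X`, `h ↦ h x`. -/
def act (X : FDMod k H) (x : X) : regular k H ⟶ X :=
  ofLin (M := regular k H) (N := X) (X.orbit x) (fun a h => by
    exact LinearMap.congr_fun (map_mul X.ρ a h) x)

/-- The internal Hom object `Hom_L(H ⊙ₗ M, N)`, on which `H` acts by
`(h f)(h' ⊗ m) = f(h' h ⊗ m)`. -/
def ihom (M N : FDMod k L) : FDMod k H where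
  carrier := homSubmodule (regular k H ⊙ₗ M) N
  ρ := AlgHom.ofLinearMap
    { toFun h :=
        { toFun f := ⟨f.1 ∘ₗ lin (rmul h ⊵ₗ M), fun a x => by
            rw [LinearMap.comp_apply, LinearMap.comp_apply, lin_comm]
            exact f.2 a _⟩
          map_add' f g := rfl
          map_smul' c f := rfl }
      map_add' h h' := by
        ext f : 1
        refine Subtype.ext (TensorProduct.ext' fun (x : H) m => ?_)
        refine Eq.trans ?_ (map_add f.1 _ _)
        exact congrArg f.1 ((congrArg (fun y : H => y ⊗ₜ[k] m) (mul_add x h h')).trans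
          (TensorProduct.add_tmul _ _ _))
      map_smul' c h := by
        ext f : 1
        refine Subtype.ext (TensorProduct.ext' fun (x : H) m => ?_)
        refine Eq.trans ?_ (map_smul f.1 _ _)
        exact congrArg f.1 ((congrArg (fun y : H => y ⊗ₜ[k] m) (mul_smul_comm c x h)).trans
          (TensorProduct.smul_tmul' _ _ _).symm) }
    (by
      ext f : 1
      refine Subtype.ext (TensorProduct.ext' fun (x : H) m => ?_)
      exact congrArg f.1 (congrArg (fun y : H => y ⊗ₜ[k] m) (mul_one x)))
    (fun h h' => by
      ext f : 1
      refine Subtype.ext (TensorProduct.ext' fun (x : H) m => ?_)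
      exact congrArg f.1 (congrArg (fun y : H => y ⊗ₜ[k] m) (mul_assoc x h h').symm))

variable (H) in
/-- The functor `Hom_L(H ⊙ₗ M, -)`. -/
def ihomFunctor (M : FDMod k L) : FDMod k L ⥤ FDMod k H where
  obj N := ihom M N
  map {N N'} g := ofLin (M := ihom M N) (N := ihom M N')
    { toFun f := ⟨lin g ∘ₗ f.1, fun a x => by
        rw [LinearMap.comp_apply, f.2 a x, lin_comm, LinearMap.comp_apply]⟩
      map_add' f f' := by
        refine Subtype.ext (LinearMap.ext fun z => ?_)
        exact map_add (lin g) _ _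
      map_smul' c f := by
        refine Subtype.ext (LinearMap.ext fun z => ?_)
        exact map_smul (lin g) _ _ }
    (fun _ _ => rfl)

/-- The bijection `Hom_L(X ⊙ₗ M, N) ≃ Hom_H(X, Hom_L(H ⊙ₗ M, N))`, which sends `f` to
`x ↦ [h ⊗ m ↦ f(h x ⊗ m)]`; its inverse sends `g` to `x ⊗ m ↦ g(x)(1 ⊗ m)`. -/
def ihomEquiv (X : FDMod k H) (M N : FDMod k L) : (X ⊙ₗ M ⟶ N) ≃ (X ⟶ ihom M N) where
  toFun f := ofLin (M := X) (N := ihom M N)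
    { toFun x := ⟨lin f ∘ₗ lin (act X x ⊵ₗ M), fun a z => by
        rw [LinearMap.comp_apply, lin_comm, lin_comm, LinearMap.comp_apply]⟩
      map_add' x y := by
        refine Subtype.ext (TensorProduct.ext' fun (h : H) m => ?_)
        refine Eq.trans ?_ (map_add (lin f) _ _)
        exact congrArg (lin f) ((congrArg (fun y : X => y ⊗ₜ[k] m) (map_add (X.ρ h) x y)).trans
          (TensorProduct.add_tmul _ _ _))
      map_smul' c x := by
        refine Subtype.ext (TensorProduct.ext' fun (h : H) m => ?_)
        refine Eq.trans ?_ (map_smul (lin f) _ _)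
        exact congrArg (lin f) ((congrArg (fun y : X => y ⊗ₜ[k] m) (map_smul (X.ρ h) c x)).trans
          (TensorProduct.smul_tmul' _ _ _).symm) }
    (fun a x => by
      refine Subtype.ext (TensorProduct.ext' fun (h : H) m => ?_)
      exact congrArg (lin f) (congrArg (fun y : X => y ⊗ₜ[k] m)
        (LinearMap.congr_fun (map_mul X.ρ h a) x).symm))
  invFun g := ofLin (M := X ⊙ₗ M) (N := N)
    (TensorProduct.lift
      { toFun x := (lin g x : homSubmodule (regular k H ⊙ₗ M) N).1 ∘ₗ
          (TensorProduct.mk k H M 1 : M →ₗ[k] H ⊗[k] M)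
        map_add' x y := by
          rw [map_add]; rfl
        map_smul' c x := by
          rw [map_smul]; rfl } : X ⊗[k] M →ₗ[k] N)
    (fun a z =>
      LinearMap.congr_fun (f := TensorProduct.lift _ ∘ₗ (X ⊙ₗ M).ρ a)
        (g := N.ρ a ∘ₗ TensorProduct.lift _) (TensorProduct.ext' fun x m => by
          let f : homSubmodule (regular k H ⊙ₗ M) N := lin g x
          have h1 := f.2 a ((1 : H) ⊗ₜ[k] m : H ⊗[k] M)
          refine Eq.trans ?_ h1
          refine (congrArg (TensorProduct.lift _)
            (tens_ρ_tmul (LeftComoduleAlgebra.coact (H := H)) X M a x m)).trans ?_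
          refine Eq.trans ?_ (congrArg f.1
            (tens_ρ_tmul (LeftComoduleAlgebra.coact (H := H)) (regular k H) M a (1 : H) m)).symm
          induction LeftComoduleAlgebra.coact (k := k) (H := H) a with
          | zero => exact (map_zero _).trans (map_zero f.1).symm
          | add s t hs ht =>
            refine ((congrArg _ (map_add _ s t)).trans (map_add _ _ _)).trans ?_
            refine Eq.trans ?_ ((congrArg _ (map_add _ s t)).trans (map_add f.1 _ _)).symm
            exact congrArg₂ (· + ·) hs ht
          | tmul h l =>
            have h2 := lin_comm g h x
            have h3 : (lin g (X.ρ h x) : homSubmodule (regular k H ⊙ₗ M) N).1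
                ((1 : H) ⊗ₜ[k] M.ρ l m : H ⊗[k] M) = f.1 (((1 : H) * h) ⊗ₜ[k] M.ρ l m : H ⊗[k] M) :=
              congrArg (fun q : homSubmodule (regular k H ⊙ₗ M) N =>
                q.1 ((1 : H) ⊗ₜ[k] M.ρ l m : H ⊗[k] M)) h2
            refine h3.trans (congrArg f.1 ?_)
            rw [one_mul]
            exact congrArg (fun y : H => y ⊗ₜ[k] M.ρ l m) (mul_one h).symm) z)
  left_inv f := hom_ext (TensorProduct.ext' fun x m => by
    refine congrArg (lin f) (congrArg (fun y : X => y ⊗ₜ[k] m) ?_)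
    exact LinearMap.congr_fun (map_one X.ρ) x)
  right_inv g := hom_ext (LinearMap.ext fun x =>
    Subtype.ext (TensorProduct.ext' fun (h : H) m => by
      have h2 := lin_comm g h x
      refine (congrArg (fun q : homSubmodule (regular k H ⊙ₗ M) N =>
        q.1 ((1 : H) ⊗ₜ[k] m : H ⊗[k] M)) h2).trans ?_
      exact congrArg (lin g x : homSubmodule (regular k H ⊙ₗ M) N).1
        (congrArg (fun y : H => y ⊗ₜ[k] m) (one_mul h))))

instance : ClosedModuleCategory (FDMod k H) (FDMod k L) where
  homFunctor M := ihomFunctor H M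
  adj M := Adjunction.mkOfHomEquiv
    { homEquiv X N := ihomEquiv X M N
      homEquiv_naturality_left_symm f g := hom_ext (TensorProduct.ext' fun _ _ => rfl)
      homEquiv_naturality_right f g := rfl }

end FDMod

/-! ### Frobenius forms -/

/-- A Frobenius form on `L`: a linear form `λ` such that `a ↦ λ(a -)` is a bijection from `L`
to `L^*`. -/
structure FrobeniusForm (k : Type u) [Field k] (L : Type u) [Ring L] [Algebra k L] where
  form : L →ₗ[k] k
  bijective : Function.Bijective ((LinearMap.mul k L).compr₂ form)

namespace FrobeniusForm

variable {k : Type u} [Field k] {L : Type u} [Ring L] [Algebra k L] (F : FrobeniusForm k L)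

/-- The map `a ↦ λ(a -)`. -/
def theta : L ≃ₗ[k] (L →ₗ[k] k) := LinearEquiv.ofBijective _ F.bijective

lemma theta_apply (a c : L) : F.theta a c = F.form (a * c) := rfl

/-- The underlying map of the Nakayama automorphism. -/
def nakayamaFun (a : L) : L := F.theta.symm (F.form ∘ₗ LinearMap.mulRight k a)

lemma form_nakayamaFun_mul (a c : L) : F.form (F.nakayamaFun a * c) = F.form (c * a) := by
  rw [← F.theta_apply, nakayamaFun, LinearEquiv.apply_symm_apply]; rfl

lemma eq_of_form_mul {a b : L} (h : ∀ c, F.form (a * c) = F.form (b * c)) : a = b :=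
  F.theta.injective (LinearMap.ext h)

/-- The Nakayama automorphism `ν`, determined by `λ(ν(a) c) = λ(c a)`. -/
def nakayama : L →ₐ[k] L :=
  AlgHom.ofLinearMap
    { toFun := F.nakayamaFun
      map_add' a b := F.eq_of_form_mul fun c => by
        simp only [add_mul, map_add, form_nakayamaFun_mul, mul_add]
      map_smul' r a := F.eq_of_form_mul fun c => by
        simp only [form_nakayamaFun_mul, mul_smul_comm, smul_mul_assoc, map_smul,
          RingHom.id_apply] }
    (F.eq_of_form_mul fun c => by
      exact (F.form_nakayamaFun_mul 1 c).trans (by rw [one_mul, mul_one]))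
    (fun a b => F.eq_of_form_mul fun c => by
      change F.form (F.nakayamaFun (a * b) * c) =
        F.form (F.nakayamaFun a * F.nakayamaFun b * c)
      rw [form_nakayamaFun_mul, mul_assoc, form_nakayamaFun_mul, mul_assoc, form_nakayamaFun_mul,
        mul_assoc])

lemma form_nakayama_mul (a c : L) : F.form (F.nakayama a * c) = F.form (c * a) :=
  F.form_nakayamaFun_mul a c

end FrobeniusForm

/-! ### The relative Serre functor of the category of `L`-modules -/

section Serre

variable {k : Type u} [Field k] {H : Type u} [Ring H] [Bialgebra k H]
variable {L : Type u} [Ring L] [Algebra k L] [LeftComoduleAlgebra k H L]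

/-- The element `⟨f, a_{(-1)}⟩ a_{(0)}` of `L`. -/
def coactLeft (f : H →ₗ[k] k) : L →ₗ[k] L :=
  (TensorProduct.lid k L).toLinearMap ∘ₗ f.rTensor L ∘ₗ
    (LeftComoduleAlgebra.coact (k := k) (H := H) (L := L)).toLinearMap

variable (H) in
/-- The element `a_{(-1)} ⟨f, a_{(0)}⟩` of `H`. -/
def coactRight (f : L →ₗ[k] k) : L →ₗ[k] H :=
  (TensorProduct.rid k H).toLinearMap ∘ₗ f.lTensor H ∘ₗ
    (LeftComoduleAlgebra.coact (k := k) (H := H) (L := L)).toLinearMap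

/-- The algebra map `a ↦ ⟨α, ν(a)_{(-1)}⟩ ν(a)_{(0)}`, where `ν` is the Nakayama automorphism. -/
def twistedNakayama (α : H →ₐ[k] k) (F : FrobeniusForm k L) : L →ₐ[k] L :=
  ((Algebra.TensorProduct.lid k L).toAlgHom.comp
    (Algebra.TensorProduct.map α (AlgHom.id k L))).comp
      (LeftComoduleAlgebra.coact.comp F.nakayama)

/-- The functor `Ser`, which twists the action of `L` by `twistedNakayama`. -/
def serre (α : H →ₐ[k] k) (F : FrobeniusForm k L) : FDMod k L ⥤ FDMod k L :=
  FDMod.twist (twistedNakayama α F)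

end Serre

/-! ### Integrals of Hopf algebras -/

/-- A non-zero right integral of `H`, a right cointegral normalized by it, and the right modular
function of `H`. -/
structure IntegralData (k : Type u) [Field k] (H : Type u) [Ring H] [Bialgebra k H] where
  /-- the right integral `Λ` -/
  integral : H
  integral_ne_zero : integral ≠ 0
  integral_mul (h : H) : integral * h = (Coalgebra.counit h : k) • integral
  /-- the right cointegral, `λ(h₍₁₎) h₍₂₎ = λ(h) 1` -/
  cointegral : H →ₗ[k] k
  cointegral_comul (h : H) :
    TensorProduct.lid k H (cointegral.rTensor H (Coalgebra.comul h)) = cointegral h • (1 : H)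
  cointegral_integral : cointegral integral = 1
  /-- the right modular function -/
  modular : H →ₐ[k] k
  mul_integral (h : H) : h * integral = modular h • integral

end

noncomputable section

set_option linter.unusedVariables false
set_option linter.unusedSectionVars false

/-! ### Linearity as a predicate, and sums over representations of tensors -/

/-! Everything rests on one trace. Let `P` be an `L`-module with dual bases `tᵢ`, `tⁱ`, and put
tr(G) = ∑ λ(tⁱ(G(tᵢ))), where λ is the Frobenius form and ν its Nakayama automorphism. If `G : Q →
P` satisfies G(ax) = ν(a)G(x) and `f : P → Q` is `L`-linear, then tr(Gf) = tr(fG), because λ(ν(a)c)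
= λ(ca). Moreover (G, f) ↦ tr(Gf) identifies the ν-semilinear maps Q → P with the dual of Hom_L(P,
Q) (`ftrace_comp_comm`, `eq_zero_of_ftrace_comp`, `exists_ftrace_comp`).

Exactness makes every H ⊗ M projective, so this applies to P = H ⊗ M and Q = H ⊗ N. A semilinear map
H ⊗ N → H ⊗ M on whose values H acts from the right through ε has the form z ↦ Λ ⊗ g(z). Since a(Λ ⊗
m) = Λ ⊗ χ(a)m with χ(a) = α(a₍₋₁₎)a₍₀₎, the map g is `L`-linear for the action through ν' = χν,
that is, g lies in [N, Ser(M)]. On the other side Hom_L(H ⊗ M, H ⊗ N) is H ⊗ [M, N]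
(`unshift_shift`, `sum_shift_unshift`). A functional p on [M, N] extends to it by c ⊗ f ↦ p(S(c)f),
and the semilinear map representing this extension is `H`-invariant. Hence [N, Ser(M)] is the dual
of [M, N], through composition followed by ξ ↦ tr(Λ ⊗ ξ) (`serreDual_injective`,
`serreDual_surjective`). Naturality is associativity of composition and cyclicity of the trace.

The twisted module structure is the action on X ⊗ M of the tensor W = ∑ S³(b_{j(-1)}) g λ(b_{j(0)})
⊗ χ(a_j), followed by X ≅ X^{**}; here g is the distinguished grouplike element of `H`. Linearity,
associativity and unitality are three identities for W. They are checked on slices against the forms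
λ(- c), which exhaust the dual of `L`, and the fourth powers of S that arise are absorbed by
Radford's formula for S⁴ (`IntegralData.radford`). Compatibility with the pairing is an equality of
two traces, verified on maps of rank one (`freeTrace_contr_comp`). Uniqueness holds because [X ⊗ M,
N] is spanned by products of [M, N] and X^*, while the pairing is non-degenerate. Finally
S⁴(Λ₍₁₎)S(Λ₍₃₎)λ_H(yΛ₍₂₎) = α(y)g converts W into the formula with three copies of Λ
(`twistTensor_eq_sum`).

The data exist for two reasons. A nonzero cointegral comes from an explicit projection of the dual
of `H` onto cointegrals, from which every functional can be recovered. For the Frobenius form, an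
extremal argument on dim Hom_L(M, L)/dim M, using exactness, shows that this ratio is at most 1
(`homDim_le_finrank`); a form that vanishes on no nonzero left ideal is then built along a chain of
left ideals. -/

/-- Linearity of a function, as a predicate. -/
@[fun_prop] def KLin (k : Type*) [CommSemiring k] {V W : Type*} [AddCommMonoid V] [Module k V]
    [AddCommMonoid W] [Module k W] (f : V → W) : Prop := IsLinearMap k f

namespace KLin

variable {k : Type*} [CommSemiring k] {V W U : Type*} [AddCommMonoid V] [Module k V]
    [AddCommMonoid W] [Module k W] [AddCommMonoid U] [Module k U]

@[fun_prop] lemma id' : KLin k (fun x : V => x) := ⟨fun _ _ => rfl, fun _ _ => rfl⟩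

@[fun_prop] lemma comp {f : W → U} {g : V → W} (hf : KLin k f) (hg : KLin k g) :
    KLin k (fun x => f (g x)) :=
  ⟨fun a b => by rw [hg.1, hf.1], fun c a => by rw [hg.2, hf.2]⟩

@[fun_prop] lemma app {f : V → (W →ₗ[k] U)} (hf : KLin k f) (w : W) :
    KLin k (fun x => f x w) :=
  ⟨fun a b => by rw [hf.1]; rfl, fun c a => by rw [hf.2]; rfl⟩

@[fun_prop] lemma linearMap (f : W →ₗ[k] U) {g : V → W} (hg : KLin k g) :
    KLin k (fun x => f (g x)) :=
  ⟨fun a b => by rw [hg.1, map_add], fun c a => by rw [hg.2, map_smul]⟩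

@[fun_prop] lemma linearEquiv (f : W ≃ₗ[k] U) {g : V → W} (hg : KLin k g) :
    KLin k (fun x => f (g x)) :=
  ⟨fun a b => by rw [hg.1, map_add], fun c a => by rw [hg.2, map_smul]⟩

variable {A B : Type*} [Semiring A] [Algebra k A] [Semiring B] [Algebra k B]

@[fun_prop] lemma algHom (f : A →ₐ[k] B) {g : V → A} (hg : KLin k g) :
    KLin k (fun x => f (g x)) :=
  ⟨fun a b => by rw [hg.1, map_add], fun c a => by rw [hg.2, map_smul]⟩

@[fun_prop] lemma mul_const {f : V → A} (hf : KLin k f) (c : A) :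
    KLin k (fun x => f x * c) :=
  ⟨fun a b => by rw [hf.1, add_mul], fun r a => by rw [hf.2, smul_mul_assoc]⟩

@[fun_prop] lemma const_mul {f : V → A} (c : A) (hf : KLin k f) :
    KLin k (fun x => c * f x) :=
  ⟨fun a b => by rw [hf.1, mul_add], fun r a => by rw [hf.2, mul_smul_comm]⟩

@[fun_prop] lemma tmul_const {f : V → W} (hf : KLin k f) (c : U) :
    KLin k (fun x => f x ⊗ₜ[k] c) :=
  ⟨fun a b => by rw [hf.1, TensorProduct.add_tmul], fun r a => by rw [hf.2]; rfl⟩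

@[fun_prop] lemma const_tmul {f : V → W} (c : U) (hf : KLin k f) :
    KLin k (fun x => c ⊗ₜ[k] f x) :=
  ⟨fun a b => by rw [hf.1, TensorProduct.tmul_add],
    fun r a => by rw [hf.2, TensorProduct.tmul_smul]⟩

@[fun_prop] lemma smul_const {f : V → k} (hf : KLin k f) (c : W) :
    KLin k (fun x => f x • c) :=
  ⟨fun a b => by rw [hf.1, add_smul], fun r a => by rw [hf.2, smul_assoc]⟩

@[fun_prop] lemma const_smul {f : V → W} (c : k) (hf : KLin k f) :
    KLin k (fun x => c • f x) :=
  ⟨fun a b => by rw [hf.1, smul_add], fun r a => by rw [hf.2, smul_comm]⟩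

@[fun_prop] lemma sum {ι : Type*} (s : Finset ι) {f : ι → V → W} (hf : ∀ i, KLin k (f i)) :
    KLin k (fun x => ∑ i ∈ s, f i x) :=
  ⟨fun a b => by simp [(hf _).1, Finset.sum_add_distrib],
    fun r a => by simp [(hf _).2, Finset.smul_sum]⟩

/-- The linear map underlying a linear function. -/
def toLin {f : V → W} (hf : KLin k f) : V →ₗ[k] W := IsLinearMap.mk' f hf

@[simp] lemma toLin_apply {f : V → W} (hf : KLin k f) (x : V) : hf.toLin x = f x := rfl

lemma ext_tmul {f g : V ⊗[k] W → U} (hf : KLin k f) (hg : KLin k g)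
    (h : ∀ x y, f (x ⊗ₜ y) = g (x ⊗ₜ y)) (t : V ⊗[k] W) : f t = g t :=
  LinearMap.congr_fun (f := hf.toLin) (g := hg.toLin) (TensorProduct.ext' h) t

end KLin

section Swd

variable {k : Type*} [CommRing k] {A B V W U : Type*} [AddCommGroup A] [Module k A]
  [AddCommGroup B] [Module k B] [AddCommGroup V] [Module k V] [AddCommGroup W] [Module k W]
  [AddCommGroup U] [Module k U]

/-- The sum `∑ F xᵢ yᵢ`, where `t = ∑ xᵢ ⊗ yᵢ` is a chosen representation of `t`. -/
def swd (t : A ⊗[k] B) (F : A → B → V) : V :=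
  ∑ i ∈ (TensorProduct.exists_finset t).choose, F i.1 i.2

lemma swd_tmul_self (t : A ⊗[k] B) : swd t (fun a b => a ⊗ₜ[k] b) = t :=
  (TensorProduct.exists_finset t).choose_spec.symm

lemma map_swd (φ : V →ₗ[k] W) (t : A ⊗[k] B) (F : A → B → V) :
    φ (swd t F) = swd t (fun a b => φ (F a b)) := map_sum φ _ _

lemma KLin.map_swd {φ : V → W} (hφ : KLin k φ) (t : A ⊗[k] B) (F : A → B → V) :
    φ (swd t F) = swd t (fun a b => φ (F a b)) := _root_.map_swd hφ.toLin t F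

lemma swd_congr (t : A ⊗[k] B) {F G : A → B → V} (h : ∀ a b, F a b = G a b) :
    swd t F = swd t G := Finset.sum_congr rfl fun _ _ => h _ _

@[simp] lemma swd_zero (t : A ⊗[k] B) : swd t (fun _ _ => (0 : V)) = 0 :=
  Finset.sum_const_zero

lemma swd_comm {A' B' : Type*} [AddCommGroup A'] [Module k A'] [AddCommGroup B'] [Module k B']
    (t : A ⊗[k] B) (s : A' ⊗[k] B') (F : A → B → A' → B' → V) :
    swd t (fun a b => swd s (F a b)) = swd s (fun c d => swd t (fun a b => F a b c d)) :=
  Finset.sum_comm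

/-- The bilinear map underlying a bilinear function. -/
def bilin (F : A → B → V) (h1 : ∀ b, KLin k (fun a => F a b))
    (h2 : ∀ a, KLin k (fun b => F a b)) : A →ₗ[k] B →ₗ[k] V :=
  LinearMap.mk₂ k F (fun a a' b => (h1 b).1 a a') (fun c a b => (h1 b).2 c a)
    (fun a b b' => (h2 a).1 b b') (fun c a b => (h2 a).2 c b)

/-- For bilinear `F` the sum does not depend on the chosen representation of `t`; all manipulations
of Sweedler sums go through this fact. -/
lemma swd_eq_lift (t : A ⊗[k] B) (F : A → B → V)
    (h1 : ∀ b, KLin k (fun a => F a b))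
    (h2 : ∀ a, KLin k (fun b => F a b)) :
    swd t F = TensorProduct.lift (bilin F h1 h2) t := by
  conv_rhs => rw [← swd_tmul_self t, map_swd]
  rfl

lemma swd_zero_left (F : A → B → V) (h1 : ∀ b, KLin k (fun a => F a b))
    (h2 : ∀ a, KLin k (fun b => F a b)) : swd (0 : A ⊗[k] B) F = 0 := by
  rw [swd_eq_lift _ F h1 h2, map_zero]

lemma swd_tmul (a : A) (b : B) (F : A → B → V)
    (h1 : ∀ b, KLin k (fun a => F a b))
    (h2 : ∀ a, KLin k (fun b => F a b)) :
    swd (a ⊗ₜ[k] b) F = F a b := by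
  rw [swd_eq_lift _ F h1 h2, TensorProduct.lift.tmul]; rfl

@[fun_prop] lemma KLin.swd_left {t : W → A ⊗[k] B} (ht : KLin k t) {F : A → B → V}
    (h1 : ∀ b, KLin k (fun a => F a b)) (h2 : ∀ a, KLin k (fun b => F a b)) :
    KLin k (fun w => swd (t w) F) := by
  have : (fun w => swd (t w) F) = fun w => TensorProduct.lift (bilin F h1 h2) (t w) :=
    funext fun w => swd_eq_lift _ F h1 h2
  rw [this]; fun_prop

@[fun_prop] lemma KLin.swd_right (t : A ⊗[k] B) {F : W → A → B → V}
    (h : ∀ a b, KLin k (fun w => F w a b)) :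
    KLin k (fun w => swd t (F w)) :=
  KLin.sum _ (f := fun (i : A × B) w => F w i.1 i.2) fun _ => h _ _

/-- A map that is compatible with a pair of linear maps on pure tensors. -/
lemma swd_sum {ι : Type*} (s : Finset ι) (x : ι → A) (y : ι → B) (F : A → B → V)
    (h1 : ∀ b, KLin k (fun a => F a b))
    (h2 : ∀ a, KLin k (fun b => F a b)) :
    swd (∑ i ∈ s, x i ⊗ₜ[k] y i) F = ∑ i ∈ s, F (x i) (y i) := by
  rw [swd_eq_lift _ F h1 h2, map_sum]; rfl

lemma swd_swd {A' B' : Type*} [AddCommGroup A'] [Module k A'] [AddCommGroup B'] [Module k B']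
    (t : A' ⊗[k] B') (x : A' → B' → A ⊗[k] B) (F : A → B → V)
    (h1 : ∀ b, KLin k (fun a => F a b))
    (h2 : ∀ a, KLin k (fun b => F a b)) :
    swd (swd t x) F = swd t (fun a b => swd (x a b) F) := by
  rw [KLin.map_swd (k := k) (φ := fun z => swd z F) (by fun_prop)]

lemma swd_mul {A B : Type*} [Ring A] [Algebra k A] [Ring B] [Algebra k B] (t s : A ⊗[k] B)
    (F : A → B → V) (h1 : ∀ b, KLin k (fun a => F a b))
    (h2 : ∀ a, KLin k (fun b => F a b)) :
    swd (t * s) F = swd t (fun a b => swd s (fun c d => F (a * c) (b * d))) := by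
  conv_lhs => rw [← swd_tmul_self t, ← swd_tmul_self s,
    KLin.map_swd (φ := fun z => z * swd s (fun a b => a ⊗ₜ[k] b)) (by fun_prop),
    swd_swd t _ F h1 h2]
  refine swd_congr _ fun a b => ?_
  rw [KLin.map_swd (φ := fun z => (a ⊗ₜ[k] b) * z) (by fun_prop),
    swd_swd s _ F h1 h2]
  refine swd_congr _ fun c d => ?_
  rw [Algebra.TensorProduct.tmul_mul_tmul, swd_tmul _ _ F h1 h2]

end Swd

/-! ### Sweedler calculus for coactions and Hopf algebras -/

section Sweedler

variable {k : Type*} [Field k] {H : Type*} [Ring H]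
variable {V W : Type*} [AddCommGroup V] [Module k V] [AddCommGroup W] [Module k W]

local notation "Δ" => (Coalgebra.comul : H →ₗ[k] H ⊗[k] H)
local notation "ε" => (Coalgebra.counit : H →ₗ[k] k)
local notation "S" => (HopfAlgebra.antipode k : H →ₗ[k] H)

/-- Formulated for a coaction on any space `W`, so that W = H gives coassociativity of Δ and W = L
gives the comodule axiom. -/
lemma swd_coassoc_of [Bialgebra k H] {δ : W → H ⊗[k] W} (hδ : KLin k δ) (w : W)
    (hw : TensorProduct.assoc k H H W ((Δ).rTensor W (δ w)) = hδ.toLin.lTensor H (δ w))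
    (T : H → H → W → V)
    (h1 : ∀ b c, KLin k (fun a => T a b c)) (h2 : ∀ a c, KLin k (fun b => T a b c))
    (h3 : ∀ a b, KLin k (fun c => T a b c)) :
    swd (δ w) (fun a l => swd (Δ a) (fun c d => T c d l)) =
      swd (δ w) (fun a l => swd (δ l) (fun c d => T a c d)) := by
  let Φ : H ⊗[k] (H ⊗[k] W) →ₗ[k] V := TensorProduct.lift
    (bilin (fun a (z : H ⊗[k] W) => swd z (fun b c => T a b c)) (by fun_prop) (by fun_prop))
  have e1 : ∀ t : H ⊗[k] W, Φ (TensorProduct.assoc k H H W ((Δ).rTensor W t)) =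
      swd t (fun a l => swd (Δ a) (fun c d => T c d l)) := by
    refine KLin.ext_tmul (by fun_prop) (by fun_prop) fun a l => ?_
    rw [swd_tmul _ _ (fun a l => swd (Δ a) (fun c d => T c d l)) (by fun_prop) (by fun_prop),
      LinearMap.rTensor_tmul]
    conv_lhs => rw [← swd_tmul_self (Δ a)]
    rw [KLin.map_swd (φ := fun z => Φ (TensorProduct.assoc k H H W (z ⊗ₜ[k] l))) (by fun_prop)]
    refine swd_congr _ fun c d => ?_
    exact swd_tmul _ _ (fun b c' => T c b c') (by fun_prop) (by fun_prop)
  have e2 : ∀ t : H ⊗[k] W, Φ (hδ.toLin.lTensor H t) =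
      swd t (fun a l => swd (δ l) (fun c d => T a c d)) := by
    refine KLin.ext_tmul (by fun_prop) (by fun_prop) fun a l => ?_
    rw [swd_tmul _ _ (fun a l => swd (δ l) (fun c d => T a c d)) (by fun_prop) (by fun_prop),
      LinearMap.lTensor_tmul]
    rfl
  rw [← e1, ← e2, hw]

section Bialgebra

variable [Bialgebra k H]

lemma swd_coassoc (h : H) (T : H → H → H → V)
    (h1 : ∀ b c, KLin k (fun a => T a b c) := by fun_prop)
    (h2 : ∀ a c, KLin k (fun b => T a b c) := by fun_prop)
    (h3 : ∀ a b, KLin k (fun c => T a b c) := by fun_prop) :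
    swd (Δ h) (fun a b => swd (Δ a) (fun c d => T c d b)) =
      swd (Δ h) (fun a b => swd (Δ b) (fun c d => T a c d)) :=
  swd_coassoc_of (δ := fun x => Δ x) (by fun_prop) h (Coalgebra.coassoc_apply h) T h1 h2 h3

lemma swd_counit_left (h : H) {f : H → V} (hf : KLin k f) :
    swd (Δ h) (fun a b => ε a • f b) = f h := by
  have := Coalgebra.rTensor_counit_comul (R := k) h
  rw [← swd_tmul_self (Δ h), map_swd] at this
  have h2 := congrArg (fun t => TensorProduct.lid k V (hf.toLin.lTensor k t)) this
  rw [KLin.map_swd (φ := fun t => TensorProduct.lid k V (hf.toLin.lTensor k t))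
    (by fun_prop)] at h2
  simpa using! h2

lemma swd_counit_right (h : H) {f : H → V} (hf : KLin k f) :
    swd (Δ h) (fun a b => ε b • f a) = f h := by
  have := Coalgebra.lTensor_counit_comul (R := k) h
  rw [← swd_tmul_self (Δ h), map_swd] at this
  have h2 := congrArg (fun t => TensorProduct.rid k V (hf.toLin.rTensor k t)) this
  rw [KLin.map_swd (φ := fun t => TensorProduct.rid k V (hf.toLin.rTensor k t))
    (by fun_prop)] at h2
  simpa using! h2

end Bialgebra

section Hopf

variable [HopfAlgebra k H]

lemma swd_antipode_mul (h : H) {f : H → V} (hf : KLin k f) :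
    swd (Δ h) (fun a b => f (S a * b)) = ε h • f 1 := by
  have := HopfAlgebra.mul_antipode_rTensor_comul_apply (R := k) h
  rw [← swd_tmul_self (Δ h), map_swd, map_swd] at this
  have h2 := congrArg f this
  rw [hf.map_swd, Algebra.algebraMap_eq_smul_one, hf.2] at h2
  simpa using h2

lemma swd_mul_antipode (h : H) {f : H → V} (hf : KLin k f) :
    swd (Δ h) (fun a b => f (a * S b)) = ε h • f 1 := by
  have := HopfAlgebra.mul_antipode_lTensor_comul_apply (R := k) h
  rw [← swd_tmul_self (Δ h), map_swd, map_swd] at this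
  have h2 := congrArg f this
  rw [hf.map_swd, Algebra.algebraMap_eq_smul_one, hf.2] at h2
  simpa using h2

/-- `(S(h₍₁₎) ⊗ 1) Δ(h₍₂₎) = 1 ⊗ h`. -/
lemma swd_antipode_tmul_mul_comul (h : H) :
    swd (Δ h) (fun a b => (S a ⊗ₜ[k] (1 : H)) * Δ b) = 1 ⊗ₜ h := by
  calc _ = swd (Δ h) (fun a b => swd (Δ b) fun c d => (S a * c) ⊗ₜ[k] d) := by
        refine swd_congr _ fun a b => ?_
        conv_lhs => rw [← swd_tmul_self (Δ b)]
        rw [KLin.map_swd (φ := fun z => S a ⊗ₜ[k] (1 : H) * z) (by fun_prop)]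
        simp
    _ = swd (Δ h) (fun a b => swd (Δ a) fun c d => (S c * d) ⊗ₜ[k] b) :=
        (swd_coassoc h (fun a b c => (S a * b) ⊗ₜ[k] c)).symm
    _ = swd (Δ h) (fun a b => ε a • (1 : H) ⊗ₜ[k] b) := swd_congr _ fun a b =>
        swd_antipode_mul a (f := fun x => x ⊗ₜ[k] b) (by fun_prop)
    _ = _ := swd_counit_left h (f := fun b => (1 : H) ⊗ₜ[k] b) (by fun_prop)

/-- `Δ(h₍₁₎) (1 ⊗ S(h₍₂₎)) = h ⊗ 1`. -/
lemma swd_comul_mul_tmul_antipode (h : H) :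
    swd (Δ h) (fun a b => Δ a * ((1 : H) ⊗ₜ[k] S b)) = h ⊗ₜ 1 := by
  calc _ = swd (Δ h) (fun a b => swd (Δ a) fun c d => c ⊗ₜ[k] (d * S b)) := by
        refine swd_congr _ fun a b => ?_
        conv_lhs => rw [← swd_tmul_self (Δ a)]
        rw [KLin.map_swd (φ := fun z => z * (1 : H) ⊗ₜ[k] S b) (by fun_prop)]
        simp
    _ = swd (Δ h) (fun a b => swd (Δ b) fun c d => a ⊗ₜ[k] (c * S d)) :=
        (swd_coassoc h (fun a b c => a ⊗ₜ[k] (b * S c)))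
    _ = swd (Δ h) (fun a b => ε b • a ⊗ₜ[k] (1 : H)) := swd_congr _ fun a b =>
        swd_mul_antipode b (f := fun x => a ⊗ₜ[k] x) (by fun_prop)
    _ = _ := swd_counit_right h (f := fun b => b ⊗ₜ[k] (1 : H)) (by fun_prop)

/-- The antipode is an anti-coalgebra map. -/
lemma comul_antipode (h : H) : Δ (S h) = swd (Δ h) (fun a b => S b ⊗ₜ[k] S a) := by
  -- In the convolution algebra of maps H → H ⊗ H, the map h ↦ S(h₍₂₎) ⊗ S(h₍₁₎) is a left inverse
  -- of Δ, while Δ ∘ S is a right inverse. The two therefore agree.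
  have hG : ∀ x : H, swd (Δ x) (fun a b => swd (Δ a) (fun c d => S d ⊗ₜ[k] S c) * Δ b) =
      ε x • (1 : H ⊗[k] H) := by
    intro x
    calc _ = swd (Δ x) (fun a b => swd (Δ a) (fun c d =>
          ((1 : H) ⊗ₜ[k] S c) * (S d ⊗ₜ[k] (1 : H) * Δ b))) := by
          refine swd_congr _ fun a b => ?_
          rw [KLin.map_swd (φ := fun z => z * Δ b) (by fun_prop)]
          refine swd_congr _ fun c d => ?_
          rw [← mul_assoc]; simp
      _ = swd (Δ x) (fun a b => swd (Δ b) (fun c d =>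
          ((1 : H) ⊗ₜ[k] S a) * (S c ⊗ₜ[k] (1 : H) * Δ d))) :=
          swd_coassoc x (fun a c d => ((1 : H) ⊗ₜ[k] S a) * (S c ⊗ₜ[k] (1 : H) * Δ d))
      _ = swd (Δ x) (fun a b => (1 : H) ⊗ₜ[k] (S a * b)) := by
          refine swd_congr _ fun a b => ?_
          rw [← KLin.map_swd (φ := fun z => ((1 : H) ⊗ₜ[k] S a) * z) (by fun_prop),
            swd_antipode_tmul_mul_comul]
          simp
      _ = _ := swd_antipode_mul x (f := fun y => (1 : H) ⊗ₜ[k] y) (by fun_prop)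
  calc Δ (S h) = swd (Δ h) (fun a b => ε a • Δ (S b)) :=
        (swd_counit_left h (f := fun b => Δ (S b)) (by fun_prop)).symm
    _ = swd (Δ h) (fun a b => swd (Δ a) (fun c d =>
          swd (Δ c) (fun c d => S d ⊗ₜ[k] S c) * (Δ d * Δ (S b)))) := by
        refine swd_congr _ fun a b => ?_
        have := congrArg (fun z => z * Δ (S b)) (hG a)
        rw [smul_mul_assoc, one_mul] at this
        rw [← this, KLin.map_swd (φ := fun z => z * Δ (S b)) (by fun_prop)]
        simp only [mul_assoc]
    _ = swd (Δ h) (fun a b => swd (Δ b) (fun c d =>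
          swd (Δ a) (fun c d => S d ⊗ₜ[k] S c) * (Δ c * Δ (S d)))) :=
        swd_coassoc h (fun a c d => swd (Δ a) (fun c d => S d ⊗ₜ[k] S c) * (Δ c * Δ (S d)))
    _ = swd (Δ h) (fun a b => ε b • swd (Δ a) (fun c d => S d ⊗ₜ[k] S c)) := by
        refine swd_congr _ fun a b => ?_
        have := swd_mul_antipode (k := k) b (f := fun x =>
          swd (Δ a) (fun c d => S d ⊗ₜ[k] S c) * Δ x) (by fun_prop)
        simpa using this
    _ = _ := swd_counit_right h (f := fun a => swd (Δ a) (fun c d => S d ⊗ₜ[k] S c))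
        (by fun_prop)

end Hopf

end Sweedler

/-! ### Existence of integrals and bijectivity of the antipode -/

namespace HopfAlgebra

variable {k : Type u} [Field k] {H : Type u} [Ring H] [HopfAlgebra k H]

local notation "Δ" => (Coalgebra.comul : H →ₗ[k] H ⊗[k] H)
local notation "ε" => (Coalgebra.counit : H →ₗ[k] k)
local notation "S" => (HopfAlgebra.antipode k : H →ₗ[k] H)

/-- `Δ(S(y₍₁₎)) (y₍₂₎ ⊗ 1) = 1 ⊗ S(y)`. -/
lemma swd_comul_antipode_mul (y : H) :
    swd (Δ y) (fun a b => Δ (S a) * (b ⊗ₜ[k] (1 : H))) = 1 ⊗ₜ S y := by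
  calc _ = swd (Δ y) (fun a b => swd (Δ a) (fun c d => (S d * b) ⊗ₜ[k] S c)) := by
        refine swd_congr _ fun a b => ?_
        rw [comul_antipode, KLin.map_swd (φ := fun z => z * (b ⊗ₜ[k] (1 : H))) (by fun_prop)]
        simp
    _ = swd (Δ y) (fun a b => swd (Δ b) (fun c d => (S c * d) ⊗ₜ[k] S a)) :=
        swd_coassoc y (fun c d b => (S d * b) ⊗ₜ[k] S c)
    _ = swd (Δ y) (fun a b => ε b • (1 : H) ⊗ₜ[k] S a) := swd_congr _ fun a b =>
        swd_antipode_mul b (f := fun x => x ⊗ₜ[k] S a) (by fun_prop)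
    _ = _ := swd_counit_right y (f := fun a => (1 : H) ⊗ₜ[k] S a) (by fun_prop)

/-- `Δ(S²(y₍₂₎)) (S(y₍₁₎) ⊗ 1) = 1 ⊗ S²(y)`. -/
lemma swd_comul_antipode_antipode_mul (y : H) :
    swd (Δ y) (fun a b => Δ (S (S b)) * (S a ⊗ₜ[k] (1 : H))) = 1 ⊗ₜ S (S y) := by
  rw [← swd_comul_antipode_mul, comul_antipode, swd_swd _ _ _ (by fun_prop) (by fun_prop)]
  refine swd_congr _ fun a b => ?_
  rw [swd_tmul _ _ _ (by fun_prop) (by fun_prop)]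

/-! ### Projection of functionals onto left cointegrals -/

section Trace

variable {n : ℕ} (e : Module.Basis (Fin n) k H) (f : H →ₗ[k] k)

/-- The functionals `f_i` with `∑ f_i(h) e_i = h₍₁₎ f(h₍₂₎)`. -/
def coactDual (i : Fin n) : H →ₗ[k] k :=
  KLin.toLin (k := k) (f := fun h => swd (Δ h) (fun a b => e.coord i a * f b)) (by fun_prop)

lemma coactDual_apply (i : Fin n) (h : H) :
    coactDual e f i h = swd (Δ h) (fun a b => e.coord i a * f b) := rfl

variable {V : Type*} [AddCommGroup V] [Module k V]

lemma sum_coactDual_smul {φ : H → V} (hφ : KLin k φ) (h : H) :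
    ∑ i, coactDual e f i h • φ (e i) = swd (Δ h) (fun a b => f b • φ a) := by
  simp only [coactDual_apply]
  have : ∀ i, swd (Δ h) (fun a b => e.coord i a * f b) • φ (e i) =
      swd (Δ h) (fun a b => f b • φ (e.coord i a • e i)) := fun i => by
    rw [KLin.map_swd (φ := fun z => z • φ (e i)) (by fun_prop)]
    refine swd_congr _ fun a b => ?_
    rw [hφ.2, smul_smul, mul_comm]
  rw [Finset.sum_congr rfl fun i _ => this i]
  unfold swd
  rw [Finset.sum_comm]
  refine Finset.sum_congr rfl fun p _ => ?_
  rw [← Finset.smul_sum]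
  congr 1
  have h2 := congrArg hφ.toLin (e.sum_repr p.1)
  rw [map_sum] at h2
  exact h2

/-- The comodule axiom for the coaction f ↦ ∑ fᵢ ⊗ eᵢ on the dual of `H`, evaluated by a trilinear
`F`; it is coassociativity of Δ, transposed. -/
lemma sum_coactDual_comul {F : (H →ₗ[k] k) → H → H → V}
    (h1 : ∀ a b, KLin k (fun x => F x a b)) (h2 : ∀ x b, KLin k (fun a => F x a b))
    (h3 : ∀ x a, KLin k (fun b => F x a b)) :
    ∑ i, ∑ j, F (coactDual e (coactDual e f i) j) (e j) (e i) =
      ∑ l, swd (Δ (e l)) (fun a b => F (coactDual e f l) a b) := by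
  have key : ∀ i j, coactDual e (coactDual e f i) j =
      ∑ l, swd (Δ (e l)) (fun a b => e.coord j a * e.coord i b) • coactDual e f l := by
    intro i j
    ext x
    rw [LinearMap.sum_apply]
    simp only [LinearMap.smul_apply, smul_eq_mul]
    have e1 : ∑ l, swd (Δ (e l)) (fun a b => e.coord j a * e.coord i b) * coactDual e f l x =
        swd (Δ x) (fun a b => f b • swd (Δ a) (fun a b => e.coord j a * e.coord i b)) := by
      rw [← sum_coactDual_smul e f (φ := fun y =>
        swd (Δ y) (fun a b => e.coord j a * e.coord i b)) (by fun_prop) x]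
      exact Finset.sum_congr rfl fun l _ => mul_comm _ _
    rw [e1, coactDual_apply]
    have e2 := swd_coassoc (k := k) x (fun a b c => f c * (e.coord j a * e.coord i b))
    refine Eq.trans ?_ (e2.symm.trans ?_)
    · refine swd_congr _ fun a b => ?_
      rw [coactDual_apply, KLin.map_swd (φ := fun z => e.coord j a * z) (by fun_prop)]
      exact swd_congr _ fun c d => by ring
    · refine swd_congr _ fun a b => ?_
      rw [KLin.map_swd (φ := fun z => f b • z) (by fun_prop)]
      rfl
  have e3 : ∀ l, swd (Δ (e l)) (fun a b => F (coactDual e f l) a b) =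
      ∑ i, ∑ j, swd (Δ (e l)) (fun a b => e.coord j a * e.coord i b) •
        F (coactDual e f l) (e j) (e i) := by
    intro l
    have : ∀ i j, swd (Δ (e l)) (fun a b => e.coord j a * e.coord i b) •
        F (coactDual e f l) (e j) (e i) = swd (Δ (e l)) (fun a b =>
          F (coactDual e f l) (e.coord j a • e j) (e.coord i b • e i)) := fun i j => by
      rw [KLin.map_swd (φ := fun z => z • F (coactDual e f l) (e j) (e i)) (by fun_prop)]
      refine swd_congr _ fun a b => ?_
      rw [(h2 _ _).2, (h3 _ _).2, smul_smul]
    simp only [this]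
    unfold swd
    simp only [Finset.sum_comm (t := (TensorProduct.exists_finset (Δ (e l))).choose)]
    refine Finset.sum_congr rfl fun p _ => ?_
    have hb : ∀ a, F (coactDual e f l) a p.2 =
        ∑ i, F (coactDual e f l) a (e.coord i p.2 • e i) := fun a => by
      conv_lhs => rw [← e.sum_repr p.2]
      exact map_sum (h3 _ _).toLin _ _
    rw [hb]
    refine Finset.sum_congr rfl fun i _ => ?_
    conv_lhs => rw [← e.sum_repr p.1]
    exact map_sum (h2 (coactDual e f l) (e.coord i p.2 • e i)).toLin _ _
  simp only [e3]
  have e4 : ∀ i j, F (coactDual e (coactDual e f i) j) (e j) (e i) =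
      ∑ l, swd (Δ (e l)) (fun a b => e.coord j a * e.coord i b) •
        F (coactDual e f l) (e j) (e i) := fun i j => by
    rw [key]
    refine (map_sum (h1 (e j) (e i)).toLin _ _).trans ?_
    exact Finset.sum_congr rfl fun l _ => (h1 (e j) (e i)).2 _ _
  simp only [e4]
  rw [Finset.sum_comm (s := Finset.univ (α := Fin n)) (t := Finset.univ (α := Fin n))]
  conv_rhs => rw [Finset.sum_comm]
  rw [Finset.sum_comm]
  refine Finset.sum_congr rfl fun i _ => ?_
  rw [Finset.sum_comm]

/-- The projection `f ↦ ∑ f_i(- S²(e_i))` onto the left cointegrals. -/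
def cointegralOf : H →ₗ[k] k :=
  ∑ i, coactDual e f i ∘ₗ LinearMap.mulRight k (S (S (e i)))

lemma cointegralOf_apply (h : H) :
    cointegralOf e f h = ∑ i, coactDual e f i (h * S (S (e i))) := by
  simp [cointegralOf]

lemma comul_mul_tmul_slice (φ : H →ₗ[k] k) (t : H ⊗[k] H) (x : H) :
    swd (t * (x ⊗ₜ[k] (1 : H))) (fun a b => φ b • a) = swd t (fun a b => φ b • a) * x := by
  rw [swd_mul _ _ _ (by fun_prop) (by fun_prop),
    KLin.map_swd (φ := fun z => z * x) (by fun_prop)]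
  refine swd_congr _ fun a b => ?_
  rw [swd_tmul _ _ _ (by fun_prop) (by fun_prop)]
  simp

/-- Rewriting 1 ⊗ S²(y) as Δ(S²(y₍₂₎))(S(y₍₁₎) ⊗ 1) absorbs S²(eᵢ) into the argument of Δ at the
price of a factor S(y₍₁₎). By the comodule axiom that factor meets the outer leg in the form
x₍₁₎S(x₍₂₎), which collapses to ε. -/
lemma cointegralOf_comul (h : H) :
    swd (Δ h) (fun a b => cointegralOf e f b • a) = cointegralOf e f h • (1 : H) := by
  have e1 : ∀ (φ : H →ₗ[k] k) (y : H), swd (Δ h) (fun a b => φ (b * S (S y)) • a) =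
      swd (Δ y) (fun p q => swd (Δ (h * S (S q))) (fun a b => φ b • a) * S p) := by
    intro φ y
    have e2 : swd (Δ h * ((1 : H) ⊗ₜ[k] S (S y))) (fun a b => φ b • a) =
        swd (Δ h) (fun a b => φ (b * S (S y)) • a) := by
      rw [swd_mul _ _ _ (by fun_prop) (by fun_prop)]
      refine swd_congr _ fun a b => ?_
      rw [swd_tmul _ _ _ (by fun_prop) (by fun_prop), mul_one]
    rw [← e2, ← swd_comul_antipode_antipode_mul,
      KLin.map_swd (φ := fun z => Δ h * z) (by fun_prop),
      swd_swd _ _ _ (by fun_prop) (by fun_prop)]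
    refine swd_congr _ fun p q => ?_
    rw [← mul_assoc, comul_mul_tmul_slice, Bialgebra.comul_mul]
  have e3 : swd (Δ h) (fun a b => cointegralOf e f b • a) =
      ∑ l, swd (Δ (e l)) (fun p q =>
        swd (Δ (h * S (S q))) (fun a b => coactDual e f l b • a) * S p) := by
    simp only [← e1, cointegralOf_apply, Finset.sum_smul]
    unfold swd
    exact Finset.sum_comm
  rw [e3, ← sum_coactDual_comul e f (F := fun x p q =>
    swd (Δ (h * S (S q))) (fun a b => x b • a) * S p) (by fun_prop) (by fun_prop) (by fun_prop),
    cointegralOf_apply, Finset.sum_smul]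
  refine Finset.sum_congr rfl fun i _ => ?_
  generalize h * S (S (e i)) = x
  generalize coactDual e f i = φ
  calc _ = swd (Δ x) (fun a b => ∑ j, coactDual e φ j b • (a * S (e j))) := by
        unfold swd
        simp only [Finset.sum_mul, smul_mul_assoc]
        exact Finset.sum_comm
    _ = swd (Δ x) (fun a b => swd (Δ b) (fun c d => φ d • (a * S c))) :=
        swd_congr _ fun a b => sum_coactDual_smul e φ (φ := fun y => a * S y) (by fun_prop) b
    _ = swd (Δ x) (fun a b => swd (Δ a) (fun c d => φ b • (c * S d))) :=
        (swd_coassoc x (fun a b c => φ c • (a * S b))).symm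
    _ = swd (Δ x) (fun a b => ε a • (φ b • (1 : H))) := swd_congr _ fun a b =>
        swd_mul_antipode a (f := fun y => φ b • y) (by fun_prop)
    _ = _ := swd_counit_left x (f := fun b => φ b • (1 : H)) (by fun_prop)

/-- Every functional can be recovered from cointegrals: after the comodule axiom the argument
contains S(b)S²(a) = S(S(a)b) with a ⊗ b = Δ(e_l), and this is ε(e_l). -/
lemma sum_cointegralOf_coactDual (h : H) :
    ∑ i, cointegralOf e (coactDual e f i) (h * S (e i)) = f h := by
  simp only [cointegralOf_apply]
  refine (sum_coactDual_comul e f (F := fun x a b => x (h * S b * S (S a)))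
    (by fun_prop) (by fun_prop) (by fun_prop)).trans ?_
  have : ∀ l, swd (Δ (e l)) (fun a b => coactDual e f l (h * S b * S (S a))) =
      ε (e l) • coactDual e f l h := fun l => by
    simpa [antipode_mul_antidistrib, mul_assoc, antipode_one] using
      swd_antipode_mul (k := k) (e l) (f := fun x => coactDual e f l (h * S x)) (by fun_prop)
  simp only [this]
  have h2 := sum_coactDual_smul e f (φ := fun x => ε x) (by fun_prop) h
  refine Eq.trans (Finset.sum_congr rfl fun l _ => ?_) (h2.trans ?_)
  · exact mul_comm _ _
  · refine Eq.trans (swd_congr _ fun a b => ?_) (swd_counit_left h (f := fun b => f b) (by fun_prop))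
    exact mul_comm _ _

end Trace

variable (k H) in
-- If all left cointegrals vanished, so would all projections, and the recovery formula would give
-- ε(1) = 0.
lemma exists_left_cointegral [FiniteDimensional k H] :
    ∃ l : H →ₗ[k] k, l ≠ 0 ∧ ∀ h, swd (Δ h) (fun a b => l b • a) = l h • (1 : H) := by
  let e := Module.finBasis k H
  by_contra hcon
  push Not at hcon
  have h0 : ∀ f, cointegralOf e f = 0 := fun f => by
    by_contra h
    obtain ⟨x, hx⟩ := hcon _ h
    exact hx (cointegralOf_comul e f x)
  have := sum_cointegralOf_coactDual e ε 1
  simp [h0] at this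

/-! ### Non-degeneracy of a left cointegral -/

section Antipode

variable {l : H →ₗ[k] k}

/-- Substitute 1 ⊗ S(y) = Δ(S(y₍₁₎))(y₍₂₎ ⊗ 1) after Δ(h) and apply invariance of `l` to hS(y₍₁₎).
-/
lemma swd_left_cointegral (hl : ∀ h, swd (Δ h) (fun a b => l b • a) = l h • (1 : H)) (y h : H) :
    swd (Δ y) (fun a b => l (h * S a) • b) = swd (Δ h) (fun a b => l (b * S y) • a) := by
  have e2 : swd (Δ h * ((1 : H) ⊗ₜ[k] S y)) (fun a b => l b • a) =
      swd (Δ h) (fun a b => l (b * S y) • a) := by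
    rw [swd_mul _ _ _ (by fun_prop) (by fun_prop)]
    refine swd_congr _ fun a b => ?_
    rw [swd_tmul _ _ _ (by fun_prop) (by fun_prop), mul_one]
  rw [← e2, ← swd_comul_antipode_mul,
    KLin.map_swd (φ := fun z => Δ h * z) (by fun_prop),
    swd_swd _ _ _ (by fun_prop) (by fun_prop)]
  refine swd_congr _ fun p q => ?_
  rw [← mul_assoc, comul_mul_tmul_slice, ← Bialgebra.comul_mul, hl]
  simp

/-- A single cancellation serves twice: it gives injectivity of the antipode, and injectivity of c ↦
l(- S(c)), hence existence and uniqueness of integrals. -/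
lemma eq_zero_of_left_cointegral (hl : ∀ h, swd (Δ h) (fun a b => l b • a) = l h • (1 : H))
    (hl0 : l ≠ 0) [FiniteDimensional k H] (y : H)
    (hy : ∀ h, l (h * S y) = 0) : y = 0 := by
  obtain ⟨h, hh⟩ : ∃ h, l h ≠ 0 := by
    by_contra hcon
    push Not at hcon
    exact hl0 (LinearMap.ext hcon)
  let A : H →ₗ[k] (H →ₗ[k] k) :=
    KLin.toLin (k := k) (f := fun c => l ∘ₗ LinearMap.mulRight k (S c))
      ⟨fun a b => by ext; simp [mul_add], fun a b => by ext; simp⟩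
  -- The preceding identity shows that the operator x ↦ l(xS(y₍₁₎))y₍₂₎ is zero, so its tensor is
  -- zero.
  have hA : swd (Δ y) (fun a b => A a ⊗ₜ[k] b) = 0 := by
    refine (dualTensorHom_bijective (R := k) (M := H) (N := H)).1 ?_
    refine (KLin.map_swd (k := k) (φ := fun z : (H →ₗ[k] k) ⊗[k] H => dualTensorHom k H H z)
      (by fun_prop) _ _).trans ?_
    rw [map_zero]
    ext x
    rw [KLin.map_swd (k := k) (φ := fun z : H →ₗ[k] H => z x) (by fun_prop)]
    refine (swd_left_cointegral hl y x).trans ?_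
    refine (swd_congr _ fun a b => ?_).trans (swd_zero (Δ x))
    rw [hy, zero_smul]
  -- Apply φ ⊗ c ↦ φ(hS²(c₍₁₎))c₍₂₎. The argument becomes hS(y₍₁₎S(y₍₂₎)), which leaves l(h)y, where
  -- l(h) ≠ 0.
  have e1 := congrArg (fun t : (H →ₗ[k] k) ⊗[k] H =>
    swd t (fun φ c => swd (Δ c) (fun p q => φ (h * S (S p)) • q))) hA
  rw [swd_zero_left _ (by fun_prop) (by fun_prop),
    swd_swd _ _ _ (by fun_prop) (by fun_prop)] at e1
  have e3 : swd (Δ y) (fun a b => swd (Δ b) (fun p q => l (h * S (S p) * S a) • q)) = 0 := by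
    refine Eq.trans (swd_congr _ fun a b => ?_) e1
    rw [swd_tmul _ _ _ (by fun_prop) (by fun_prop)]
    rfl
  rw [← swd_coassoc y (fun a p q => l (h * S (S p) * S a) • q)] at e3
  have e4 : ∀ a b : H, swd (Δ a) (fun c d => l (h * S (S d) * S c) • b) = ε a • (l h • b) := by
    intro a b
    simpa [antipode_mul_antidistrib, antipode_one, mul_assoc] using
      swd_mul_antipode (k := k) a (f := fun x => l (h * S x) • b) (by fun_prop)
  rw [swd_congr _ e4, swd_counit_left y (f := fun b => l h • b) (by fun_prop)] at e3
  exact (smul_eq_zero.1 e3).resolve_left hh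

end Antipode

variable (k) in
lemma antipode_injective [FiniteDimensional k H] : Function.Injective S := by
  obtain ⟨l, hl0, hl⟩ := exists_left_cointegral k H
  rw [injective_iff_map_eq_zero]
  intro y hy
  exact eq_zero_of_left_cointegral hl hl0 y fun h => by simp [hy]

/-- The antipode of a finite-dimensional Hopf algebra, as a linear equivalence. -/
def antipodeEquiv [FiniteDimensional k H] : H ≃ₗ[k] H :=
  LinearEquiv.ofInjectiveEndo S (antipode_injective k)

/-! ### Existence of the integral data -/

section AntipodeEquiv

variable [FiniteDimensional k H]

@[simp] lemma antipode_antipodeEquiv_symm (x : H) : S ((antipodeEquiv (k := k)).symm x) = x :=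
  (antipodeEquiv (k := k) (H := H)).apply_symm_apply x

@[simp] lemma antipodeEquiv_symm_antipode (x : H) : (antipodeEquiv (k := k)).symm (S x) = x :=
  (antipodeEquiv (k := k) (H := H)).symm_apply_apply x

variable (k H) in
-- By non-degeneracy, c ↦ l(- S(c)) is a bijection onto the dual of `H`; the integral is the
-- preimage of ε. Bijectivity also shows that the right integrals form a line, and the modular
-- function is the factor by which left multiplication acts on that line.
lemma nonempty_integralData : Nonempty (IntegralData k H) := by
  obtain ⟨l, hl0, hl⟩ := exists_left_cointegral k H
  let D : H →ₗ[k] Module.Dual k H :=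
    KLin.toLin (k := k) (f := fun c => l ∘ₗ LinearMap.mulRight k (S c))
      ⟨fun a b => by ext; simp [mul_add], fun a b => by ext; simp⟩
  have hD (c x : H) : D c x = l (x * S c) := rfl
  have hinj : Function.Injective D := by
    rw [injective_iff_map_eq_zero]
    intro y hy
    exact eq_zero_of_left_cointegral hl hl0 y fun h => LinearMap.congr_fun hy h
  have hsurj : Function.Surjective D :=
    (LinearMap.injective_iff_surjective_of_finrank_eq_finrank
      (Subspace.dual_finrank_eq (K := k) (V := H)).symm).1 hinj
  obtain ⟨Λ, hΛ⟩ := hsurj ε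
  have hΛ' : ∀ x, l (x * S Λ) = ε x := fun x => LinearMap.congr_fun hΛ x
  have hint : ∀ h, Λ * h = ε h • Λ := fun h => hinj (LinearMap.ext fun x => by
    rw [hD, antipode_mul_antidistrib, ← mul_assoc, hΛ', map_smul, LinearMap.smul_apply, hD, hΛ']
    simp [mul_comm])
  have hΛ0 : Λ ≠ 0 := by
    rintro rfl
    have := hΛ' 1
    simp at this
  -- Apply the functional of y · S⁻¹(w) to 1: it equals the functional of y at w, since S(y S⁻¹(w))
  -- = w S(y). Thus the functional of y is a multiple of ε.
  have huniq : ∀ y, (∀ z, y * z = ε z • y) → y = D y 1 • Λ := fun y hy => by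
    refine hinj (LinearMap.ext fun w => ?_)
    have := LinearMap.congr_fun (congrArg D (hy ((antipodeEquiv (k := k)).symm w))) 1
    rw [hD, antipode_mul_antidistrib, antipode_antipodeEquiv_symm, one_mul, ← hD, map_smul] at this
    rw [map_smul, LinearMap.smul_apply, hD Λ, hΛ', this, LinearMap.smul_apply,
      ← counit_antipode (R := k) ((antipodeEquiv (k := k)).symm w), antipode_antipodeEquiv_symm]
    exact mul_comm _ _
  have hmod : ∀ h, h * Λ = D (h * Λ) 1 • Λ := fun h =>
    huniq _ fun z => by rw [mul_assoc, hint, mul_smul_comm]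
  have hcan : ∀ c d : k, c • Λ = d • Λ → c = d := fun c d h => smul_left_injective k hΛ0 h
  exact ⟨{
    integral := Λ
    integral_ne_zero := hΛ0
    integral_mul := hint
    -- The antipode reverses the comultiplication, so it turns the left cointegral into a right one.
    cointegral := l ∘ₗ S
    cointegral_comul h := by
      apply antipode_injective k
      conv_lhs => rw [← swd_tmul_self (Δ h)]
      rw [map_swd, KLin.map_swd (φ := fun z => S (TensorProduct.lid k H z)) (by fun_prop)]
      have := hl (S h)
      rw [comul_antipode, swd_swd _ _ _ (by fun_prop) (by fun_prop)] at this
      rw [map_smul, antipode_one]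
      refine Eq.trans (swd_congr _ fun a b => ?_) this
      rw [swd_tmul _ _ _ (by fun_prop) (by fun_prop)]
      simp
    cointegral_integral := by
      have := hΛ' 1
      simpa using this
    modular := AlgHom.ofLinearMap
      (KLin.toLin (k := k) (f := fun h => D (h * Λ) 1) (by fun_prop))
      (hcan _ _ (by rw [KLin.toLin_apply, ← hmod, one_mul, one_smul]))
      (fun a b => hcan _ _ (by
        simp only [KLin.toLin_apply]
        rw [← hmod, mul_assoc]
        conv_lhs => rw [hmod b]
        rw [mul_smul_comm, hmod a, smul_smul, mul_comm]
        simp only [← hmod]))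
    mul_integral := hmod }⟩

end AntipodeEquiv

end HopfAlgebra

/-! ### Slices of tensors -/

section Slice

variable {k : Type*} [Field k] {A B : Type*}

section Module

variable [AddCommGroup A] [Module k A] [AddCommGroup B] [Module k B]

/-- The map `a ⊗ b ↦ φ(a) b`. -/
def sliceL (φ : A →ₗ[k] k) : A ⊗[k] B →ₗ[k] B :=
  (TensorProduct.lid k B).toLinearMap ∘ₗ φ.rTensor B

/-- The map `a ⊗ b ↦ ψ(b) a`. -/
def sliceR (ψ : B →ₗ[k] k) : A ⊗[k] B →ₗ[k] A :=
  (TensorProduct.rid k A).toLinearMap ∘ₗ ψ.lTensor A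

@[simp] lemma sliceL_tmul (φ : A →ₗ[k] k) (a : A) (b : B) :
    sliceL φ (a ⊗ₜ[k] b) = φ a • b := by simp [sliceL]

@[simp] lemma sliceR_tmul (ψ : B →ₗ[k] k) (a : A) (b : B) :
    sliceR ψ (a ⊗ₜ[k] b) = ψ b • a := by simp [sliceR]

lemma sliceL_eq_swd (φ : A →ₗ[k] k) (t : A ⊗[k] B) :
    sliceL φ t = swd t (fun a b => φ a • b) := by
  conv_lhs => rw [← swd_tmul_self t, map_swd]
  simp

lemma sliceR_eq_swd (ψ : B →ₗ[k] k) (t : A ⊗[k] B) :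
    sliceR ψ t = swd t (fun a b => ψ b • a) := by
  conv_lhs => rw [← swd_tmul_self t, map_swd]
  simp

lemma eq_of_forall_dual {x y : A} (h : ∀ φ : A →ₗ[k] k, φ x = φ y) : x = y :=
  sub_eq_zero.1 ((Module.forall_dual_apply_eq_zero_iff k (x - y)).1 fun φ => by
    rw [map_sub, h, sub_self])

lemma ext_sliceR [FiniteDimensional k B] {t s : A ⊗[k] B}
    (h : ∀ ψ : B →ₗ[k] k, sliceR ψ t = sliceR ψ s) : t = s := by
  let e := Module.finBasis k B
  have key : ∀ t : A ⊗[k] B, ∑ i, sliceR (e.coord i) t ⊗ₜ[k] e i = t := by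
    refine KLin.ext_tmul (by fun_prop) (by fun_prop) fun a b => ?_
    simp only [sliceR_tmul, TensorProduct.smul_tmul, ← TensorProduct.tmul_sum]
    congr 1
    exact e.sum_repr b
  rw [← key t, ← key s]
  simp only [h]

end Module

section Algebra

variable [Ring A] [Algebra k A] [Ring B] [Algebra k B]

lemma sliceL_mul_one_tmul (φ : A →ₗ[k] k) (t : A ⊗[k] B) (x : B) :
    sliceL φ (t * (1 : A) ⊗ₜ[k] x) = sliceL φ t * x := by
  refine KLin.ext_tmul (k := k) (f := fun t => sliceL φ (t * (1 : A) ⊗ₜ[k] x))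
    (g := fun t => sliceL φ t * x) (by fun_prop) (by fun_prop) (fun a b => ?_) t
  simp

lemma sliceL_one_tmul_mul (φ : A →ₗ[k] k) (t : A ⊗[k] B) (x : B) :
    sliceL φ ((1 : A) ⊗ₜ[k] x * t) = x * sliceL φ t := by
  refine KLin.ext_tmul (k := k) (f := fun t => sliceL φ ((1 : A) ⊗ₜ[k] x * t))
    (g := fun t => x * sliceL φ t) (by fun_prop) (by fun_prop) (fun a b => ?_) t
  simp

lemma sliceL_mul_tmul_one (φ : A →ₗ[k] k) (t : A ⊗[k] B) (x : A) :
    sliceL φ (t * x ⊗ₜ[k] (1 : B)) = sliceL (φ ∘ₗ LinearMap.mulRight k x) t := by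
  refine KLin.ext_tmul (k := k) (f := fun t => sliceL φ (t * x ⊗ₜ[k] (1 : B)))
    (g := fun t => sliceL (φ ∘ₗ LinearMap.mulRight k x) t) (by fun_prop) (by fun_prop)
    (fun a b => ?_) t
  simp

lemma sliceL_tmul_one_mul (φ : A →ₗ[k] k) (t : A ⊗[k] B) (x : A) :
    sliceL φ (x ⊗ₜ[k] (1 : B) * t) = sliceL (φ ∘ₗ LinearMap.mulLeft k x) t := by
  refine KLin.ext_tmul (k := k) (f := fun t => sliceL φ (x ⊗ₜ[k] (1 : B) * t))
    (g := fun t => sliceL (φ ∘ₗ LinearMap.mulLeft k x) t) (by fun_prop) (by fun_prop)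
    (fun a b => ?_) t
  simp

lemma sliceR_mul_tmul_one (ψ : B →ₗ[k] k) (t : A ⊗[k] B) (x : A) :
    sliceR ψ (t * x ⊗ₜ[k] (1 : B)) = sliceR ψ t * x := by
  refine KLin.ext_tmul (k := k) (f := fun t => sliceR ψ (t * x ⊗ₜ[k] (1 : B)))
    (g := fun t => sliceR ψ t * x) (by fun_prop) (by fun_prop) (fun a b => ?_) t
  simp

lemma sliceR_tmul_one_mul (ψ : B →ₗ[k] k) (t : A ⊗[k] B) (x : A) :
    sliceR ψ (x ⊗ₜ[k] (1 : B) * t) = x * sliceR ψ t := by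
  refine KLin.ext_tmul (k := k) (f := fun t => sliceR ψ (x ⊗ₜ[k] (1 : B) * t))
    (g := fun t => x * sliceR ψ t) (by fun_prop) (by fun_prop) (fun a b => ?_) t
  simp

lemma sliceR_mul_one_tmul (ψ : B →ₗ[k] k) (t : A ⊗[k] B) (x : B) :
    sliceR ψ (t * (1 : A) ⊗ₜ[k] x) = sliceR (ψ ∘ₗ LinearMap.mulRight k x) t := by
  refine KLin.ext_tmul (k := k) (f := fun t => sliceR ψ (t * (1 : A) ⊗ₜ[k] x))
    (g := fun t => sliceR (ψ ∘ₗ LinearMap.mulRight k x) t) (by fun_prop) (by fun_prop)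
    (fun a b => ?_) t
  simp

lemma sliceR_one_tmul_mul (ψ : B →ₗ[k] k) (t : A ⊗[k] B) (x : B) :
    sliceR ψ ((1 : A) ⊗ₜ[k] x * t) = sliceR (ψ ∘ₗ LinearMap.mulLeft k x) t := by
  refine KLin.ext_tmul (k := k) (f := fun t => sliceR ψ ((1 : A) ⊗ₜ[k] x * t))
    (g := fun t => sliceR (ψ ∘ₗ LinearMap.mulLeft k x) t) (by fun_prop) (by fun_prop)
    (fun a b => ?_) t
  simp

end Algebra

end Slice

/-! ### Identities for integrals and cointegrals -/

namespace HopfAlgebra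

variable {k : Type u} [Field k] {H : Type u} [Ring H] [HopfAlgebra k H]
variable {V : Type*} [AddCommGroup V] [Module k V]

local notation "Δ" => (Coalgebra.comul : H →ₗ[k] H ⊗[k] H)
local notation "ε" => (Coalgebra.counit : H →ₗ[k] k)
local notation "S" => (HopfAlgebra.antipode k : H →ₗ[k] H)
local notation "S'" => (LinearEquiv.symm (antipodeEquiv (k := k) (H := H)))

/-- Both α and α ∘ S² are convolution inverses of α ∘ S. -/
lemma algHom_antipode_antipode (α : H →ₐ[k] k) (x : H) : α (S (S x)) = α x := by
  calc α (S (S x)) = swd (Δ x) (fun a b => ε b • α (S (S a))) :=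
        (swd_counit_right x (f := fun a => α (S (S a))) (by fun_prop)).symm
    _ = swd (Δ x) (fun a b => swd (Δ b) (fun c d => α (S (S a)) * α (S c * d))) := by
        refine swd_congr _ fun a b => ?_
        rw [swd_antipode_mul b (f := fun z => α (S (S a)) * α z) (by fun_prop)]
        simp
    _ = swd (Δ x) (fun a b => swd (Δ a) (fun c d => α (S (S c)) * α (S d * b))) :=
        (swd_coassoc x (fun a c d => α (S (S a)) * α (S c * d))).symm
    _ = swd (Δ x) (fun a b => ε a • α b) := by
        refine swd_congr _ fun a b => ?_
        have := swd_antipode_mul (k := k) a (f := fun z => α (S z) * α b) (by fun_prop)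
        rw [antipode_one, map_one, one_mul] at this
        rw [← this]
        refine swd_congr _ fun c d => ?_
        rw [antipode_mul_antidistrib, map_mul, map_mul]
        ring
    _ = _ := swd_counit_left x (f := fun a => α a) (by fun_prop)

section Inverse

variable [FiniteDimensional k H]

lemma antipodeEquiv_symm_mul (x y : H) : S' (x * y) = S' y * S' x := by
  apply antipode_injective k
  rw [antipode_mul_antidistrib]
  simp

@[simp] lemma antipodeEquiv_symm_one : S' (1 : H) = 1 := by
  apply antipode_injective k
  simp [antipode_one]

lemma swd_antipodeEquiv_symm_mul (h : H) {f : H → V} (hf : KLin k f) :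
    swd (Δ h) (fun a b => f (S' b * a)) = ε h • f 1 := by
  have := swd_antipode_mul (k := k) h (f := fun x => f (S' x)) (by fun_prop)
  simpa [antipodeEquiv_symm_mul] using this

lemma swd_mul_antipodeEquiv_symm (h : H) {f : H → V} (hf : KLin k f) :
    swd (Δ h) (fun a b => f (b * S' a)) = ε h • f 1 := by
  have := swd_mul_antipode (k := k) h (f := fun x => f (S' x)) (by fun_prop)
  simpa [antipodeEquiv_symm_mul] using this

/-- `(1 ⊗ S⁻¹(h₍₂₎)) Δ(h₍₁₎) = h ⊗ 1`. -/
lemma swd_antipodeEquiv_symm_tmul_mul_comul (h : H) :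
    swd (Δ h) (fun a b => ((1 : H) ⊗ₜ[k] S' b) * Δ a) = h ⊗ₜ 1 := by
  calc _ = swd (Δ h) (fun a b => swd (Δ a) fun c d => c ⊗ₜ[k] (S' b * d)) := by
        refine swd_congr _ fun a b => ?_
        conv_lhs => rw [← swd_tmul_self (Δ a)]
        rw [KLin.map_swd (φ := fun z => (1 : H) ⊗ₜ[k] S' b * z) (by fun_prop)]
        simp
    _ = swd (Δ h) (fun a b => swd (Δ b) fun c d => a ⊗ₜ[k] (S' d * c)) :=
        (swd_coassoc h (fun a b c => a ⊗ₜ[k] (S' c * b)))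
    _ = swd (Δ h) (fun a b => ε b • a ⊗ₜ[k] (1 : H)) := swd_congr _ fun a b =>
        swd_antipodeEquiv_symm_mul b (f := fun x => a ⊗ₜ[k] x) (by fun_prop)
    _ = _ := swd_counit_right h (f := fun b => b ⊗ₜ[k] (1 : H)) (by fun_prop)

end Inverse

end HopfAlgebra

namespace IntegralData

open HopfAlgebra

variable {k : Type u} [Field k] {H : Type u} [Ring H] [HopfAlgebra k H]
variable {V : Type*} [AddCommGroup V] [Module k V]
variable (I : IntegralData k H)

local notation "Δ" => (Coalgebra.comul : H →ₗ[k] H ⊗[k] H)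
local notation "ε" => (Coalgebra.counit : H →ₗ[k] k)
local notation "S" => (HopfAlgebra.antipode k : H →ₗ[k] H)
local notation "S'" => (LinearEquiv.symm (antipodeEquiv (k := k) (H := H)))

lemma sliceL_cointegral_comul (h : H) : sliceL I.cointegral (Δ h) = I.cointegral h • (1 : H) :=
  I.cointegral_comul h

lemma comul_integral_mul_comul (x : H) : Δ I.integral * Δ x = ε x • Δ I.integral := by
  rw [← Bialgebra.comul_mul, I.integral_mul, map_smul]

lemma comul_mul_comul_integral (x : H) : Δ x * Δ I.integral = I.modular x • Δ I.integral := by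
  rw [← Bialgebra.comul_mul, I.mul_integral, map_smul]

/-- Since x ⊗ 1 = Δ(x₍₁₎)(1 ⊗ S(x₍₂₎)), the factor Δ(x₍₁₎) is absorbed by Δ(Λ). The next identities
for left factors have the same proof, with α in place of ε. -/
lemma comul_integral_mul_tmul_one (x : H) :
    Δ I.integral * (x ⊗ₜ[k] (1 : H)) = Δ I.integral * ((1 : H) ⊗ₜ[k] S x) := by
  rw [← swd_comul_mul_tmul_antipode, KLin.map_swd (φ := fun z => Δ I.integral * z) (by fun_prop)]
  simp only [← mul_assoc, comul_integral_mul_comul, smul_mul_assoc]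
  exact swd_counit_left x (f := fun z => Δ I.integral * (1 : H) ⊗ₜ[k] S z) (by fun_prop)

lemma one_tmul_mul_comul_integral (x : H) : ((1 : H) ⊗ₜ[k] x) * Δ I.integral =
    swd (Δ x) (fun a b => I.modular b • ((S a ⊗ₜ[k] (1 : H)) * Δ I.integral)) := by
  rw [← swd_antipode_tmul_mul_comul, KLin.map_swd (φ := fun z => z * Δ I.integral) (by fun_prop)]
  simp only [mul_assoc, comul_mul_comul_integral, mul_smul_comm]

lemma sliceL_cointegral_mul (x : H) :
    sliceL I.cointegral (Δ I.integral * (x ⊗ₜ[k] (1 : H))) = S x := by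
  rw [comul_integral_mul_tmul_one, sliceL_mul_one_tmul, sliceL_cointegral_comul,
    cointegral_integral, one_smul, one_mul]

/-- The distinguished grouplike element, `Λ₍₁₎ λ(Λ₍₂₎)`. -/
def distinguished : H := sliceR I.cointegral (Δ I.integral)

variable [FiniteDimensional k H]

lemma comul_integral_mul_one_tmul (x : H) :
    Δ I.integral * ((1 : H) ⊗ₜ[k] x) = Δ I.integral * (S' x ⊗ₜ[k] (1 : H)) := by
  rw [comul_integral_mul_tmul_one, antipode_antipodeEquiv_symm]

lemma tmul_one_mul_comul_integral (x : H) : (x ⊗ₜ[k] (1 : H)) * Δ I.integral =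
    swd (Δ x) (fun a b => I.modular a • (((1 : H) ⊗ₜ[k] S' b) * Δ I.integral)) := by
  rw [← swd_antipodeEquiv_symm_tmul_mul_comul,
    KLin.map_swd (φ := fun z => z * Δ I.integral) (by fun_prop)]
  simp only [mul_assoc, comul_mul_comul_integral, mul_smul_comm]

/-- The form λ(- x) determines x: contracting it with Δ(Λ) returns S(x), and S is injective.
Equality of dimensions gives surjectivity. -/
lemma exists_cointegral_mulRight (φ : H →ₗ[k] k) :
    ∃ x, φ = I.cointegral ∘ₗ LinearMap.mulRight k x := by
  let D : H →ₗ[k] (H →ₗ[k] k) :=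
    KLin.toLin (k := k) (f := fun c => I.cointegral ∘ₗ LinearMap.mulRight k c)
      ⟨fun a b => by ext; simp [mul_add], fun a b => by ext; simp⟩
  have hinj : Function.Injective D := by
    rw [injective_iff_map_eq_zero]
    intro x hx
    apply antipode_injective k
    rw [← I.sliceL_cointegral_mul, sliceL_mul_tmul_one]
    have : I.cointegral ∘ₗ LinearMap.mulRight k x = 0 := hx
    rw [this]
    simp [sliceL]
  obtain ⟨x, hx⟩ := (LinearMap.injective_iff_surjective_of_finrank_eq_finrank
      (Subspace.dual_finrank_eq (K := k) (V := H)).symm).1 hinj φ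
  exact ⟨x, hx.symm⟩

lemma ext_cointegral {t s : V ⊗[k] H} (h : ∀ x, sliceR (I.cointegral ∘ₗ LinearMap.mulRight k x) t =
    sliceR (I.cointegral ∘ₗ LinearMap.mulRight k x) s) : t = s :=
  ext_sliceR fun ψ => by
    obtain ⟨x, rfl⟩ := I.exists_cointegral_mulRight ψ
    exact h x

/-- `∑ λ(y S⁻¹(Λ₍₂₎)) Λ₍₁₎ = y`. -/
lemma swd_cointegral_smul (y : H) :
    swd (Δ I.integral) (fun a b => I.cointegral (y * S' b) • a) = y := by
  have h : ∀ φ : H →ₗ[k] k,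
      φ (swd (Δ I.integral) (fun a b => I.cointegral (y * S' b) • a)) = φ y := fun φ => by
    -- It is enough to test against λ(- x), where the claim becomes λ(y S⁻¹(λ(Λ₍₁₎x)Λ₍₂₎)) = λ(yx).
    obtain ⟨x, rfl⟩ := I.exists_cointegral_mulRight φ
    rw [map_swd]
    have := congrArg (fun z => I.cointegral (y * S' z)) (I.sliceL_cointegral_mul x)
    rw [sliceL_mul_tmul_one, sliceL_eq_swd,
      KLin.map_swd (φ := fun z => I.cointegral (y * S' z)) (by fun_prop)] at this
    rw [antipodeEquiv_symm_antipode] at this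
    refine Eq.trans (swd_congr _ fun a b => ?_) this
    simp [mul_comm]
  exact eq_of_forall_dual (k := k) h

/-- Uniqueness of right cointegrals. -/
lemma eq_smul_cointegral {l : H →ₗ[k] k} (hl : ∀ h, sliceL l (Δ h) = l h • (1 : H)) (y : H) :
    l y = l I.integral * I.cointegral y := by
  have := congrArg l (I.swd_cointegral_smul y)
  rw [← this, map_swd]
  have h2 := congrArg (fun z => I.cointegral (y * S' z)) (hl I.integral)
  rw [sliceL_eq_swd, KLin.map_swd (φ := fun z => I.cointegral (y * S' z)) (by fun_prop)] at h2
  refine Eq.trans (swd_congr _ fun a b => ?_) (h2.trans ?_)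
  · simp [mul_comm]
  · simp

/-- For each functional q, the form h ↦ q(h₍₁₎)λ(h₍₂₎) is again a right cointegral, hence a multiple
of λ by uniqueness; the multiple is read off at Λ. -/
lemma sliceR_cointegral_comul (h : H) :
    sliceR I.cointegral (Δ h) = I.cointegral h • I.distinguished := by
  refine eq_of_forall_dual (k := k) fun q => ?_
  let l : H →ₗ[k] k := q ∘ₗ sliceR I.cointegral ∘ₗ Δ
  have hl : ∀ h, sliceL l (Δ h) = l h • (1 : H) := fun h => by
    calc sliceL l (Δ h) = swd (Δ h) (fun a b => swd (Δ a) (fun c d =>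
          q c • (I.cointegral d • b))) := by
          rw [sliceL_eq_swd]
          refine swd_congr _ fun a b => ?_
          simp only [l, LinearMap.comp_apply, sliceR_eq_swd]
          rw [KLin.map_swd (φ := fun z => q z • b) (by fun_prop)]
          refine swd_congr _ fun c d => ?_
          rw [map_smul, smul_eq_mul, mul_comm, mul_smul]
      _ = swd (Δ h) (fun a b => swd (Δ b) (fun c d => q a • (I.cointegral c • d))) :=
          swd_coassoc h (fun a c d => q a • (I.cointegral c • d))
      _ = swd (Δ h) (fun a b => q a • (I.cointegral b • (1 : H))) := by
          refine swd_congr _ fun a b => ?_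
          rw [← KLin.map_swd (φ := fun z => q a • z) (by fun_prop), ← sliceL_eq_swd,
            sliceL_cointegral_comul]
      _ = _ := by
          simp only [l, LinearMap.comp_apply, sliceR_eq_swd]
          rw [KLin.map_swd (φ := fun z => q z • (1 : H)) (by fun_prop)]
          refine swd_congr _ fun c d => ?_
          rw [map_smul, smul_eq_mul, mul_comm, mul_smul]
  have := I.eq_smul_cointegral hl h
  rw [map_smul, smul_eq_mul, mul_comm]
  exact this

lemma comul_distinguished : Δ I.distinguished = I.distinguished ⊗ₜ[k] I.distinguished := by
  calc Δ I.distinguished = swd (Δ I.integral) (fun a b => swd (Δ a) (fun c d =>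
          I.cointegral b • c ⊗ₜ[k] d)) := by
        conv_lhs => rw [distinguished, sliceR_eq_swd, map_swd]
        refine swd_congr _ fun a b => ?_
        rw [map_smul, ← KLin.map_swd (φ := fun z => I.cointegral b • z) (by fun_prop),
          swd_tmul_self]
    _ = swd (Δ I.integral) (fun a b => swd (Δ b) (fun c d => I.cointegral d • a ⊗ₜ[k] c)) :=
        swd_coassoc _ (fun a c d => I.cointegral d • a ⊗ₜ[k] c)
    _ = swd (Δ I.integral) (fun a b => (I.cointegral b • a) ⊗ₜ[k] I.distinguished) := by
        refine swd_congr _ fun a b => ?_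
        rw [TensorProduct.smul_tmul, ← sliceR_cointegral_comul, sliceR_eq_swd,
          KLin.map_swd (φ := fun z => a ⊗ₜ[k] z) (by fun_prop)]
        simp
    _ = _ := by
        rw [← KLin.map_swd (φ := fun z => z ⊗ₜ[k] I.distinguished) (by fun_prop), ← sliceR_eq_swd]
        rfl

lemma counit_distinguished : ε I.distinguished = 1 := by
  rw [distinguished, sliceR_eq_swd, map_swd, ← I.cointegral_integral]
  refine Eq.trans (swd_congr _ fun a b => ?_)
    (swd_counit_left I.integral (f := fun z => I.cointegral z) (by fun_prop))
  simp [mul_comm]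

lemma antipode_distinguished_mul : S I.distinguished * I.distinguished = 1 := by
  have := swd_antipode_mul (k := k) I.distinguished (f := fun z => z) (by fun_prop)
  rwa [comul_distinguished, swd_tmul _ _ _ (by fun_prop) (by fun_prop), counit_distinguished,
    one_smul] at this

lemma distinguished_mul_antipode : I.distinguished * S I.distinguished = 1 := by
  have := swd_mul_antipode (k := k) I.distinguished (f := fun z => z) (by fun_prop)
  rwa [comul_distinguished, swd_tmul _ _ _ (by fun_prop) (by fun_prop), counit_distinguished,
    one_smul] at this

lemma antipode_antipode_distinguished : S (S I.distinguished) = I.distinguished := by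
  have h1 : S (S I.distinguished) * S I.distinguished = 1 := by
    rw [← antipode_mul_antidistrib, distinguished_mul_antipode, antipode_one]
  calc S (S I.distinguished) = S (S I.distinguished) * (S I.distinguished * I.distinguished) := by
        rw [antipode_distinguished_mul, mul_one]
    _ = _ := by rw [← mul_assoc, h1, one_mul]

/-- `Λ₍₁₎ λ(Λ₍₂₎ x) = g S⁻¹(x)`. -/
lemma sliceR_cointegral_mul (x : H) :
    sliceR I.cointegral (Δ I.integral * ((1 : H) ⊗ₜ[k] x)) = I.distinguished * S' x := by
  rw [comul_integral_mul_one_tmul, sliceR_mul_tmul_one]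
  rfl

/-- `S³(Λ₍₁₎) g ⊗ Λ₍₂₎ = S(Λ₍₂₎) ⊗ Λ₍₁₎`. -/
lemma swd_antipode_tmul : swd (Δ I.integral)
    (fun a b => (S (S (S a)) * I.distinguished) ⊗ₜ[k] b) =
      swd (Δ I.integral) (fun a b => S b ⊗ₜ[k] a) := by
  -- Test the second leg against λ(- x). The left side gives S³(g S⁻¹(x))g = S²(x)S(g)g = S²(x), by
  -- S²(g) = g, and the right side gives S(S(x)).
  refine I.ext_cointegral fun x => ?_
  rw [map_swd, map_swd]
  have h1 := congrArg (fun z => S (S (S z)) * I.distinguished) (I.sliceR_cointegral_mul x)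
  rw [sliceR_mul_one_tmul, sliceR_eq_swd,
    KLin.map_swd (φ := fun z => S (S (S z)) * I.distinguished) (by fun_prop)] at h1
  have h2 := congrArg (fun z => S z) (I.sliceL_cointegral_mul x)
  rw [sliceL_mul_tmul_one, sliceL_eq_swd, KLin.map_swd (φ := fun z => S z) (by fun_prop)] at h2
  refine Eq.trans (swd_congr _ fun a b => ?_) ((h1.trans ?_).trans (Eq.trans h2.symm
    (swd_congr _ fun a b => ?_)))
  · simp
  · simp only [antipode_mul_antidistrib, antipode_antipodeEquiv_symm,
      antipode_antipode_distinguished, mul_assoc, antipode_distinguished_mul, mul_one]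
  · simp

/-- `Λ₍₁₎ λ(x Λ₍₂₎) = S(x₍₁₎) α(x₍₂₎) g`. -/
lemma sliceR_one_tmul_mul_comul_integral (x : H) :
    sliceR I.cointegral (((1 : H) ⊗ₜ[k] x) * Δ I.integral) =
      swd (Δ x) (fun a b => I.modular b • (S a * I.distinguished)) := by
  rw [one_tmul_mul_comul_integral, map_swd]
  refine swd_congr _ fun a b => ?_
  rw [map_smul, sliceR_tmul_one_mul]
  rfl

/-- `λ(y w) = α(y₍₁₎) λ(w S⁻²(y₍₂₎))`. -/
lemma cointegral_mul (y w : H) : I.cointegral (y * w) =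
    swd (Δ y) (fun a b => I.modular a • I.cointegral (w * S' (S' b))) := by
  -- Moving y through Δ(Λ) computes λ(yΛ₍₁₎)Λ₍₂₎; the claim follows on expanding w as ∑ λ(w
  -- S⁻¹(Λ₍₂₎))Λ₍₁₎.
  have h1 : sliceL I.cointegral ((y ⊗ₜ[k] (1 : H)) * Δ I.integral) =
      swd (Δ y) (fun a b => I.modular a • S' b) := by
    rw [tmul_one_mul_comul_integral, map_swd]
    refine swd_congr _ fun a b => ?_
    rw [map_smul, sliceL_one_tmul_mul, sliceL_cointegral_comul, cointegral_integral, one_smul,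
      mul_one]
  have h2 := congrArg (fun z => I.cointegral (w * S' z)) h1
  rw [KLin.map_swd (φ := fun z => I.cointegral (w * S' z)) (by fun_prop), sliceL_tmul_one_mul,
    sliceL_eq_swd, KLin.map_swd (φ := fun z => I.cointegral (w * S' z)) (by fun_prop)] at h2
  have h3 := congrArg (fun z => I.cointegral (y * z)) (I.swd_cointegral_smul w)
  rw [KLin.map_swd (φ := fun z => I.cointegral (y * z)) (by fun_prop)] at h3
  refine h3.symm.trans (Eq.trans (swd_congr _ fun a b => ?_) (h2.trans (swd_congr _ fun a b => ?_)))
  · simp [mul_comm]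
  · simp

/-- `Λ₍₁₎ λ(y Λ₍₂₎) = α(y₍₁₎) g S⁻³(y₍₂₎)`. -/
lemma sliceR_one_tmul_mul_comul_integral' (y : H) :
    sliceR I.cointegral (((1 : H) ⊗ₜ[k] y) * Δ I.integral) =
      swd (Δ y) (fun a b => I.modular a • (I.distinguished * S' (S' (S' b)))) := by
  rw [sliceR_one_tmul_mul, sliceR_eq_swd]
  have h0 : ∀ a b : H, (I.cointegral ∘ₗ LinearMap.mulLeft k y) b • a =
      swd (Δ y) (fun c d => I.modular c • I.cointegral (b * S' (S' d))) • a := fun a b =>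
    congrArg (· • a) (I.cointegral_mul y b)
  rw [swd_congr _ h0]
  have : ∀ a b : H, swd (Δ y) (fun c d => I.modular c • I.cointegral (b * S' (S' d))) • a =
      swd (Δ y) (fun c d => I.modular c • I.cointegral (b * S' (S' d)) • a) := fun a b => by
    rw [KLin.map_swd (φ := fun z => z • a) (by fun_prop)]
    exact swd_congr _ fun c d => smul_assoc _ _ _
  rw [swd_congr _ this, swd_comm]
  refine swd_congr _ fun c d => ?_
  rw [← sliceR_cointegral_mul, sliceR_mul_one_tmul, sliceR_eq_swd,
    KLin.map_swd (φ := fun z => I.modular c • z) (by fun_prop)]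
  rfl

/-- `S⁴(Λ₍₁₎) S(Λ₍₃₎) λ(y Λ₍₂₎) = α(y) g`. -/
lemma swd_swd_comul_integral (y : H) :
    swd (Δ I.integral) (fun a b => swd (Δ b) (fun c d =>
      I.cointegral (y * c) • (S (S (S (S a))) * S d))) = I.modular y • I.distinguished := by
  -- Invariance of λ transfers the comultiplication from b to y. What remains is S⁴ of
  -- Λ₍₁₎λ(y₍₁₎Λ₍₂₎), known from the previous formula, and it yields α(y₍₁₎) g S(y₍₂₎)y₍₃₎.
  have h1 : ∀ b : H, swd (Δ b) (fun c d => I.cointegral (y * c) • S d) =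
      swd (Δ y) (fun p q => I.cointegral (p * b) • q) := fun b => by
    have h2 : sliceL I.cointegral ((y ⊗ₜ[k] (1 : H)) * Δ b) =
        swd (Δ y) (fun p q => I.cointegral (p * b) • S' q) := by
      rw [← swd_antipodeEquiv_symm_tmul_mul_comul,
        KLin.map_swd (φ := fun z => z * Δ b) (by fun_prop), map_swd]
      refine swd_congr _ fun p q => ?_
      rw [mul_assoc, sliceL_one_tmul_mul, ← Bialgebra.comul_mul, sliceL_cointegral_comul]
      simp
    rw [sliceL_tmul_one_mul, sliceL_eq_swd] at h2
    have h3 := congrArg (fun z => S z) h2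
    rw [KLin.map_swd (φ := fun z => S z) (by fun_prop),
      KLin.map_swd (φ := fun z => S z) (by fun_prop)] at h3
    simpa using h3
  calc _ = swd (Δ I.integral) (fun a b => swd (Δ y) (fun p q =>
        I.cointegral (p * b) • (S (S (S (S a))) * q))) := by
        refine swd_congr _ fun a b => ?_
        have := congrArg (fun z => S (S (S (S a))) * z) (h1 b)
        rw [KLin.map_swd (φ := fun z => S (S (S (S a))) * z) (by fun_prop),
          KLin.map_swd (φ := fun z => S (S (S (S a))) * z) (by fun_prop)] at this
        simpa only [mul_smul_comm] using this
    _ = swd (Δ y) (fun p q =>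
          S (S (S (S (sliceR I.cointegral (((1 : H) ⊗ₜ[k] p) * Δ I.integral))))) * q) := by
        rw [swd_comm]
        refine swd_congr _ fun p q => ?_
        rw [sliceR_one_tmul_mul, sliceR_eq_swd,
          KLin.map_swd (φ := fun z => S (S (S (S z))) * q) (by fun_prop)]
        simp
    _ = swd (Δ y) (fun p q => swd (Δ p) (fun r s =>
          I.modular r • (I.distinguished * (S s * q)))) := by
        refine swd_congr _ fun p q => ?_
        rw [sliceR_one_tmul_mul_comul_integral',
          KLin.map_swd (φ := fun z => S (S (S (S z))) * q) (by fun_prop)]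
        refine swd_congr _ fun r s => ?_
        simp [antipode_mul_antidistrib, antipode_antipode_distinguished, mul_assoc]
    _ = swd (Δ y) (fun p q => swd (Δ q) (fun r s =>
          I.modular p • (I.distinguished * (S r * s)))) :=
        swd_coassoc y (fun p r s => I.modular p • (I.distinguished * (S r * s)))
    _ = swd (Δ y) (fun p q => ε q • (I.modular p • I.distinguished)) := by
        refine swd_congr _ fun p q => ?_
        rw [swd_antipode_mul q (f := fun z => I.modular p • (I.distinguished * z)) (by fun_prop),
          mul_one]
    _ = _ := swd_counit_right y (f := fun p => I.modular p • I.distinguished) (by fun_prop)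

/-- Radford's formula, `α(x₍₁₎) α⁻¹(x₍₃₎) g x₍₂₎ = S⁴(x) g`. -/
lemma radford (x : H) :
    swd (Δ x) (fun a b => swd (Δ b) (fun c d =>
      (I.modular a * I.modular (S d)) • (I.distinguished * c))) =
      S (S (S (S x))) * I.distinguished := by
  -- The element Λ₍₁₎λ(xΛ₍₂₎) was computed in two ways. Equating the results and convolving with α ∘
  -- S isolates S(x)g.
  have h1 : ∀ x : H, S x * I.distinguished = swd (Δ x) (fun a b => swd (Δ b) (fun c d =>
      (I.modular a * I.modular (S d)) • (I.distinguished * S' (S' (S' c))))) := by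
    intro x
    symm
    calc _ = swd (Δ x) (fun a b => swd (Δ a) (fun c d =>
          (I.modular c * I.modular (S b)) • (I.distinguished * S' (S' (S' d))))) :=
          (swd_coassoc x (fun a c d =>
            (I.modular a * I.modular (S d)) • (I.distinguished * S' (S' (S' c))))).symm
      _ = swd (Δ x) (fun a b => swd (Δ a) (fun c d =>
          (I.modular d * I.modular (S b)) • (S c * I.distinguished))) := by
          refine swd_congr _ fun a b => ?_
          have := congrArg (fun z => I.modular (S b) • z)
            ((I.sliceR_one_tmul_mul_comul_integral' a).symm.trans
              (I.sliceR_one_tmul_mul_comul_integral a))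
          rw [KLin.map_swd (φ := fun z => I.modular (S b) • z) (by fun_prop),
            KLin.map_swd (φ := fun z => I.modular (S b) • z) (by fun_prop)] at this
          simpa only [smul_smul, mul_comm] using this
      _ = swd (Δ x) (fun a b => swd (Δ b) (fun c d =>
          (I.modular (c * S d)) • (S a * I.distinguished))) := by
          simp only [map_mul]
          exact swd_coassoc x (fun a c d => (I.modular c * I.modular (S d)) •
            (S a * I.distinguished))
      _ = swd (Δ x) (fun a b => ε b • (S a * I.distinguished)) := by
          refine swd_congr _ fun a b => ?_
          rw [swd_mul_antipode b (f := fun z => I.modular z • (S a * I.distinguished))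
            (by fun_prop)]
          simp
      _ = _ := swd_counit_right x (f := fun a => S a * I.distinguished) (by fun_prop)
  have h2 : ∀ (y : H) (T : H → H → H → H) (h1 : ∀ b c, KLin k (fun a => T a b c))
      (h2 : ∀ a c, KLin k (fun b => T a b c)) (h3 : ∀ a b, KLin k (fun c => T a b c)),
      swd (Δ (S y)) (fun a b => swd (Δ b) (fun c d => T a c d)) =
        swd (Δ y) (fun a b => swd (Δ b) (fun c d => T (S d) (S c) (S a))) := by
    intro y T h1 h2 h3
    rw [comul_antipode, swd_swd _ _ _ (by fun_prop) (by fun_prop)]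
    refine Eq.trans (swd_congr _ fun a b => ?_) (swd_coassoc y (fun a c d => T (S d) (S c) (S a)))
    rw [swd_tmul _ _ _ (by fun_prop) (by fun_prop), comul_antipode,
      swd_swd _ _ _ (by fun_prop) (by fun_prop)]
    refine swd_congr _ fun c d => ?_
    rw [swd_tmul _ _ _ (by fun_prop) (by fun_prop)]
  -- Used at S³(x): the three order reversals exchange the outer legs, and S³ under α turns α into α
  -- ∘ S and back, so the factors end as α(x₍₁₎) and α(S(x₍₃₎)).
  rw [h1, h2 _ _ (by fun_prop) (by fun_prop) (by fun_prop),
    h2 _ _ (by fun_prop) (by fun_prop) (by fun_prop),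
    h2 _ _ (by fun_prop) (by fun_prop) (by fun_prop)]
  refine swd_congr _ fun a b => swd_congr _ fun c d => ?_
  simp only [algHom_antipode_antipode, antipodeEquiv_symm_antipode, mul_comm]

end IntegralData

/-! ### Sweedler calculus for comodule algebras -/

namespace LeftComoduleAlgebra

open HopfAlgebra

variable {k : Type u} [Field k] {H : Type u} [Ring H] [HopfAlgebra k H]
variable {L : Type u} [Ring L] [Algebra k L] [LeftComoduleAlgebra k H L]
variable {V : Type*} [AddCommGroup V] [Module k V]

local notation "Δ" => (Coalgebra.comul : H →ₗ[k] H ⊗[k] H)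
local notation "ε" => (Coalgebra.counit : H →ₗ[k] k)
local notation "S" => (HopfAlgebra.antipode k : H →ₗ[k] H)
local notation "S'" => (LinearEquiv.symm (antipodeEquiv (k := k) (H := H)))
local notation "δ" => (coact : L →ₐ[k] H ⊗[k] L)

lemma swd_coact_coassoc (a : L) (T : H → H → L → V)
    (h1 : ∀ b c, KLin k (fun a => T a b c) := by fun_prop)
    (h2 : ∀ a c, KLin k (fun b => T a b c) := by fun_prop)
    (h3 : ∀ a b, KLin k (fun c => T a b c) := by fun_prop) :
    swd (δ a) (fun h l => swd (Δ h) (fun c d => T c d l)) =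
      swd (δ a) (fun h l => swd (δ l) (fun c d => T h c d)) :=
  swd_coassoc_of (show KLin k (fun x => δ x) by fun_prop) a (coassoc a) T h1 h2 h3

lemma swd_counit_coact (a : L) {f : L → V} (hf : KLin k f) :
    swd (δ a) (fun h l => ε h • f l) = f a := by
  have := counit_coact (k := k) (H := H) a
  rw [← swd_tmul_self (δ a), map_swd, KLin.map_swd (k := k)
    (φ := fun z => TensorProduct.lid k L z) (by fun_prop)] at this
  have h2 := congrArg f this
  rw [hf.map_swd] at h2
  refine Eq.trans (swd_congr _ fun h l => ?_) h2
  rw [LinearMap.rTensor_tmul, TensorProduct.lid_tmul, hf.2]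

/-- `(S(a₍₋₁₎) ⊗ 1) δ(a₍₀₎) = 1 ⊗ a`. -/
lemma swd_antipode_tmul_mul_coact (a : L) :
    swd (δ a) (fun h l => (S h ⊗ₜ[k] (1 : L)) * δ l) = 1 ⊗ₜ a := by
  calc _ = swd (δ a) (fun h l => swd (δ l) fun c d => (S h * c) ⊗ₜ[k] d) := by
        refine swd_congr _ fun h l => ?_
        conv_lhs => rw [← swd_tmul_self (δ l)]
        rw [KLin.map_swd (φ := fun z => S h ⊗ₜ[k] (1 : L) * z) (by fun_prop)]
        simp
    _ = swd (δ a) (fun h l => swd (Δ h) fun c d => (S c * d) ⊗ₜ[k] l) :=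
        (swd_coact_coassoc a (fun a b c => (S a * b) ⊗ₜ[k] c)).symm
    _ = swd (δ a) (fun h l => ε h • (1 : H) ⊗ₜ[k] l) := swd_congr _ fun h l =>
        swd_antipode_mul h (f := fun x => x ⊗ₜ[k] l) (by fun_prop)
    _ = _ := swd_counit_coact a (f := fun l => (1 : H) ⊗ₜ[k] l) (by fun_prop)

lemma coactLeft_apply (f : H →ₗ[k] k) (a : L) : coactLeft f a = sliceL f (δ a) := rfl

lemma coactRight_apply (f : L →ₗ[k] k) (a : L) : coactRight H f a = sliceR f (δ a) := rfl

lemma coactLeft_eq_swd (f : H →ₗ[k] k) (a : L) :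
    coactLeft f a = swd (δ a) (fun h l => f h • l) := by
  rw [coactLeft_apply, sliceL_eq_swd]

lemma coactRight_eq_swd (f : L →ₗ[k] k) (a : L) :
    coactRight H f a = swd (δ a) (fun h l => f l • h) := by
  rw [coactRight_apply, sliceR_eq_swd]

lemma counit_coactRight (f : L →ₗ[k] k) (a : L) : ε (coactRight H f a) = f a := by
  rw [coactRight_eq_swd, map_swd]
  refine Eq.trans (swd_congr _ fun h l => ?_) (swd_counit_coact a (f := fun l => f l) (by fun_prop))
  simp [mul_comm]

/-- `Δ(a₍₋₁₎ f(a₍₀₎)) = a₍₋₂₎ ⊗ a₍₋₁₎ f(a₍₀₎)`. -/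
lemma comul_coactRight (f : L →ₗ[k] k) (a : L) :
    Δ (coactRight H f a) = swd (δ a) (fun h l => h ⊗ₜ[k] coactRight H f l) := by
  calc _ = swd (δ a) (fun h l => swd (Δ h) (fun c d => f l • c ⊗ₜ[k] d)) := by
        conv_lhs => rw [coactRight_eq_swd, map_swd]
        refine swd_congr _ fun h l => ?_
        rw [map_smul, ← KLin.map_swd (φ := fun z => f l • z) (by fun_prop), swd_tmul_self]
    _ = swd (δ a) (fun h l => swd (δ l) (fun c d => f d • h ⊗ₜ[k] c)) :=
        swd_coact_coassoc a (fun c d l => f l • c ⊗ₜ[k] d)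
    _ = _ := by
        refine swd_congr _ fun h l => ?_
        rw [coactRight_eq_swd, KLin.map_swd (φ := fun z => h ⊗ₜ[k] z) (by fun_prop)]
        simp

/-- `δ(f(a₍₋₁₎) a₍₀₎) = f(a₍₋₂₎) a₍₋₁₎ ⊗ a₍₀₎`. -/
lemma coact_coactLeft (f : H →ₗ[k] k) (a : L) :
    δ (coactLeft f a) = swd (δ a) (fun h l => f h • δ l) := by
  rw [coactLeft_eq_swd, KLin.map_swd (φ := fun z => δ z) (by fun_prop)]
  simp

/-- `S(b₍₋₁₎) (b₍₀₎ c)₍₋₁₎ f((b₍₀₎ c)₍₀₎) = c₍₋₁₎ f(b c₍₀₎)`. -/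
lemma swd_antipode_mul_coactRight (f : L →ₗ[k] k) (b c : L) :
    swd (δ b) (fun h l => S h * coactRight H f (l * c)) =
      coactRight H (f ∘ₗ LinearMap.mulLeft k b) c := by
  rw [coactRight_apply, ← sliceR_one_tmul_mul, ← swd_antipode_tmul_mul_coact,
    KLin.map_swd (φ := fun z => sliceR f (z * δ c)) (by fun_prop)]
  refine swd_congr _ fun h l => ?_
  rw [mul_assoc, sliceR_tmul_one_mul, ← map_mul]
  rfl

section FiniteDimensional

variable [FiniteDimensional k H]

/-- `δ(a₍₀₎) (S⁻¹(a₍₋₁₎) ⊗ 1) = 1 ⊗ a`. -/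
lemma swd_coact_mul_antipodeEquiv_symm_tmul (a : L) :
    swd (δ a) (fun h l => δ l * (S' h ⊗ₜ[k] (1 : L))) = 1 ⊗ₜ a := by
  calc _ = swd (δ a) (fun h l => swd (δ l) fun c d => (c * S' h) ⊗ₜ[k] d) := by
        refine swd_congr _ fun h l => ?_
        conv_lhs => rw [← swd_tmul_self (δ l)]
        rw [KLin.map_swd (φ := fun z => z * S' h ⊗ₜ[k] (1 : L)) (by fun_prop)]
        simp
    _ = swd (δ a) (fun h l => swd (Δ h) fun c d => (d * S' c) ⊗ₜ[k] l) :=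
        (swd_coact_coassoc a (fun a b c => (b * S' a) ⊗ₜ[k] c)).symm
    _ = swd (δ a) (fun h l => ε h • (1 : H) ⊗ₜ[k] l) := swd_congr _ fun h l =>
        swd_mul_antipodeEquiv_symm h (f := fun x => x ⊗ₜ[k] l) (by fun_prop)
    _ = _ := swd_counit_coact a (f := fun l => (1 : H) ⊗ₜ[k] l) (by fun_prop)

/-- `(c a₍₀₎)₍₋₁₎ f((c a₍₀₎)₍₀₎) S⁻¹(a₍₋₁₎) = c₍₋₁₎ f(c₍₀₎ a)`. -/
lemma swd_coactRight_mul_antipodeEquiv_symm (f : L →ₗ[k] k) (c a : L) :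
    swd (δ a) (fun h l => coactRight H f (c * l) * S' h) =
      coactRight H (f ∘ₗ LinearMap.mulRight k a) c := by
  rw [coactRight_apply, ← sliceR_mul_one_tmul, ← swd_coact_mul_antipodeEquiv_symm_tmul,
    KLin.map_swd (φ := fun z => sliceR f (δ c * z)) (by fun_prop)]
  refine swd_congr _ fun h l => ?_
  rw [← mul_assoc, sliceR_mul_tmul_one, ← map_mul]
  rfl

end FiniteDimensional

/-- The algebra map `a ↦ α(a₍₋₁₎) a₍₀₎`. -/
def coactLeftHom (α : H →ₐ[k] k) : L →ₐ[k] L :=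
  ((Algebra.TensorProduct.lid k L).toAlgHom.comp
    (Algebra.TensorProduct.map α (AlgHom.id k L))).comp δ

lemma coactLeftHom_apply (α : H →ₐ[k] k) (a : L) :
    coactLeftHom α a = coactLeft α.toLinearMap a := rfl

lemma coactLeftHom_eq_swd (α : H →ₐ[k] k) (a : L) :
    coactLeftHom α a = swd (δ a) (fun h l => α h • l) := coactLeft_eq_swd _ _

/-- The left inverse is the same construction for α ∘ S, the convolution inverse of α. -/
lemma coactLeftHom_injective (α : H →ₐ[k] k) :
    Function.Injective (coactLeftHom α : L → L) := by
  refine Function.LeftInverse.injective (g := coactLeft (α.toLinearMap ∘ₗ S)) fun a => ?_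
  rw [coactLeftHom_eq_swd, map_swd]
  calc _ = swd (δ a) (fun h l => swd (δ l) (fun c d => (α h * α (S c)) • d)) := by
        refine swd_congr _ fun h l => ?_
        rw [map_smul, coactLeft_eq_swd, KLin.map_swd (φ := fun z => α h • z) (by fun_prop)]
        exact swd_congr _ fun c d => smul_smul _ _ _
    _ = swd (δ a) (fun h l => swd (Δ h) (fun c d => (α c * α (S d)) • l)) :=
        (swd_coact_coassoc a (fun h c d => (α h * α (S c)) • d)).symm
    _ = swd (δ a) (fun h l => ε h • l) := by
        refine swd_congr _ fun h l => ?_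
        simp only [← map_mul]
        rw [swd_mul_antipode h (f := fun z => α z • l) (by fun_prop)]
        simp
    _ = a := swd_counit_coact a (f := fun l => l) (by fun_prop)

end LeftComoduleAlgebra

namespace FrobeniusForm

variable {k : Type u} [Field k] {L : Type u} [Ring L] [Algebra k L] (F : FrobeniusForm k L)

lemma exists_eq_mulLeft (φ : L →ₗ[k] k) : ∃ c, φ = F.form ∘ₗ LinearMap.mulLeft k c := by
  obtain ⟨c, rfl⟩ := F.bijective.2 φ
  exact ⟨c, rfl⟩

lemma eq_of_form_mul_right {a b : L} (h : ∀ c, F.form (c * a) = F.form (c * b)) : a = b :=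
  eq_of_forall_dual (k := k) fun φ => by
    obtain ⟨c, rfl⟩ := F.exists_eq_mulLeft φ
    exact h c

lemma nakayama_injective : Function.Injective F.nakayama := fun a b hab =>
  F.eq_of_form_mul_right fun c => by
    rw [← F.form_nakayama_mul, hab, F.form_nakayama_mul]

variable [FiniteDimensional k L]

/-- Left and right multiplications under λ differ by ν, which is surjective by dimension. -/
lemma exists_eq_mulRight (φ : L →ₗ[k] k) : ∃ c, φ = F.form ∘ₗ LinearMap.mulRight k c := by
  obtain ⟨c, rfl⟩ := F.exists_eq_mulLeft φ
  obtain ⟨d, rfl⟩ := (LinearMap.injective_iff_surjective (f := F.nakayama.toLinearMap)).1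
    F.nakayama_injective c
  exact ⟨d, LinearMap.ext fun x => F.form_nakayama_mul d x⟩

lemma ext_form {V : Type*} [AddCommGroup V] [Module k V] {t s : V ⊗[k] L}
    (h : ∀ c, sliceR (F.form ∘ₗ LinearMap.mulRight k c) t =
      sliceR (F.form ∘ₗ LinearMap.mulRight k c) s) : t = s :=
  ext_sliceR fun ψ => by
    obtain ⟨c, rfl⟩ := F.exists_eq_mulRight ψ
    exact h c

lemma exists_dualBasis {ι : Type*} [Finite ι] [DecidableEq ι] (a : Module.Basis ι k L) :
    ∃ b : ι → L, ∀ i j, F.form (a i * b j) = if i = j then 1 else 0 := by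
  have h : ∀ j, ∃ c, a.coord j = F.form ∘ₗ LinearMap.mulRight k c := fun j =>
    F.exists_eq_mulRight _
  choose b hb using h
  refine ⟨b, fun i j => ?_⟩
  have := LinearMap.congr_fun (hb j) (a i)
  simp only [Module.Basis.coord_apply, Module.Basis.repr_self, Finsupp.single_apply] at this
  exact this.symm

section DualBasis

variable {F} {ι : Type*} [Fintype ι] [DecidableEq ι] {a : Module.Basis ι k L} {b : ι → L}

lemma sum_form_smul_basis
    (hab : ∀ i j, F.form (a i * b j) = if i = j then 1 else 0) (c : L) : ∑ j, F.form (c * b j) • a j = c := by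
  conv_rhs => rw [← a.sum_repr c]
  refine Finset.sum_congr rfl fun j _ => ?_
  congr 1
  have := congrArg (fun z => F.form (z * b j)) (a.sum_repr c)
  simp only [Finset.sum_mul, map_sum, smul_mul_assoc, map_smul, hab] at this
  simpa using this.symm

lemma sum_form_smul_dualBasis
    (hab : ∀ i j, F.form (a i * b j) = if i = j then 1 else 0) (c : L) : ∑ j, F.form (a j * c) • b j = c := by
  refine F.eq_of_form_mul_right fun x => ?_
  rw [← sum_form_smul_basis hab x]
  simp only [Finset.sum_mul, map_sum, Finset.mul_sum, smul_mul_assoc, mul_smul_comm, map_smul, hab]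
  simp [mul_comm]

end DualBasis

end FrobeniusForm

/-! ### The tensor that defines the twisted module structure -/

section SwdMap

variable {k : Type*} [CommRing k] {A B A' B' V W : Type*} [AddCommGroup A] [Module k A]
  [AddCommGroup B] [Module k B] [AddCommGroup A'] [Module k A'] [AddCommGroup B'] [Module k B']
  [AddCommGroup V] [Module k V] [AddCommGroup W] [Module k W]

lemma swd_map (f : A →ₗ[k] A') (g : B →ₗ[k] B') (t : A ⊗[k] B) (F : A' → B' → V)
    (h1 : ∀ b, KLin k (fun a => F a b)) (h2 : ∀ a, KLin k (fun b => F a b)) :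
    swd (TensorProduct.map f g t) F = swd t (fun a b => F (f a) (g b)) := by
  conv_lhs => rw [← swd_tmul_self t, map_swd]
  rw [swd_swd _ _ _ h1 h2]
  refine swd_congr _ fun a b => ?_
  rw [TensorProduct.map_tmul, swd_tmul _ _ _ h1 h2]

end SwdMap

section TripleSlice

variable {k : Type*} [Field k] {A B C : Type*} [AddCommGroup A] [Module k A]
  [AddCommGroup B] [Module k B] [AddCommGroup C] [Module k C]

lemma sliceR_assoc_symm (ψ : C →ₗ[k] k) (t : A ⊗[k] (B ⊗[k] C)) :
    sliceR ψ ((TensorProduct.assoc k A B C).symm t) = (sliceR ψ).lTensor A t := by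
  refine KLin.ext_tmul (k := k) (f := fun t => sliceR ψ ((TensorProduct.assoc k A B C).symm t))
    (g := fun t => (sliceR ψ).lTensor A t) (by fun_prop) (by fun_prop) (fun a s => ?_) t
  refine KLin.ext_tmul (k := k)
    (f := fun s => sliceR ψ ((TensorProduct.assoc k A B C).symm (a ⊗ₜ[k] s)))
    (g := fun s => (sliceR ψ).lTensor A (a ⊗ₜ[k] s)) (by fun_prop) (by fun_prop) (fun b c => ?_) s
  simp

end TripleSlice

namespace LeftComoduleAlgebra

open HopfAlgebra

variable {k : Type u} [Field k] {H : Type u} [Ring H] [HopfAlgebra k H]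
variable {L : Type u} [Ring L] [Algebra k L] [LeftComoduleAlgebra k H L]
variable {V : Type*} [AddCommGroup V] [Module k V]

local notation "Δ" => (Coalgebra.comul : H →ₗ[k] H ⊗[k] H)
local notation "ε" => (Coalgebra.counit : H →ₗ[k] k)
local notation "S" => (HopfAlgebra.antipode k : H →ₗ[k] H)
local notation "S'" => (LinearEquiv.symm (antipodeEquiv (k := k) (H := H)))
local notation "δ" => (coact : L →ₐ[k] H ⊗[k] L)

lemma swd_antipode_smul_coactLeftHom (α : H →ₐ[k] k) (a : L) :
    swd (δ a) (fun h l => α (S h) • coactLeftHom α l) = a := by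
  calc _ = swd (δ a) (fun h l => swd (δ l) (fun c d => (α (S h) * α c) • d)) := by
        refine swd_congr _ fun h l => ?_
        rw [coactLeftHom_eq_swd, KLin.map_swd (φ := fun z => α (S h) • z) (by fun_prop)]
        exact swd_congr _ fun c d => smul_smul _ _ _
    _ = swd (δ a) (fun h l => swd (Δ h) (fun c d => (α (S c) * α d) • l)) :=
        (swd_coact_coassoc a (fun h c d => (α (S h) * α c) • d)).symm
    _ = swd (δ a) (fun h l => ε h • l) := by
        refine swd_congr _ fun h l => ?_
        simp only [← map_mul]
        rw [swd_antipode_mul h (f := fun z => α z • l) (by fun_prop)]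
        simp
    _ = a := swd_counit_coact a (f := fun l => l) (by fun_prop)

/-! ### The form tensor, the twist tensor and their identities -/

section Elements

variable [FiniteDimensional k H] [FiniteDimensional k L]
variable (I : IntegralData k H) (F : FrobeniusForm k L)

/-- `(S⁴(b₍₋₁₎) g) ⊗ χ(b₍₀₎) = (g ⊗ 1) δ(χ(b))`, where `χ(b) = α(b₍₋₁₎) b₍₀₎`. -/
lemma swd_antipode_four_tmul (b : L) :
    swd (δ b) (fun h l => (S (S (S (S h))) * I.distinguished) ⊗ₜ[k] coactLeftHom I.modular l) =
      (I.distinguished ⊗ₜ[k] (1 : L)) * δ (coactLeftHom I.modular b) := by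
  -- Radford's formula replaces S⁴(h)g by α(h₍₁₎)α⁻¹(h₍₃₎) g h₍₂₎. By coassociativity the factor α⁻¹
  -- then cancels the α contained in χ.
  calc _ = swd (δ b) (fun h l => swd (Δ h) (fun a x => swd (Δ x) (fun c d =>
          (I.modular a * I.modular (S d)) •
            ((I.distinguished * c) ⊗ₜ[k] coactLeftHom I.modular l)))) := by
        refine swd_congr _ fun h l => ?_
        rw [← I.radford, KLin.map_swd (φ := fun z => z ⊗ₜ[k] coactLeftHom I.modular l)
          (by fun_prop)]
        refine swd_congr _ fun a x => ?_
        rw [KLin.map_swd (φ := fun z => z ⊗ₜ[k] coactLeftHom I.modular l) (by fun_prop)]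
        rfl
    _ = swd (δ b) (fun a y => swd (δ y) (fun h l => swd (Δ h) (fun c d =>
          (I.modular a * I.modular (S d)) •
            ((I.distinguished * c) ⊗ₜ[k] coactLeftHom I.modular l)))) :=
        swd_coact_coassoc b (fun a x l => swd (Δ x) (fun c d =>
          (I.modular a * I.modular (S d)) •
            ((I.distinguished * c) ⊗ₜ[k] coactLeftHom I.modular l)))
    _ = swd (δ b) (fun a y => I.modular a • ((I.distinguished ⊗ₜ[k] (1 : L)) * δ y)) := by
        refine swd_congr _ fun a y => ?_
        calc _ = swd (δ y) (fun c z => swd (δ z) (fun d l => (I.modular a * I.modular (S d)) •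
                ((I.distinguished * c) ⊗ₜ[k] coactLeftHom I.modular l))) :=
              swd_coact_coassoc y (fun c d l => (I.modular a * I.modular (S d)) •
                ((I.distinguished * c) ⊗ₜ[k] coactLeftHom I.modular l))
          _ = swd (δ y) (fun c z => I.modular a • ((I.distinguished * c) ⊗ₜ[k] z)) := by
              refine swd_congr _ fun c z => ?_
              conv_rhs => rw [← swd_antipode_smul_coactLeftHom I.modular z,
                KLin.map_swd (φ := fun z => I.modular a • ((I.distinguished * c) ⊗ₜ[k] z))
                  (by fun_prop)]
              refine swd_congr _ fun d l => ?_
              rw [TensorProduct.tmul_smul, smul_smul]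
          _ = _ := by
              conv_rhs => rw [← swd_tmul_self (δ y), KLin.map_swd (φ := fun z =>
                I.modular a • ((I.distinguished ⊗ₜ[k] (1 : L)) * z)) (by fun_prop)]
              simp
    _ = _ := by
        rw [coactLeftHom_apply, coact_coactLeft,
          KLin.map_swd (φ := fun z => (I.distinguished ⊗ₜ[k] (1 : L)) * z) (by fun_prop)]
        simp

variable (H) in
-- Since the forms λ(- c) exhaust the dual of `L`, this property determines the tensor. It frees the
-- identities below from dual bases, which return only in `formTensor_eq_sum`.
lemma exists_formTensor : ∃ B : H ⊗[k] L, ∀ c,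
    sliceR (F.form ∘ₗ LinearMap.mulRight k c) B = coactRight H F.form c := by
  classical
  obtain ⟨b, hab⟩ := F.exists_dualBasis (Module.finBasis k L)
  refine ⟨∑ j, coactRight H F.form (b j) ⊗ₜ[k] (Module.finBasis k L j), fun c => ?_⟩
  conv_rhs => rw [← F.sum_form_smul_dualBasis hab c]
  simp

variable (H) in
/-- The tensor `∑ⱼ b_{j(-1)} λ(b_{j(0)}) ⊗ a_j`, where `a` and `b` are dual bases of `L`. -/
def formTensor : H ⊗[k] L := (exists_formTensor H F).choose

lemma sliceR_formTensor (c : L) :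
    sliceR (F.form ∘ₗ LinearMap.mulRight k c) (formTensor H F) = coactRight H F.form c :=
  (exists_formTensor H F).choose_spec c

variable {F} in
lemma formTensor_eq_sum {ι : Type*} [Fintype ι] [DecidableEq ι] {a : Module.Basis ι k L}
    {b : ι → L} (hab : ∀ i j, F.form (a i * b j) = if i = j then 1 else 0) :
    formTensor H F = ∑ j, coactRight H F.form (b j) ⊗ₜ[k] a j := by
  refine F.ext_form fun c => ?_
  rw [sliceR_formTensor]
  conv_lhs => rw [← F.sum_form_smul_dualBasis hab c]
  simp

lemma sliceL_counit_formTensor : sliceL ε (formTensor H F) = 1 := by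
  refine F.eq_of_form_mul fun c => ?_
  have h := congrArg ε (sliceR_formTensor (H := H) F c)
  rw [counit_coactRight, sliceR_eq_swd, map_swd] at h
  rw [one_mul, ← h, sliceL_eq_swd, KLin.map_swd (φ := fun z => F.form (z * c)) (by fun_prop)]
  refine swd_congr _ fun x l => ?_
  simp [mul_comm]

/-- Slicing against λ(- c) gives c₍₋₁₎λ(c₍₀₎a) on the left and c₍₋₁₎λ(ν(a)c₍₀₎) on the right, which
are equal by the defining property of ν. -/
lemma swd_nakayama_formTensor (a : L) :
    swd (δ a) (fun h l => ((1 : H) ⊗ₜ[k] F.nakayama l) * formTensor H F *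
      (S' h ⊗ₜ[k] (1 : L))) =
    swd (δ (F.nakayama a)) (fun h l => (S h ⊗ₜ[k] (1 : L)) * formTensor H F *
      ((1 : H) ⊗ₜ[k] l)) := by
  refine F.ext_form fun c => ?_
  rw [map_swd, map_swd]
  have e1 : ∀ l : L, (F.form ∘ₗ LinearMap.mulRight k c) ∘ₗ LinearMap.mulLeft k (F.nakayama l) =
      F.form ∘ₗ LinearMap.mulRight k (c * l) := fun l => LinearMap.ext fun x => by
    simp only [LinearMap.comp_apply, LinearMap.mulRight_apply, LinearMap.mulLeft_apply]
    rw [mul_assoc, F.form_nakayama_mul, mul_assoc]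
  have e2 : ∀ l : L, (F.form ∘ₗ LinearMap.mulRight k c) ∘ₗ LinearMap.mulRight k l =
      F.form ∘ₗ LinearMap.mulRight k (l * c) := fun l => LinearMap.ext fun x => by
    simp [mul_assoc]
  have e3 : F.form ∘ₗ LinearMap.mulRight k a = F.form ∘ₗ LinearMap.mulLeft k (F.nakayama a) :=
    LinearMap.ext fun x => (F.form_nakayama_mul a x).symm
  simp only [sliceR_mul_tmul_one, sliceR_one_tmul_mul, sliceR_mul_one_tmul, e1, e2, mul_assoc,
    sliceR_tmul_one_mul, sliceR_formTensor, swd_coactRight_mul_antipodeEquiv_symm,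
    swd_antipode_mul_coactRight, e3]

/-- Sliced against λ(- c), both sides become c₍₋₁₎λ(c₍₀₎) ⊗ c₍₋₂₎. The comultiplication appears in
reversed order, which S³ will undo. -/
lemma swd_formTensor_comul :
    swd (formTensor H F) (fun x l => swd (δ l) (fun h m =>
      x ⊗ₜ[k] ((S h ⊗ₜ[k] (1 : L)) * formTensor H F * ((1 : H) ⊗ₜ[k] m)))) =
    swd (formTensor H F) (fun x l => swd (Δ x) (fun c d => d ⊗ₜ[k] (c ⊗ₜ[k] l))) := by
  apply (TensorProduct.assoc k H H L).symm.injective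
  refine F.ext_form fun c => ?_
  rw [sliceR_assoc_symm, sliceR_assoc_symm, map_swd, map_swd]
  have e2 : ∀ l : L, (F.form ∘ₗ LinearMap.mulRight k c) ∘ₗ LinearMap.mulRight k l =
      F.form ∘ₗ LinearMap.mulRight k (l * c) := fun l => LinearMap.ext fun x => by
    simp [mul_assoc]
  calc _ = swd (formTensor H F) (fun x l =>
          x ⊗ₜ[k] coactRight H (F.form ∘ₗ LinearMap.mulLeft k l) c) := by
        refine swd_congr _ fun x l => ?_
        rw [← swd_antipode_mul_coactRight, KLin.map_swd (φ := fun z => x ⊗ₜ[k] z) (by fun_prop),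
          map_swd]
        refine swd_congr _ fun h m => ?_
        rw [LinearMap.lTensor_tmul, mul_assoc, sliceR_tmul_one_mul, sliceR_mul_one_tmul, e2,
          sliceR_formTensor]
    _ = swd (δ c) (fun h m => coactRight H F.form m ⊗ₜ[k] h) := by
        simp only [coactRight_eq_swd (a := c), ← sliceR_formTensor]
        have : ∀ (x : H) (l : L),
            x ⊗ₜ[k] swd (δ c) (fun h m => (F.form ∘ₗ LinearMap.mulLeft k l) m • h) =
            swd (δ c) (fun h m => F.form (l * m) • x ⊗ₜ[k] h) := fun x l => by
          rw [KLin.map_swd (φ := fun z => x ⊗ₜ[k] z) (by fun_prop)]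
          simp
        simp only [this]
        rw [swd_comm]
        refine swd_congr _ fun h m => ?_
        rw [sliceR_eq_swd, KLin.map_swd (φ := fun z => z ⊗ₜ[k] h) (by fun_prop)]
        rfl
    _ = swd (Δ (coactRight H F.form c)) (fun p q => q ⊗ₜ[k] p) := by
        rw [comul_coactRight, swd_swd _ _ _ (by fun_prop) (by fun_prop)]
        refine swd_congr _ fun h m => ?_
        rw [swd_tmul _ _ _ (by fun_prop) (by fun_prop)]
    _ = _ := by
        rw [← sliceR_formTensor, sliceR_eq_swd, KLin.map_swd (φ := fun z =>
          swd (Δ z) (fun p q => q ⊗ₜ[k] p)) (by fun_prop)]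
        refine swd_congr _ fun x l => ?_
        rw [map_smul, (show KLin k fun z : H ⊗[k] H => swd z (fun p q => q ⊗ₜ[k] p) by fun_prop).2,
          map_swd, KLin.map_swd (φ := fun z => (F.form ∘ₗ LinearMap.mulRight k c) l • z)
            (by fun_prop)]
        simp

/-- The tensor `∑ⱼ S³(b_{j(-1)}) g λ(b_{j(0)}) ⊗ χ(a_j)`. -/
def twistTensor : H ⊗[k] L :=
  TensorProduct.map (LinearMap.mulRight k I.distinguished ∘ₗ S ∘ₗ S ∘ₗ S)
    (coactLeftHom I.modular).toLinearMap (formTensor H F)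

lemma twistTensor_eq_map_mul : twistTensor I F =
    TensorProduct.map (S ∘ₗ S ∘ₗ S) (coactLeftHom I.modular).toLinearMap (formTensor H F) *
      (I.distinguished ⊗ₜ[k] (1 : L)) := by
  rw [twistTensor, ← swd_tmul_self (formTensor H F), map_swd, map_swd,
    KLin.map_swd (φ := fun z => z * (I.distinguished ⊗ₜ[k] (1 : L))) (by fun_prop)]
  simp

lemma map_antipode_mul (α : H →ₐ[k] k) (x y : H) (l m : L) (t : H ⊗[k] L) :
    TensorProduct.map (S ∘ₗ S ∘ₗ S) (coactLeftHom α).toLinearMap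
      ((x ⊗ₜ[k] l) * t * (y ⊗ₜ[k] m)) =
    (S (S (S y)) ⊗ₜ[k] coactLeftHom α l) *
      TensorProduct.map (S ∘ₗ S ∘ₗ S) (coactLeftHom α).toLinearMap t *
      (S (S (S x)) ⊗ₜ[k] coactLeftHom α m) := by
  refine KLin.ext_tmul (k := k) (f := fun t => TensorProduct.map (S ∘ₗ S ∘ₗ S)
      (coactLeftHom α).toLinearMap ((x ⊗ₜ[k] l) * t * (y ⊗ₜ[k] m)))
    (g := fun t => (S (S (S y)) ⊗ₜ[k] coactLeftHom α l) *
      TensorProduct.map (S ∘ₗ S ∘ₗ S) (coactLeftHom α).toLinearMap t *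
      (S (S (S x)) ⊗ₜ[k] coactLeftHom α m)) (by fun_prop) (by fun_prop) (fun a b => ?_) t
  simp [antipode_mul_antidistrib, mul_assoc]

lemma twistedNakayama_apply (α : H →ₐ[k] k) (a : L) :
    twistedNakayama α F a = coactLeftHom α (F.nakayama a) := rfl

lemma twistedNakayama_bijective (α : H →ₐ[k] k) :
    Function.Bijective (twistedNakayama α F) := by
  have hinj : Function.Injective (twistedNakayama α F) := fun a b hab => by
    rw [twistedNakayama_apply, twistedNakayama_apply] at hab
    exact F.nakayama_injective (coactLeftHom_injective α hab)
  exact ⟨hinj, (LinearMap.injective_iff_surjective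
    (f := (twistedNakayama α F).toLinearMap)).1 hinj⟩

/-- `(S²(a₍₋₁₎) ⊗ ν'(a₍₀₎)) W = W δ(ν'(a))`. -/
lemma swd_twistedNakayama_mul_twistTensor (a : L) :
    swd (δ a) (fun h l => (S (S h) ⊗ₜ[k] twistedNakayama I.modular F l) * twistTensor I F) =
      twistTensor I F * δ (twistedNakayama I.modular F a) := by
  -- Apply S³ ⊗ χ and multiply by g ⊗ 1. On one side S³(S⁻¹(h)) = S²(h); on the other, S³(S(h)) =
  -- S⁴(h) is absorbed by Radford's formula and produces δ(ν'(a)).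
  have h := congrArg (fun z => TensorProduct.map (S ∘ₗ S ∘ₗ S)
    (coactLeftHom I.modular).toLinearMap z * (I.distinguished ⊗ₜ[k] (1 : L)))
    (swd_nakayama_formTensor (H := H) F a)
  rw [KLin.map_swd (φ := fun z => TensorProduct.map (S ∘ₗ S ∘ₗ S)
    (coactLeftHom I.modular).toLinearMap z * (I.distinguished ⊗ₜ[k] (1 : L))) (by fun_prop),
    KLin.map_swd (φ := fun z => TensorProduct.map (S ∘ₗ S ∘ₗ S)
    (coactLeftHom I.modular).toLinearMap z * (I.distinguished ⊗ₜ[k] (1 : L))) (by fun_prop)] at h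
  simp only [map_antipode_mul, antipode_antipodeEquiv_symm, antipode_one, map_one,
    ← Algebra.TensorProduct.one_def, one_mul, mul_one] at h
  refine Eq.trans (swd_congr _ fun x l => ?_) (h.trans ?_)
  · rw [twistTensor_eq_map_mul, mul_assoc]; rfl
  · simp only [mul_assoc, Algebra.TensorProduct.tmul_mul_tmul, mul_one]
    rw [← KLin.map_swd (φ := fun z => TensorProduct.map (S ∘ₗ S ∘ₗ S)
      (coactLeftHom I.modular).toLinearMap (formTensor H F) * z) (by fun_prop),
      swd_antipode_four_tmul, twistTensor_eq_map_mul, mul_assoc]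
    rfl

lemma comul_antipode_three_mul (x : H) : Δ (S (S (S x)) * I.distinguished) =
    swd (Δ x) (fun c d => (S (S (S d)) * I.distinguished) ⊗ₜ[k]
      (S (S (S c)) * I.distinguished)) := by
  rw [Bialgebra.comul_mul, I.comul_distinguished, comul_antipode, comul_antipode, comul_antipode]
  simp only [swd_swd _ _ (fun a b : H => S b ⊗ₜ[k] S a) (by fun_prop) (by fun_prop),
    swd_tmul _ _ (fun a b : H => S b ⊗ₜ[k] S a) (by fun_prop) (by fun_prop)]
  rw [KLin.map_swd (φ := fun z => z * I.distinguished ⊗ₜ[k] I.distinguished) (by fun_prop)]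
  simp

/-- `W₁ ⊗ W δ(W₂) = W₁₍₁₎ ⊗ W₁₍₂₎ ⊗ W₂`. -/
lemma swd_twistTensor_comul :
    swd (twistTensor I F) (fun x l => x ⊗ₜ[k] (twistTensor I F * δ l)) =
      swd (twistTensor I F) (fun x l => swd (Δ x) (fun c d => c ⊗ₜ[k] (d ⊗ₜ[k] l))) := by
  let f : H →ₗ[k] H := LinearMap.mulRight k I.distinguished ∘ₗ S ∘ₗ S ∘ₗ S
  have hf (x : H) : f x = S (S (S x)) * I.distinguished := rfl
  -- The map f = S³(-)g reverses the comultiplication, because g is grouplike, and so restores its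
  -- natural order; the factors S⁴ are again absorbed into δ ∘ χ.
  have h := congrArg (TensorProduct.map f
    (TensorProduct.map f (coactLeftHom I.modular).toLinearMap)) (swd_formTensor_comul (H := H) F)
  rw [map_swd, map_swd] at h
  conv_lhs => rw [twistTensor]
  conv_rhs => rw [twistTensor]
  rw [swd_map _ _ _ _ (by fun_prop) (by fun_prop), swd_map _ _ _ _ (by fun_prop) (by fun_prop)]
  refine Eq.trans (swd_congr _ fun x l => ?_) (h.trans (swd_congr _ fun x l => ?_))
  · rw [map_swd]
    have h2 := congrArg (fun z => f x ⊗ₜ[k] (TensorProduct.map (S ∘ₗ S ∘ₗ S)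
      (coactLeftHom I.modular).toLinearMap (formTensor H F) * z)) (swd_antipode_four_tmul I l)
    rw [KLin.map_swd (φ := fun z => f x ⊗ₜ[k] (TensorProduct.map (S ∘ₗ S ∘ₗ S)
      (coactLeftHom I.modular).toLinearMap (formTensor H F) * z)) (by fun_prop)] at h2
    refine Eq.trans ?_ (h2.symm.trans (swd_congr _ fun p q => ?_))
    · change f x ⊗ₜ[k] (twistTensor I F * δ (coactLeftHom I.modular l)) = _
      rw [twistTensor_eq_map_mul, mul_assoc]
    · rw [TensorProduct.map_tmul]
      congr 1
      have h3 : ∀ t : H ⊗[k] L, TensorProduct.map f (coactLeftHom I.modular).toLinearMap t =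
          TensorProduct.map (S ∘ₗ S ∘ₗ S) (coactLeftHom I.modular).toLinearMap t *
            (I.distinguished ⊗ₜ[k] (1 : L)) := fun t => by
        refine KLin.ext_tmul (k := k) (f := fun t => TensorProduct.map f
          (coactLeftHom I.modular).toLinearMap t) (g := fun t => TensorProduct.map (S ∘ₗ S ∘ₗ S)
            (coactLeftHom I.modular).toLinearMap t * (I.distinguished ⊗ₜ[k] (1 : L)))
          (by fun_prop) (by fun_prop) (fun a b => ?_) t
        simp [hf]
      rw [h3, map_antipode_mul]
      simp [antipode_one, mul_assoc, ← Algebra.TensorProduct.one_def]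
  · rw [map_swd]
    have h2 := comul_antipode_three_mul I x
    change _ = swd (Δ (S (S (S x)) * I.distinguished)) _
    rw [h2, swd_swd _ _ _ (by fun_prop) (by fun_prop)]
    refine swd_congr _ fun c d => ?_
    rw [swd_tmul _ _ _ (by fun_prop) (by fun_prop)]
    rfl

lemma sliceL_counit_twistTensor : sliceL ε (twistTensor I F) = 1 := by
  have h := congrArg (coactLeftHom I.modular) (sliceL_counit_formTensor (H := H) F)
  rw [sliceL_eq_swd, KLin.map_swd (φ := fun z => coactLeftHom I.modular z) (by fun_prop),
    map_one] at h
  rw [← h, sliceL_eq_swd, twistTensor, swd_map _ _ _ _ (by fun_prop) (by fun_prop)]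
  refine swd_congr _ fun x l => ?_
  simp [I.counit_distinguished, counit_antipode]

/-- The multiplicativity W₁ ⊗ Wδ(W₂) = Δ(W₁) ⊗ W₂ already exhibits δ(W₂)(S⁻¹(W₁) ⊗ 1) as a right
inverse. A right inverse suffices, since W acts on finite-dimensional spaces. -/
lemma exists_twistTensor_mul_eq_one : ∃ V : H ⊗[k] L, twistTensor I F * V = 1 := by
  refine ⟨swd (twistTensor I F) (fun x l => δ l * (S' x ⊗ₜ[k] (1 : L))), ?_⟩
  have h := congrArg (fun t : H ⊗[k] (H ⊗[k] L) => swd t (fun x z => z * (S' x ⊗ₜ[k] (1 : L))))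
    (swd_twistTensor_comul I F)
  rw [swd_swd _ _ _ (by fun_prop) (by fun_prop), swd_swd _ _ _ (by fun_prop) (by fun_prop)] at h
  rw [KLin.map_swd (φ := fun z => twistTensor I F * z) (by fun_prop)]
  refine Eq.trans (swd_congr _ fun x l => ?_) (h.trans ?_)
  · rw [swd_tmul _ _ _ (by fun_prop) (by fun_prop), mul_assoc]
  · calc _ = swd (twistTensor I F) (fun x l => ε x • (1 : H) ⊗ₜ[k] l) := by
          refine swd_congr _ fun x l => ?_
          rw [← swd_mul_antipodeEquiv_symm x (f := fun y => y ⊗ₜ[k] l) (by fun_prop),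
            swd_swd _ _ _ (by fun_prop) (by fun_prop)]
          refine swd_congr _ fun c d => ?_
          rw [swd_tmul _ _ _ (by fun_prop) (by fun_prop)]
          simp
      _ = 1 := by
          rw [Algebra.TensorProduct.one_def, ← sliceL_counit_twistTensor I F, sliceL_eq_swd,
            KLin.map_swd (φ := fun z => (1 : H) ⊗ₜ[k] z) (by fun_prop)]
          simp

lemma swd_comul_comul_eq_sum {n : ℕ} {x : H} {Λ₁ Λ₂ Λ₃ : Fin n → H}
    (h : (Δ).lTensor H (Δ x) = ∑ p, Λ₁ p ⊗ₜ[k] (Λ₂ p ⊗ₜ[k] Λ₃ p)) (T : H → H → H → V)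
    (h1 : ∀ b c, KLin k (fun a => T a b c)) (h2 : ∀ a c, KLin k (fun b => T a b c))
    (h3 : ∀ a b, KLin k (fun c => T a b c)) :
    swd (Δ x) (fun a b => swd (Δ b) (fun c d => T a c d)) = ∑ p, T (Λ₁ p) (Λ₂ p) (Λ₃ p) := by
  have e := congrArg (fun t : H ⊗[k] (H ⊗[k] H) => swd t (fun a z => swd z (fun c d => T a c d))) h
  rw [LinearMap.lTensor, swd_map _ _ _ _ (by fun_prop) (by fun_prop),
    swd_sum _ _ _ _ (by fun_prop) (by fun_prop)] at e
  refine Eq.trans ?_ (e.trans (Finset.sum_congr rfl fun p _ => ?_))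
  · rfl
  · rw [swd_tmul _ _ _ (by fun_prop) (by fun_prop)]

variable {F} in
-- With x = a_{j(-1)}, the sum over the three copies of Λ collapses through S⁴(Λ₍₁₎)S(Λ₍₃₎)λ(xΛ₍₂₎)
-- = α(x)g, and α(a_{j(-1)})a_{j(0)} is χ(a_j).
lemma twistTensor_eq_sum {ι : Type*} [Fintype ι] [DecidableEq ι] {a : Module.Basis ι k L}
    {b : ι → L} (hab : ∀ i j, F.form (a i * b j) = if i = j then 1 else 0)
    {n : ℕ} {Λ₁ Λ₂ Λ₃ : Fin n → H}
    (h : (Δ).lTensor H (Δ I.integral) = ∑ p, Λ₁ p ⊗ₜ[k] (Λ₂ p ⊗ₜ[k] Λ₃ p)) :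
    twistTensor I F = ∑ j, ∑ p, (S (S (S (S (Λ₁ p) * coactRight H F.form (b j)))) * S (Λ₃ p)) ⊗ₜ[k]
      coactLeft (I.cointegral ∘ₗ LinearMap.mulRight k (Λ₂ p)) (a j) := by
  rw [twistTensor, formTensor_eq_sum hab, map_sum]
  refine Finset.sum_congr rfl fun j _ => ?_
  generalize coactRight H F.form (b j) = u
  generalize a j = l
  have e1 : ∀ y c d : H, ((S (S (S (S y * u))) * S d) ⊗ₜ[k]
      coactLeft (I.cointegral ∘ₗ LinearMap.mulRight k c) l : H ⊗[k] L) =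
      swd (δ l) (fun x m => (S (S (S u)) * (I.cointegral (x * c) •
        (S (S (S (S y))) * S d))) ⊗ₜ[k] m) := fun y c d => by
    rw [coactLeft_eq_swd, KLin.map_swd (φ := fun z => (S (S (S (S y * u))) * S d) ⊗ₜ[k] z)
      (by fun_prop)]
    refine swd_congr _ fun x m => ?_
    simp [antipode_mul_antidistrib, mul_assoc, TensorProduct.smul_tmul]
  simp only [e1]
  rw [← swd_comul_comul_eq_sum h (T := fun y c d => swd (δ l) (fun x m =>
    (S (S (S u)) * (I.cointegral (x * c) • (S (S (S (S y))) * S d))) ⊗ₜ[k] m))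
    (by fun_prop) (by fun_prop) (by fun_prop)]
  have e2 : ∀ (x : H) (m : L), swd (Δ I.integral) (fun y b => swd (Δ b) (fun c d =>
      (S (S (S u)) * (I.cointegral (x * c) • (S (S (S (S y))) * S d))) ⊗ₜ[k] m)) =
      (S (S (S u)) * (I.modular x • I.distinguished)) ⊗ₜ[k] m := fun x m => by
    rw [← I.swd_swd_comul_integral, KLin.map_swd (φ := fun z => (S (S (S u)) * z) ⊗ₜ[k] m)
      (by fun_prop)]
    refine swd_congr _ fun y b => ?_
    rw [KLin.map_swd (φ := fun z => (S (S (S u)) * z) ⊗ₜ[k] m) (by fun_prop)]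
  have e3 : swd (Δ I.integral) (fun y b => swd (Δ b) (fun c d => swd (δ l) (fun x m =>
      (S (S (S u)) * (I.cointegral (x * c) • (S (S (S (S y))) * S d))) ⊗ₜ[k] m))) =
      swd (δ l) (fun x m => (S (S (S u)) * (I.modular x • I.distinguished)) ⊗ₜ[k] m) := by
    simp only [← e2]
    rw [swd_comm]
    exact swd_congr _ fun y b => swd_comm _ _ _
  rw [e3, TensorProduct.map_tmul]
  change _ ⊗ₜ[k] coactLeftHom I.modular l = _
  rw [coactLeftHom_eq_swd, KLin.map_swd (φ := fun z => _ ⊗ₜ[k] z) (by fun_prop)]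
  refine swd_congr _ fun x m => ?_
  rw [mul_smul_comm, TensorProduct.smul_tmul]
  rfl

end Elements

end LeftComoduleAlgebra

/-! ### Finite-dimensional modules: constructions and projectivity -/

namespace FDMod

section General

variable {k : Type u} [Field k] {A : Type u} [Ring A] [Algebra k A]

instance toModule (M : FDMod k A) : Module A M := Module.compHom M.carrier M.ρ.toRingHom

lemma smul_eq (M : FDMod k A) (a : A) (x : M) : a • x = M.ρ a x := rfl

instance (M : FDMod k A) : IsScalarTower k A M :=
  ⟨fun c a x => by rw [smul_eq, smul_eq, map_smul, LinearMap.smul_apply]⟩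

@[fun_prop] lemma klin_ρ {V : Type*} [AddCommGroup V] [Module k V] (M : FDMod k A) (m : M)
    {f : V → A} (hf : KLin k f) : KLin k (fun x => M.ρ (f x) m) :=
  ⟨fun a b => by rw [hf.1, map_add, LinearMap.add_apply],
    fun c a => by rw [hf.2, map_smul, LinearMap.smul_apply]⟩

variable (k) in
/-- A finite-dimensional module over a `k`-algebra, as an object of `FDMod k A`. -/
def of (V : Type u) [AddCommGroup V] [Module k V] [Module A V] [IsScalarTower k A V]
    [FiniteDimensional k V] : FDMod k A where
  carrier := V
  ρ := Algebra.lsmul k k V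

/-- The `A`-linear map underlying a morphism. -/
def toLinA {M N : FDMod k A} (f : M ⟶ N) : M →ₗ[A] N :=
  { lin f with map_smul' := fun a x => lin_comm f a x }

lemma epi_of_surjective {M N : FDMod k A} (f : M ⟶ N) (hf : Function.Surjective (lin f)) :
    Epi f where
  left_cancellation g h hgh := hom_ext (LinearMap.ext fun y => by
    obtain ⟨x, rfl⟩ := hf y
    exact LinearMap.congr_fun (congrArg lin hgh) x)

/-- Categorical projectivity is thereby usable as lifting along surjections: an epimorphism cannot
distinguish the projection modulo its range from zero. -/
lemma surjective_of_epi {M N : FDMod k A} (f : M ⟶ N) [Epi f] :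
    Function.Surjective (lin f) := by
  let R : Submodule A N := LinearMap.range (toLinA f)
  have : FiniteDimensional k (N ⧸ R) :=
    Module.Finite.of_surjective (R.mkQ.restrictScalars k) R.mkQ_surjective
  let q : N ⟶ of k (N ⧸ R) :=
    ofLin (M := N) (N := of k (N ⧸ R)) (R.mkQ.restrictScalars k) fun a x => rfl
  let z : N ⟶ of k (N ⧸ R) :=
    ofLin (M := N) (N := of k (N ⧸ R)) 0 fun a x => (smul_zero a).symm
  have hqz : q = z := by
    rw [← cancel_epi f]
    refine hom_ext (LinearMap.ext fun x => ?_)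
    exact (Submodule.Quotient.mk_eq_zero R).2 ⟨x, rfl⟩
  intro y
  have : R.mkQ y = 0 := LinearMap.congr_fun (congrArg lin hqz) y
  exact (Submodule.Quotient.mk_eq_zero R).1 this

variable (k A) in
lemma projective_regular [FiniteDimensional k A] : Projective (regular k A) where
  factors {E X} f e he := by
    obtain ⟨x, hx⟩ := surjective_of_epi e (lin f (1 : A))
    refine ⟨ofLin (M := regular k A) (N := E) (E.orbit x) fun a y => ?_, ?_⟩
    · exact LinearMap.congr_fun (map_mul E.ρ a y) x
    · refine hom_ext (LinearMap.ext fun (a : A) => ?_)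
      refine (lin_comm e a x).trans ?_
      rw [hx]
      exact (lin_comm f a (1 : A)).symm.trans (congrArg (lin f) (mul_one a))

lemma exists_lift {P B C : FDMod k A} (hP : Projective P) (p : B ⟶ C)
    (hp : Function.Surjective (lin p)) (g : P ⟶ C) : ∃ g' : P ⟶ B, g' ≫ p = g := by
  have := epi_of_surjective p hp
  exact hP.factors g p

/-- The elements `t i` of `P` and `t' i` of `Hom_A(P, A)` form a pair of dual bases. -/
def IsDualBases [FiniteDimensional k A] {P : FDMod k A} {n : ℕ} (t : Fin n → P)
    (t' : Fin n → (P ⟶ regular k A)) : Prop :=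
  ∀ x : P, ∑ i, P.ρ (lin (t' i) x : A) (t i) = x

/-- A `k`-basis of `P` generates it over `A`; the coordinates of a splitting of the resulting
surjection Aⁿ → P are the dual elements. -/
lemma exists_isDualBases [FiniteDimensional k A] {P : FDMod k A} (hP : Projective P) :
    ∃ (n : ℕ) (t : Fin n → P) (t' : Fin n → (P ⟶ regular k A)), IsDualBases t t' := by
  let n := Module.finrank k P
  let t : Fin n → P := Module.finBasis k P
  let B : FDMod k A := of k (Fin n → A)
  let p : B ⟶ P := ofLin (M := B) (N := P)
    (∑ i, P.orbit (t i) ∘ₗ (LinearMap.proj i : (Fin n → A) →ₗ[k] A)) (fun a x => by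
      rw [LinearMap.sum_apply, LinearMap.sum_apply, map_sum]
      refine Finset.sum_congr rfl fun i _ => ?_
      exact LinearMap.congr_fun (map_mul P.ρ a ((x : Fin n → A) i)) (t i))
  have hp_apply : ∀ x : Fin n → A, lin p x = ∑ i, P.ρ (x i) (t i) := fun x =>
    LinearMap.sum_apply _ _ _
  have hp : Function.Surjective (lin p) := fun x => by
    refine ⟨(fun i => algebraMap k A ((Module.finBasis k P).repr x i) : Fin n → A), ?_⟩
    rw [hp_apply]
    conv_rhs => rw [← (Module.finBasis k P).sum_repr x]
    refine Finset.sum_congr rfl fun i _ => ?_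
    rw [AlgHom.commutes]
    rfl
  obtain ⟨s, hs⟩ := exists_lift hP p hp (𝟙 P)
  refine ⟨n, t, fun i => s ≫ ofLin (M := B) (N := regular k A)
    (LinearMap.proj i : (Fin n → A) →ₗ[k] A) (fun a x => rfl), fun x => ?_⟩
  exact (hp_apply _).symm.trans (LinearMap.congr_fun (congrArg lin hs) x)

end General

section Exact

variable {k : Type u} [Field k] {H : Type u} [Ring H] [Bialgebra k H] [FiniteDimensional k H]
variable {L : Type u} [Ring L] [Algebra k L] [LeftComoduleAlgebra k H L]

lemma projective_regular_act (hL : IsExactModuleCategory (FDMod k H) (FDMod k L))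
    (M : FDMod k L) : Projective (regular k H ⊙ₗ M) :=
  hL _ M (projective_regular k H)

/-- The free module `H ⊗ M` over an `H`-comodule algebra. -/
abbrev free (H : Type u) [Ring H] [Bialgebra k H] [FiniteDimensional k H]
    [LeftComoduleAlgebra k H L] (M : FDMod k L) : FDMod k L := regular k H ⊙ₗ M

lemma free_ρ_tmul (M : FDMod k L) (a : L) (h : H) (m : M) :
    (free H M).ρ a (h ⊗ₜ[k] m : H ⊗[k] M) =
      (swd (LeftComoduleAlgebra.coact (k := k) (H := H) a)
        (fun x l => (x * h) ⊗ₜ[k] M.ρ l m) : H ⊗[k] M) := by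
  refine (tens_ρ_tmul _ (regular k H) M a h m).trans ?_
  conv_lhs => rw [← swd_tmul_self (LeftComoduleAlgebra.coact (k := k) (H := H) a)]
  rw [map_swd]
  rfl

/-- The action of `L` on the vector space `H ⊗ M`. -/
def freeAct (M : FDMod k L) (a : L) : H ⊗[k] M →ₗ[k] H ⊗[k] M := (free H M).ρ a

lemma freeAct_tmul (M : FDMod k L) (a : L) (h : H) (m : M) :
    freeAct M a (h ⊗ₜ[k] m) =
      swd (LeftComoduleAlgebra.coact (k := k) (H := H) a) (fun x l => (x * h) ⊗ₜ[k] M.ρ l m) :=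
  free_ρ_tmul M a h m

end Exact

end FDMod

/-! ### Exact comodule algebras are Frobenius -/

namespace IntegralData

open HopfAlgebra

variable {k : Type u} [Field k] {H : Type u} [Ring H] [HopfAlgebra k H] [FiniteDimensional k H]

/-- A cointegral is a Frobenius form. -/
def frobeniusForm (I : IntegralData k H) : FrobeniusForm k H where
  form := I.cointegral
  bijective := by
    have hinj : Function.Injective ((LinearMap.mul k H).compr₂ I.cointegral) := by
      rw [injective_iff_map_eq_zero]
      refine fun x hx => eq_of_forall_dual (k := k) fun φ => ?_
      obtain ⟨y, rfl⟩ := I.exists_cointegral_mulRight φ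
      rw [map_zero]
      exact LinearMap.congr_fun hx y
    exact ⟨hinj, (LinearMap.injective_iff_surjective_of_finrank_eq_finrank
      (Subspace.dual_finrank_eq (K := k) (V := H)).symm).1 hinj⟩

end IntegralData

/-! ### The dimension of Hom into the regular module -/

section HomDim

variable {k : Type u} [Field k] {L : Type u} [Ring L] [Algebra k L] [FiniteDimensional k L]
variable {V W : Type u} [AddCommGroup V] [Module k V] [Module L V] [IsScalarTower k L V]
  [FiniteDimensional k V] [AddCommGroup W] [Module k W] [Module L W] [IsScalarTower k L W]
  [FiniteDimensional k W]

instance finiteDimensional_linearMap : FiniteDimensional k (V →ₗ[L] L) :=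
  Module.Finite.of_injective (LinearMap.restrictScalarsₗ k L V L k)
    (LinearMap.restrictScalars_injective k)

instance finiteDimensional_submodule (N : Submodule L V) : FiniteDimensional k N :=
  Module.Finite.of_injective (N.subtype.restrictScalars k) N.injective_subtype

instance finiteDimensional_quotient (N : Submodule L V) : FiniteDimensional k (V ⧸ N) :=
  Module.Finite.of_surjective (N.mkQ.restrictScalars k) N.mkQ_surjective

variable (k L V) in
/-- The dimension of `Hom_L(V, L)`. -/
def homDim : ℕ := Module.finrank k (V →ₗ[L] L)

variable (k) in
/-- Precomposition with an `L`-linear map. -/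
def precomp (f : V →ₗ[L] W) : (W →ₗ[L] L) →ₗ[k] (V →ₗ[L] L) where
  toFun g := g ∘ₗ f
  map_add' _ _ := rfl
  map_smul' _ _ := rfl

lemma homDim_le_of_surjective (f : V →ₗ[L] W) (hf : Function.Surjective f) :
    homDim k L W ≤ homDim k L V :=
  LinearMap.finrank_le_finrank_of_injective (f := precomp k f) fun g h hgh =>
    LinearMap.ext fun y => by
      obtain ⟨x, rfl⟩ := hf y
      exact LinearMap.congr_fun hgh x

lemma finrank_submodule_add_quotient (N : Submodule L V) :
    Module.finrank k N + Module.finrank k (V ⧸ N) = Module.finrank k V := by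
  have h := LinearMap.finrank_range_add_finrank_ker (N.mkQ.restrictScalars k)
  rw [LinearMap.range_eq_top.2 (show Function.Surjective (N.mkQ.restrictScalars k) from
    N.mkQ_surjective), finrank_top] at h
  have h2 : LinearMap.ker (N.mkQ.restrictScalars k) = N.restrictScalars k := by
    ext x
    exact Submodule.Quotient.mk_eq_zero N
  rw [h2, add_comm] at h
  exact h

/-- Left exactness of Hom(-, L): the kernel of restriction to `N` factors through the quotient. -/
lemma homDim_le_add (N : Submodule L V) :
    homDim k L V ≤ homDim k L N + homDim k L (V ⧸ N) := by
  have h := LinearMap.finrank_range_add_finrank_ker (precomp k N.subtype)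
  have h1 := Submodule.finrank_le (LinearMap.range (precomp k N.subtype))
  have h2 : Module.finrank k (LinearMap.ker (precomp k N.subtype)) ≤ homDim k L (V ⧸ N) := by
    have h3 : LinearMap.ker (precomp k N.subtype) ≤ LinearMap.range (precomp k N.mkQ) := by
      intro f hf
      refine ⟨N.liftQ f fun x hx => ?_, ?_⟩
      · exact LinearMap.congr_fun hf ⟨x, hx⟩
      · exact N.liftQ_mkQ f _
    exact (Submodule.finrank_mono h3).trans (LinearMap.finrank_range_le _)
  unfold homDim at *
  omega

lemma homDim_prod : homDim k L V + homDim k L W ≤ homDim k L (V × W) := by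
  have h : Module.finrank k ((V →ₗ[L] L) × (W →ₗ[L] L)) ≤ homDim k L (V × W) :=
    (LinearMap.coprodEquiv k : ((V →ₗ[L] L) × (W →ₗ[L] L)) ≃ₗ[k] _).finrank_eq.le
  rwa [Module.finrank_prod] at h

lemma homDim_pi (n : ℕ) : n * homDim k L V ≤ homDim k L (Fin n → V) := by
  have h : Module.finrank k (Fin n → (V →ₗ[L] L)) ≤ homDim k L (Fin n → V) :=
    (LinearMap.lsum L (fun _ : Fin n => V) k :
      (Fin n → (V →ₗ[L] L)) ≃ₗ[k] _).finrank_eq.le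
  simpa [Module.finrank_pi_fintype, homDim] using h

end HomDim

namespace LeftComoduleAlgebra

open HopfAlgebra FDMod

variable {k : Type u} [Field k] {H : Type u} [Ring H] [HopfAlgebra k H] [FiniteDimensional k H]
variable {L : Type u} [Ring L] [Algebra k L] [LeftComoduleAlgebra k H L] [FiniteDimensional k L]

local notation "Δ" => (Coalgebra.comul : H →ₗ[k] H ⊗[k] H)
local notation "ε" => (Coalgebra.counit : H →ₗ[k] k)
local notation "S" => (HopfAlgebra.antipode k : H →ₗ[k] H)
local notation "S'" => (LinearEquiv.symm (antipodeEquiv (k := k) (H := H)))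
local notation "δ" => (coact : L →ₐ[k] H ⊗[k] L)

/-- The map x ⊗ b ↦ δ(b)(x ⊗ 1) has the left inverse y ⊗ c ↦ S⁻¹(c₍₋₁₎)y ⊗ c₍₀₎, so it preserves the
independence of the elements eᵢ over `L`. -/
lemma eq_zero_of_sum_coact_mul {n : ℕ} (e : Module.Basis (Fin n) k H) (a : Fin n → L)
    (h : ∑ i, δ (a i) * (e i ⊗ₜ[k] (1 : L)) = 0) : a = 0 := by
  have key : ∀ (x : H) (b : L), swd (δ b * (x ⊗ₜ[k] (1 : L))) (fun y c =>
      swd (δ c) (fun z d => (S' z * y) ⊗ₜ[k] d)) = x ⊗ₜ[k] b := by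
    intro x b
    rw [swd_mul _ _ _ (by fun_prop) (by fun_prop)]
    calc _ = swd (δ b) (fun y c => swd (δ c) (fun z d => (S' z * (y * x)) ⊗ₜ[k] d)) := by
          refine swd_congr _ fun y c => ?_
          rw [swd_tmul _ _ _ (by fun_prop) (by fun_prop), mul_one]
      _ = swd (δ b) (fun y c => swd (Δ y) (fun z d => (S' d * (z * x)) ⊗ₜ[k] c)) :=
          (swd_coact_coassoc b (fun y z d => (S' z * (y * x)) ⊗ₜ[k] d)).symm
      _ = swd (δ b) (fun y c => ε y • (x ⊗ₜ[k] c)) := by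
          refine swd_congr _ fun y c => ?_
          have := swd_antipodeEquiv_symm_mul (k := k) y (f := fun z => (z * x) ⊗ₜ[k] c)
            (by fun_prop)
          simpa only [mul_assoc, one_mul] using this
      _ = _ := swd_counit_coact b (f := fun c => x ⊗ₜ[k] c) (by fun_prop)
  have hR : KLin k fun t : H ⊗[k] L => swd t (fun y c =>
      swd (δ c) (fun z d => (S' z * y) ⊗ₜ[k] d)) := by fun_prop
  have h2 := congrArg hR.toLin h
  rw [map_sum, map_zero] at h2
  simp only [KLin.toLin_apply, key] at h2
  funext i
  have h3 := congrArg (sliceL (e.coord i)) h2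
  simpa [Finsupp.single_apply] using h3

/-- The `k`-linear map `h ⊗ m ↦ λ(S(h) f(m)₍₋₁₎ c) f(m)₍₀₎`. -/
def slicedLin (I : IntegralData k H) (M : FDMod k L) (f : M →ₗ[L] L) (c : H) :
    H ⊗[k] M →ₗ[k] L :=
  TensorProduct.lift (bilin
    (fun h m => sliceL I.cointegral ((S h ⊗ₜ[k] (1 : L)) *
      (δ (f.restrictScalars k m) * (c ⊗ₜ[k] (1 : L)))))
    (fun m => by fun_prop) (fun h => by fun_prop))

lemma slicedLin_tmul (I : IntegralData k H) (M : FDMod k L) (f : M →ₗ[L] L) (c h : H) (m : M) :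
    slicedLin I M f c (h ⊗ₜ[k] m) =
      sliceL I.cointegral ((S h ⊗ₜ[k] (1 : L)) * (δ (f m) * (c ⊗ₜ[k] (1 : L)))) := rfl

lemma slicedLin_ρ (I : IntegralData k H) (M : FDMod k L) (f : M →ₗ[L] L) (c : H) (a : L)
    (z : H ⊗[k] M) : slicedLin I M f c (freeAct M a z) = a * slicedLin I M f c z := by
  refine KLin.ext_tmul (k := k) (f := fun z => slicedLin I M f c (freeAct M a z))
    (g := fun z => a * slicedLin I M f c z) (by fun_prop) (by fun_prop) (fun h m => ?_) z
  rw [slicedLin_tmul, ← sliceL_one_tmul_mul]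
  have h1 : ((1 : H) ⊗ₜ[k] a) * ((S h ⊗ₜ[k] (1 : L)) * (δ (f m) * (c ⊗ₜ[k] (1 : L)))) =
      (S h ⊗ₜ[k] (1 : L)) * (((1 : H) ⊗ₜ[k] a) * (δ (f m) * (c ⊗ₜ[k] (1 : L)))) := by
    simp only [← mul_assoc, Algebra.TensorProduct.tmul_mul_tmul, one_mul, mul_one]
  rw [h1, ← swd_antipode_tmul_mul_coact, KLin.map_swd (φ := fun z => sliceL I.cointegral
    ((S h ⊗ₜ[k] (1 : L)) * (z * (δ (f m) * (c ⊗ₜ[k] (1 : L)))))) (by fun_prop),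
    freeAct_tmul, map_swd]
  refine swd_congr _ fun x l => ?_
  have h2 : f (M.ρ l m) = l * f m := f.map_smul l m
  rw [slicedLin_tmul, h2, map_mul δ l (f m), antipode_mul_antidistrib]
  simp only [← mul_assoc, Algebra.TensorProduct.tmul_mul_tmul, mul_one]

/-- The `L`-linear map `h ⊗ m ↦ λ(S(h) f(m)₍₋₁₎ c) f(m)₍₀₎`. -/
def slicedHom (I : IntegralData k H) (M : FDMod k L) (f : M →ₗ[L] L) (c : H) :
    free H M →ₗ[L] L :=
  { slicedLin I M f c with map_smul' := slicedLin_ρ I M f c }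

/-- Tensoring with `H` does not lower the ratio of dim Hom(M, L) to dim M. Each f : M → L and c in
`H` give a homomorphism on H ⊗ M. If a combination over a basis of `H` vanishes, then bijectivity of
S and non-degeneracy of the cointegral give ∑ δ(fᵢ(m))(eᵢ ⊗ 1) = 0, hence all fᵢ(m) = 0. -/
lemma finrank_mul_homDim_le (M : FDMod k L) :
    Module.finrank k H * homDim k L M ≤ homDim k L (free H M) := by
  obtain ⟨I⟩ := nonempty_integralData k H
  let e := Module.finBasis k H
  let T : (Fin (Module.finrank k H) → (M →ₗ[L] L)) →ₗ[k] (free H M →ₗ[L] L) :=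
    { toFun := fun f => ∑ i, slicedHom I M (f i) (e i)
      map_add' := fun f g => by
        rw [← Finset.sum_add_distrib]
        refine Finset.sum_congr rfl fun i _ => LinearMap.ext fun z => ?_
        refine LinearMap.congr_fun (f := slicedLin I M (f i + g i) (e i))
          (g := slicedLin I M (f i) (e i) + slicedLin I M (g i) (e i))
          (TensorProduct.ext' fun h m => ?_) z
        simp only [LinearMap.add_apply, slicedLin_tmul, map_add, add_mul, mul_add]
      map_smul' := fun r f => by
        rw [RingHom.id_apply, Finset.smul_sum]
        refine Finset.sum_congr rfl fun i _ => LinearMap.ext fun z => ?_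
        refine LinearMap.congr_fun (f := slicedLin I M (r • f i) (e i))
          (g := r • slicedLin I M (f i) (e i)) (TensorProduct.ext' fun h m => ?_) z
        simp only [LinearMap.smul_apply, slicedLin_tmul, map_smul, smul_mul_assoc,
          mul_smul_comm] }
  have hT : Function.Injective T := by
    rw [injective_iff_map_eq_zero]
    intro f hf
    have h1 : ∀ m, (fun i => f i m) = 0 := fun m => by
      refine eq_zero_of_sum_coact_mul (k := k) e _ ?_
      have h2 : ∀ φ : H →ₗ[k] k, sliceL φ (∑ i, δ (f i m) * (e i ⊗ₜ[k] (1 : L))) = 0 := by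
        intro φ
        obtain ⟨y, rfl⟩ := I.frobeniusForm.exists_eq_mulLeft φ
        have h3 := LinearMap.congr_fun hf ((S' y) ⊗ₜ[k] m : H ⊗[k] M)
        have h4 : (∑ i, slicedHom I M (f i) (e i)) ((S' y) ⊗ₜ[k] m : H ⊗[k] M) =
          ∑ i, sliceL I.cointegral ((S (S' y) ⊗ₜ[k] (1 : L)) *
            (δ (f i m) * (e i ⊗ₜ[k] (1 : L)))) := LinearMap.sum_apply _ _ _
        change (∑ i, slicedHom I M (f i) (e i)) ((S' y) ⊗ₜ[k] m : H ⊗[k] M) = 0 at h3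
        rw [h4, antipode_antipodeEquiv_symm] at h3
        rw [map_sum, ← h3]
        refine Finset.sum_congr rfl fun i _ => ?_
        rw [sliceL_tmul_one_mul]
        rfl
      generalize (∑ i, δ (f i m) * (e i ⊗ₜ[k] (1 : L))) = t at h2
      have h5 : ∀ t : H ⊗[k] L, ∑ i, e i ⊗ₜ[k] sliceL (e.coord i) t = t := by
        refine KLin.ext_tmul (by fun_prop) (by fun_prop) fun a b => ?_
        simp only [sliceL_tmul, ← TensorProduct.smul_tmul, ← TensorProduct.sum_tmul]
        congr 1
        exact e.sum_repr a
      rw [← h5 t]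
      simp [h2]
    funext i
    exact LinearMap.ext fun m => congrFun (h1 m) i
  have h := LinearMap.finrank_le_finrank_of_injective hT
  simpa [Module.finrank_pi_fintype, homDim] using h

/-- The annihilator of a finite-dimensional module. -/
abbrev ann (M : FDMod k L) : Submodule L L := Module.annihilator L M

/-- Only the finitely many dimension pairs of modules of dimension at most dim L matter. A larger
module contains a proper nonzero cyclic submodule, and subadditivity of `homDim` carries the bound
from the submodule and the quotient to the module. -/
lemma exists_max_ratio [Nontrivial L] : ∃ r : ℚ, (∀ M : FDMod k L,
    (homDim k L M : ℚ) ≤ r * Module.finrank k M) ∧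
    ∃ M : FDMod k L, 0 < Module.finrank k M ∧ (homDim k L M : ℚ) = r * Module.finrank k M := by
  let D := Module.finrank k L
  let T : Set (ℕ × ℕ) := {p | ∃ M : FDMod k L, 0 < Module.finrank k M ∧
    Module.finrank k M ≤ D ∧ p = (homDim k L M, Module.finrank k M)}
  have hfin : T.Finite := by
    refine Set.Finite.subset ((Set.finite_Iic (D * D)).prod (Set.finite_Iic D)) ?_
    rintro _ ⟨M, -, h2, rfl⟩
    refine ⟨?_, h2⟩
    have h3 : homDim k L M ≤ Module.finrank k (M →ₗ[k] L) :=
      LinearMap.finrank_le_finrank_of_injective (f := LinearMap.restrictScalarsₗ k L M L k)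
        (LinearMap.restrictScalars_injective k)
    rw [Module.finrank_linearMap] at h3
    exact h3.trans (Nat.mul_le_mul_right _ h2)
  have hne : T.Nonempty := ⟨_, of k L, Module.finrank_pos (R := k) (M := L), le_rfl, rfl⟩
  obtain ⟨_, ⟨M0, h1, h2, rfl⟩, hmax⟩ :=
    Set.exists_max_image T (fun p => (p.1 : ℚ) / p.2) hfin hne
  have hd : (0 : ℚ) < Module.finrank k M0 := by exact_mod_cast h1
  refine ⟨(homDim k L M0 : ℚ) / Module.finrank k M0, ?_, M0, h1, by field_simp⟩
  have key : ∀ (n : ℕ) (M : FDMod k L), Module.finrank k M ≤ n →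
      (homDim k L M : ℚ) ≤ (homDim k L M0 : ℚ) / Module.finrank k M0 * Module.finrank k M := by
    intro n
    induction n with
    | zero =>
      intro M hM
      have : Subsingleton M := Module.finrank_zero_iff.1 (Nat.le_zero.1 hM)
      have h3 : homDim k L M = 0 := Module.finrank_zero_of_subsingleton
      simp [h3, Nat.le_zero.1 hM]
    | succ n ih =>
      intro M hM
      by_cases h3 : Module.finrank k M ≤ n
      · exact ih M h3
      have h4 : 0 < Module.finrank k M := by omega
      by_cases h5 : Module.finrank k M ≤ D
      · have := hmax _ ⟨M, h4, h5, rfl⟩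
        have h6 : (0 : ℚ) < Module.finrank k M := by exact_mod_cast h4
        exact (div_le_iff₀ h6).1 this
      have : Nontrivial M := Module.finrank_pos_iff.1 h4
      obtain ⟨x, hx⟩ := exists_ne (0 : M)
      let N : Submodule L M := Submodule.span L {x}
      have hN : Module.finrank k N ≤ D := by
        have hs : Function.Surjective ((LinearMap.toSpanSingleton L M x).rangeRestrict) :=
          LinearMap.surjective_rangeRestrict _
        have := LinearMap.finrank_le_finrank_of_surjective (R := k)
          (f := ((LinearMap.toSpanSingleton L M x).rangeRestrict).restrictScalars k) hs
        rw [← LinearMap.span_singleton_eq_range] at this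
        exact this
      have hN0 : 0 < Module.finrank k N := by
        have : Nontrivial N := ⟨⟨⟨x, Submodule.mem_span_singleton_self x⟩, 0, fun h =>
          hx (congrArg Subtype.val h)⟩⟩
        exact Module.finrank_pos
      have hadd := finrank_submodule_add_quotient (k := k) N
      have e1 : (homDim k L N : ℚ) ≤ _ := ih (of k N) (by change Module.finrank k N ≤ n; omega)
      have e2 : (homDim k L (M ⧸ N) : ℚ) ≤ _ :=
        ih (of k (M ⧸ N)) (by change Module.finrank k (M ⧸ N) ≤ n; omega)
      have e3 : (homDim k L M : ℚ) ≤ homDim k L N + homDim k L (M ⧸ N) := by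
        exact_mod_cast homDim_le_add (k := k) N
      have e4 : (Module.finrank k M : ℚ) = Module.finrank k N + Module.finrank k (M ⧸ N) := by
        exact_mod_cast hadd.symm
      rw [e4, mul_add]
      exact e3.trans (add_le_add e1 e2)
  exact fun M => key _ M le_rfl

end LeftComoduleAlgebra

/-! ### Stable ideals and the bound on Hom into the regular module -/

namespace LeftComoduleAlgebra

open HopfAlgebra FDMod

variable {k : Type u} [Field k] {H : Type u} [Ring H] [HopfAlgebra k H] [FiniteDimensional k H]
variable {L : Type u} [Ring L] [Algebra k L] [LeftComoduleAlgebra k H L] [FiniteDimensional k L]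

local notation "ε" => (Coalgebra.counit : H →ₗ[k] k)
local notation "S'" => (LinearEquiv.symm (antipodeEquiv (k := k) (H := H)))
local notation "δ" => (coact : L →ₐ[k] H ⊗[k] L)

variable (H) in
/-- The morphism `h ⊗ m ↦ ε(h) m`. -/
def counitAct (M : FDMod k L) : free H M ⟶ M :=
  ofLin (M := free H M) (N := M) ((TensorProduct.lid k M).toLinearMap ∘ₗ (ε).rTensor M)
    (fun a z => by
      refine KLin.ext_tmul (k := k) (f := fun z => ((TensorProduct.lid k M).toLinearMap ∘ₗ
        (ε).rTensor M) (freeAct M a z)) (g := fun z => M.ρ a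
          (((TensorProduct.lid k M).toLinearMap ∘ₗ (ε).rTensor M) z)) (by fun_prop) (by fun_prop)
        (fun h m => ?_) z
      rw [freeAct_tmul, map_swd]
      have h1 := swd_counit_coact (k := k) (H := H) a (f := fun l => ε h • M.ρ l m)
        (by fun_prop)
      refine Eq.trans (swd_congr _ fun x l => ?_) (h1.trans ?_)
      · simp [mul_smul]
      · simp)

lemma counitAct_tmul (M : FDMod k L) (h : H) (m : M) :
    lin (counitAct H M) (h ⊗ₜ[k] m : H ⊗[k] M) = ε h • m := by
  change ((TensorProduct.lid k M).toLinearMap ∘ₗ (ε).rTensor M) (h ⊗ₜ[k] m : H ⊗[k] M) = _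
  simp

/-- The left ideal of the elements annihilated by `I`. -/
def rightAnn (I : Ideal L) [I.IsTwoSided] : Submodule L L where
  carrier := {a | ∀ i ∈ I, i * a = 0}
  zero_mem' := fun i _ => mul_zero i
  add_mem' := fun ha hb i hi => by rw [mul_add, ha i hi, hb i hi, add_zero]
  smul_mem' := fun c a ha i hi => by
    rw [smul_eq_mul, ← mul_assoc]
    exact ha _ (I.mul_mem_right c hi)

/-- If `δ(I) ⊆ H ⊗ I`, then `I` meets its right annihilator trivially. -/
lemma disjoint_rightAnn (hL : IsExactModuleCategory (FDMod k H) (FDMod k L))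
    (I : Ideal L) [I.IsTwoSided] (hI : ∀ a ∈ I, ∀ φ : H →ₗ[k] k, sliceL φ (δ a) ∈ I) (b : L)
    (hb : b ∈ I) (hb' : b ∈ rightAnn I) : b = 0 := by
  let A := rightAnn I
  let R : FDMod k L := regular k L
  let Q : FDMod k L := of k (L ⧸ A)
  let q : R ⟶ Q := ofLin (M := R) (N := Q) (A.mkQ.restrictScalars k) (fun a x => rfl)
  let π : free H R ⟶ free H Q := regular k H ⊴ₗ q
  have hπ : ∀ z, lin π z = (A.mkQ.restrictScalars k).lTensor H (z : H ⊗[k] L) := fun z => rfl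
  have hπs : Function.Surjective (lin π) :=
    LinearMap.lTensor_surjective H (g := A.mkQ.restrictScalars k) A.mkQ_surjective
  obtain ⟨σ, hσ⟩ := exists_lift (projective_regular_act hL Q) π hπs (𝟙 _)
  have hσ' : ∀ z, lin π (lin σ z) = z := fun z => LinearMap.congr_fun (congrArg lin hσ) z
  have hnat : ∀ z, lin q (lin (counitAct H R) z) = lin (counitAct H Q) (lin π z) := fun z => by
    refine LinearMap.congr_fun (f := lin q ∘ₗ lin (counitAct H R))
      (g := lin (counitAct H Q) ∘ₗ lin π) (TensorProduct.ext' fun (h : H) (l : L) => ?_) z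
    refine (congrArg (lin q) (counitAct_tmul R h l)).trans ?_
    refine Eq.trans ?_ (counitAct_tmul Q h (A.mkQ l)).symm
    exact map_smul (lin q) _ _
  -- The section σ exists because H ⊗ (L/A) is projective. The map g is `L`-linear, has values in A,
  -- and fixes b on 1 ⊗ b because b lies in A.
  let g : free H R →ₗ[k] R := lin (counitAct H R) ∘ₗ (LinearMap.id - lin σ ∘ₗ lin π)
  have hg1 : ∀ z, (g z : L) ∈ A := fun z => by
    have h1 : lin q (g z) = 0 := by
      refine (hnat _).trans ?_
      have h2 : lin π ((LinearMap.id - lin σ ∘ₗ lin π : free H R →ₗ[k] free H R) z) = 0 := by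
        rw [LinearMap.sub_apply, map_sub, LinearMap.id_apply, LinearMap.comp_apply, hσ', sub_self]
      rw [h2, map_zero]
    exact (Submodule.Quotient.mk_eq_zero A).1 h1
  have hg2 : ∀ a z, g ((free H R).ρ a z) = R.ρ a (g z) := fun a z => by
    simp only [g, LinearMap.comp_apply, LinearMap.sub_apply, LinearMap.id_apply, lin_comm,
      map_sub]
  let w : free H R := ((1 : H) ⊗ₜ[k] b : H ⊗[k] L)
  have hg3 : (g w : L) = b := by
    have h1 : lin π w = 0 := by
      refine (hπ w).trans ?_
      change (A.mkQ.restrictScalars k).lTensor H ((1 : H) ⊗ₜ[k] b) = 0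
      rw [LinearMap.lTensor_tmul]
      have : (A.mkQ.restrictScalars k) b = 0 := (Submodule.Quotient.mk_eq_zero A).2 hb'
      rw [this, TensorProduct.tmul_zero]
    have h2 : g w = lin (counitAct H R) w := by
      simp only [g, LinearMap.comp_apply, LinearMap.sub_apply, LinearMap.id_apply, h1, map_zero,
        sub_zero]
    refine h2.trans ((counitAct_tmul R (1 : H) b).trans ?_)
    rw [Bialgebra.counit_one]
    exact one_smul k b
  let G : H ⊗[k] L →ₗ[k] L := g
  have hG : ∀ (h : H) (l : L), G (δ l * (S' h ⊗ₜ[k] (1 : L))) = l * G (S' h ⊗ₜ[k] (1 : L)) := by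
    intro h l
    refine Eq.trans (congrArg G ?_) (hg2 l ((S' h) ⊗ₜ[k] (1 : L) : H ⊗[k] L))
    refine Eq.trans ?_ (freeAct_tmul R l (S' h) (1 : L)).symm
    conv_lhs => rw [← swd_tmul_self (δ l), KLin.map_swd
      (φ := fun z => z * (S' h ⊗ₜ[k] (1 : L))) (by fun_prop)]
    exact swd_congr _ fun x y => Algebra.TensorProduct.tmul_mul_tmul _ _ _ _
  -- Writing 1 ⊗ b as δ(b₍₀₎)(S⁻¹(b₍₋₁₎) ⊗ 1) and using linearity of g expresses b as a sum of
  -- products of elements b₍₀₎ of I with values of g in A. Such products vanish.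
  have h1 : b = swd (δ b) (fun h l => l * G (S' h ⊗ₜ[k] (1 : L))) := by
    conv_lhs => rw [← hg3]
    change G ((1 : H) ⊗ₜ[k] b) = _
    rw [← swd_coact_mul_antipodeEquiv_symm_tmul, map_swd]
    exact swd_congr _ fun h l => hG h l
  rw [h1]
  let e := Module.finBasis k H
  have h5 : ∀ t : H ⊗[k] L, ∑ i, e i ⊗ₜ[k] sliceL (e.coord i) t = t := by
    refine KLin.ext_tmul (by fun_prop) (by fun_prop) fun a b => ?_
    simp only [sliceL_tmul, ← TensorProduct.smul_tmul, ← TensorProduct.sum_tmul]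
    congr 1
    exact e.sum_repr a
  rw [← h5 (δ b), swd_sum _ _ _ _ (by fun_prop) (by fun_prop)]
  exact Finset.sum_eq_zero fun i _ => hg1 _ _ (hI b hb _)

/-- Let r be the maximal ratio dim Hom(M, L)/dim M, and let N attain it with an annihilator I of
least dimension. Every extremal module is killed by I. As H ⊗ N is extremal, I is stable under the
coaction, so exactness makes I meet its right annihilator trivially. Therefore dim Hom(L/I, L) ≤ dim
L/I; but L/I is itself extremal, which gives r ≤ 1. -/
lemma homDim_le_finrank (hL : IsExactModuleCategory (FDMod k H) (FDMod k L)) (M : FDMod k L) :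
    homDim k L M ≤ Module.finrank k M := by
  rcases subsingleton_or_nontrivial L with hsub | hnon
  · have : homDim k L M = 0 := Module.finrank_zero_of_subsingleton
    omega
  obtain ⟨r, hle, M0, hM0, hM0'⟩ := exists_max_ratio (k := k) (L := L)
  let T : Set (FDMod k L) := {M | 0 < Module.finrank k M ∧
    (homDim k L M : ℚ) = r * Module.finrank k M}
  obtain ⟨N, ⟨hN1, hN2⟩, hmin⟩ := WellFounded.has_min
    (measure fun M : FDMod k L => Module.finrank k (ann M)).wf T ⟨M0, hM0, hM0'⟩
  let I : Ideal L := ann N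
  -- The module N × M' is extremal and its annihilator lies in I, so minimality forces equality.
  have hkill : ∀ M' : FDMod k L, (homDim k L M' : ℚ) = r * Module.finrank k M' →
      ∀ a ∈ I, ∀ m : M', a • m = 0 := by
    intro M' hM' a ha m
    let P : FDMod k L := of k (N × M')
    have hP1 : Module.finrank k P = Module.finrank k N + Module.finrank k M' :=
      Module.finrank_prod
    have hP2 : (homDim k L P : ℚ) = r * Module.finrank k P := by
      refine le_antisymm (hle P) ?_
      rw [hP1, Nat.cast_add, mul_add, ← hN2, ← hM']
      exact_mod_cast homDim_prod (k := k) (L := L) (V := N) (W := M')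
    have hP3 : ann P ≤ I := fun x hx => Module.mem_annihilator.2 fun n =>
      congrArg Prod.fst (Module.mem_annihilator.1 hx ((n, 0) : N × M'))
    have hP4 := hmin P ⟨by omega, hP2⟩
    have hP5 : Module.finrank k I ≤ Module.finrank k (ann P) := not_lt.1 hP4
    have hP6 : (ann P).restrictScalars k = I.restrictScalars k :=
      Submodule.eq_of_le_of_finrank_le (fun x hx => hP3 hx) hP5
    have hP7 : a ∈ (ann P).restrictScalars k := by rw [hP6]; exact ha
    exact congrArg Prod.snd (Module.mem_annihilator.1 hP7 ((0, m) : N × M'))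
  have hI : ∀ a ∈ I, ∀ φ : H →ₗ[k] k, sliceL φ (δ a) ∈ I := by
    intro a ha φ
    refine Module.mem_annihilator.2 fun m => ?_
    have hQ : (homDim k L (free H N) : ℚ) = r * Module.finrank k (free H N) := by
      refine le_antisymm (hle _) ?_
      have e1 : Module.finrank k (free H N) = Module.finrank k H * Module.finrank k N :=
        Module.finrank_tensorProduct
      have e2 : (Module.finrank k H * homDim k L N : ℚ) ≤ homDim k L (free H N) := by
        exact_mod_cast finrank_mul_homDim_le (H := H) N
      rw [e1, Nat.cast_mul]
      rw [hN2] at e2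
      linarith
    have h1 := hkill _ hQ a ha ((1 : H) ⊗ₜ[k] m : H ⊗[k] N)
    have h2 : freeAct N a ((1 : H) ⊗ₜ[k] m) = 0 := h1
    rw [freeAct_tmul] at h2
    have h3 := congrArg (sliceL φ) h2
    rw [map_swd, map_zero] at h3
    change N.ρ (sliceL φ (δ a)) m = 0
    rw [sliceL_eq_swd, KLin.map_swd (k := k) (φ := fun z => N.ρ z m) (by fun_prop), ← h3]
    refine swd_congr _ fun x l => ?_
    simp
  have hAI := disjoint_rightAnn hL I hI
  have hd1 : Module.finrank k (rightAnn I) ≤ Module.finrank k (L ⧸ I) := by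
    let f : rightAnn I →ₗ[L] L ⧸ I := (Submodule.mkQ I) ∘ₗ (rightAnn I).subtype
    have hf : Function.Injective f := by
      rw [injective_iff_map_eq_zero]
      intro a ha
      exact Subtype.ext (hAI a ((Submodule.Quotient.mk_eq_zero I).1 ha) a.2)
    exact LinearMap.finrank_le_finrank_of_injective (f := f.restrictScalars k) hf
  -- A homomorphism from L/I to L is determined by the image of 1, which is annihilated from the
  -- left by I.
  have hd2 : homDim k L (L ⧸ I) ≤ Module.finrank k (rightAnn I) := by
    let f : ((L ⧸ I) →ₗ[L] L) →ₗ[k] rightAnn I :=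
      { toFun := fun g => ⟨g (Submodule.mkQ I 1), fun i hi => by
          rw [← smul_eq_mul, ← map_smul, ← map_smul, smul_eq_mul, mul_one]
          have : Submodule.mkQ I i = 0 := (Submodule.Quotient.mk_eq_zero I).2 hi
          rw [this, map_zero]⟩
        map_add' := fun _ _ => rfl
        map_smul' := fun _ _ => rfl }
    refine LinearMap.finrank_le_finrank_of_injective (f := f) fun g h hgh => ?_
    refine Submodule.linearMap_qext I (LinearMap.ext_ring ?_)
    exact congrArg Subtype.val hgh
  -- Evaluation on a basis of N embeds L/I into a power of N. A submodule of an extremal module is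
  -- extremal, since neither it nor the quotient exceeds the ratio r and `homDim` is subadditive.
  have hd3 : (homDim k L (L ⧸ I) : ℚ) = r * Module.finrank k (L ⧸ I) := by
    let d := Module.finrank k N
    let P : FDMod k L := of k (Fin d → N)
    have hP1 : Module.finrank k P = d * Module.finrank k N := by
      change Module.finrank k (Fin d → N) = _
      simp [Module.finrank_pi_fintype]
    have hP2 : (homDim k L P : ℚ) = r * Module.finrank k P := by
      refine le_antisymm (hle P) ?_
      have e2 : (d * homDim k L N : ℚ) ≤ homDim k L P := by
        exact_mod_cast homDim_pi (k := k) (L := L) (V := N) d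
      rw [hP1, Nat.cast_mul]
      rw [hN2] at e2
      linarith
    let f : L →ₗ[L] (Fin d → N) :=
      LinearMap.pi fun i => LinearMap.toSpanSingleton L N (Module.finBasis k N i)
    have hf : LinearMap.ker f = I := by
      ext a
      constructor
      · intro h
        refine Module.mem_annihilator.2 fun m => ?_
        have : N.ρ a = 0 := (Module.finBasis k N).ext fun i => congrFun h i
        change N.ρ a m = 0
        rw [this, LinearMap.zero_apply]
      · intro h
        funext i
        exact Module.mem_annihilator.1 h _
    let R : Submodule L (Fin d → N) := LinearMap.range f
    have e1 : (L ⧸ I) ≃ₗ[L] R := (Submodule.quotEquivOfEq _ _ hf.symm).trans f.quotKerEquivRange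
    have e2 : homDim k L (L ⧸ I) = homDim k L R :=
      le_antisymm (homDim_le_of_surjective e1.symm.toLinearMap e1.symm.surjective)
        (homDim_le_of_surjective e1.toLinearMap e1.surjective)
    have e3 : Module.finrank k (L ⧸ I) = Module.finrank k R :=
      (e1.restrictScalars k).finrank_eq
    rw [e2, e3]
    have e4 : (homDim k L R : ℚ) ≤ _ := hle (of k R)
    have e5 : (homDim k L ((Fin d → N) ⧸ R) : ℚ) ≤ _ := hle (of k ((Fin d → N) ⧸ R))
    have e6 : (homDim k L (Fin d → N) : ℚ) ≤ homDim k L R + homDim k L ((Fin d → N) ⧸ R) := by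
      exact_mod_cast homDim_le_add (k := k) R
    have e7 : (Module.finrank k (Fin d → N) : ℚ) =
        Module.finrank k R + Module.finrank k ((Fin d → N) ⧸ R) := by
      exact_mod_cast (finrank_submodule_add_quotient (k := k) R).symm
    have e8 : (homDim k L (Fin d → N) : ℚ) = r * Module.finrank k (Fin d → N) := hP2
    refine le_antisymm e4 ?_
    change (homDim k L ((Fin d → N) ⧸ R) : ℚ) ≤ r * Module.finrank k ((Fin d → N) ⧸ R) at e5
    rw [e8, e7] at e6
    linarith
  have hpos : 0 < Module.finrank k (L ⧸ I) := by
    have : Nontrivial (L ⧸ I) := by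
      refine Submodule.Quotient.nontrivial_iff.2 fun h => ?_
      have : Nontrivial N := Module.finrank_pos_iff.1 hN1
      obtain ⟨x, hx⟩ := exists_ne (0 : N)
      have h1 : (1 : L) ∈ I := h ▸ Submodule.mem_top
      exact hx ((one_smul L x).symm.trans (Module.mem_annihilator.1 h1 x))
    exact Module.finrank_pos
  have hr : r ≤ 1 := by
    have e1 : (homDim k L (L ⧸ I) : ℚ) ≤ Module.finrank k (L ⧸ I) := by
      exact_mod_cast hd2.trans hd1
    rw [hd3] at e1
    have e2 : (0 : ℚ) < Module.finrank k (L ⧸ I) := by exact_mod_cast hpos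
    by_contra h
    nlinarith
  have h1 := hle M
  have h2 : (homDim k L M : ℚ) ≤ Module.finrank k M :=
    h1.trans (mul_le_of_le_one_left (Nat.cast_nonneg _) hr)
  exact_mod_cast h2

end LeftComoduleAlgebra

/-! ### Construction of a Frobenius form along a chain of left ideals -/

section FrobeniusExistence

variable {k : Type u} [Field k] {L : Type u} [Ring L] [Algebra k L] [FiniteDimensional k L]

/-- The `L`-submodules of `N` on which the form `f` vanishes are trivial. -/
def IsNondegOn (f : L →ₗ[k] k) (N : Submodule L L) : Prop :=
  ∀ T ≤ N, (∀ x ∈ T, f x = 0) → T = ⊥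

/-- If N is essential in N', the same form works. Otherwise N' = K ⊕ N, and a nonzero left ideal of
N' meeting N trivially is the graph of a homomorphism K → N. The dimension bound leaves room to
choose the form on K so that it vanishes on no such graph. -/
lemma exists_isNondegOn_of_covBy
    (hdim : ∀ K : Submodule L L, homDim k L K ≤ Module.finrank k K)
    {N N' : Submodule L L} (hN : N ⋖ N') (f : L →ₗ[k] k) (hf : IsNondegOn f N) :
    ∃ f' : L →ₗ[k] k, IsNondegOn f' N' := by
  by_cases hess : ∀ T ≤ N', T ⊓ N = ⊥ → T = ⊥
  · exact ⟨f, fun T hT h0 => hess T hT (hf _ inf_le_right fun x hx => h0 x hx.1)⟩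
  push Not at hess
  obtain ⟨K, hKN', hKN, hK⟩ := hess
  have hsup : ∀ T ≤ N', T ⊓ N = ⊥ → T ≠ ⊥ → T ⊔ N = N' := fun T hT h1 h2 => by
    rcases hN.eq_or_eq (c := T ⊔ N) le_sup_right (sup_le hT hN.le) with h | h
    · have : T ≤ N := by rw [← h]; exact le_sup_left
      rw [inf_eq_left.2 this] at h1
      exact absurd h1 h2
    · exact h
  -- the maps from `K` to `L` with values in `N`
  let W : Submodule k (K →ₗ[L] L) :=
    { carrier := {φ | ∀ x, φ x ∈ N}
      zero_mem' := fun x => N.zero_mem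
      add_mem' := fun ha hb x => N.add_mem (ha x) (hb x)
      smul_mem' := fun c φ h x => (N.restrictScalars k).smul_mem c (h x) }
  -- The inclusion of K does not take values in N, so Hom(K, N) is a proper subspace of Hom(K, L),
  -- which has dimension at most dim K.
  have hW : Module.finrank k W < Module.finrank k K := by
    refine lt_of_lt_of_le (Submodule.finrank_lt fun h => hK ?_) (hdim K)
    have h1 : K.subtype ∈ W := h ▸ Submodule.mem_top
    rw [← hKN]
    exact le_antisymm (le_inf le_rfl fun x hx => h1 ⟨x, hx⟩) inf_le_left
  let Θ : W →ₗ[k] (K →ₗ[k] k) :=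
    { toFun := fun φ => f ∘ₗ φ.1.restrictScalars k
      map_add' := fun _ _ => LinearMap.ext fun x => map_add f _ _
      map_smul' := fun _ _ => LinearMap.ext fun x => map_smul f _ _ }
  -- By this count some functional on K is not of the form f ∘ φ with φ : K → N.
  obtain ⟨fK, hfK⟩ : ∃ fK, fK ∉ LinearMap.range Θ := by
    by_contra h
    push Not at h
    have h1 := LinearMap.finrank_range_le Θ
    rw [LinearMap.range_eq_top.2 (fun x => h x), finrank_top] at h1
    have h2 : Module.finrank k (K →ₗ[k] k) = Module.finrank k K := Subspace.dual_finrank_eq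
    omega
  -- extend `f` on `N` and `fK` on `K`
  let p : K →ₗ[k] L ⧸ N := (N.mkQ ∘ₗ K.subtype).restrictScalars k
  have hp : LinearMap.ker p = ⊥ := by
    rw [LinearMap.ker_eq_bot']
    intro x hx
    have h1 : (x : L) ∈ K ⊓ N := ⟨x.2, (Submodule.Quotient.mk_eq_zero N).1 hx⟩
    rw [hKN] at h1
    exact Subtype.ext h1
  obtain ⟨g, hg⟩ := p.exists_leftInverse_of_injective hp
  let u : K →ₗ[k] k := fK - f ∘ₗ K.subtype.restrictScalars k
  let f' : L →ₗ[k] k := f + u ∘ₗ g ∘ₗ N.mkQ.restrictScalars k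
  have hf'N : ∀ x ∈ N, f' x = f x := fun x hx => by
    have : N.mkQ.restrictScalars k x = 0 := (Submodule.Quotient.mk_eq_zero N).2 hx
    simp only [f', LinearMap.add_apply, LinearMap.comp_apply, this, map_zero, add_zero]
  have hf'K : ∀ x : K, f' x = fK x := fun x => by
    have h1 : g (N.mkQ.restrictScalars k (x : L)) = x := LinearMap.congr_fun hg x
    simp only [f', LinearMap.add_apply, LinearMap.comp_apply, h1, u, LinearMap.sub_apply]
    exact add_sub_cancel _ _
  refine ⟨f', fun T hT h0 => ?_⟩
  by_contra hT0
  have hTN : T ⊓ N = ⊥ := hf _ inf_le_right fun x hx => by rw [← hf'N x hx.2, h0 x hx.1]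
  have hTsup := hsup T hT hTN hT0
  have hex : ∀ x : K, ∃ y : N, (x : L) + y ∈ T := fun x => by
    have h1 : (x : L) ∈ T ⊔ N := hTsup.symm ▸ hKN' x.2
    obtain ⟨t, ht, n, hn, h⟩ := Submodule.mem_sup.1 h1
    refine ⟨-⟨n, hn⟩, ?_⟩
    have : (x : L) + (-(⟨n, hn⟩ : N) : N) = t := by
      rw [← h]; exact add_neg_cancel_right t n
    rw [this]; exact ht
  have huniq : ∀ y z : N, (y : L) - z ∈ T → y = z := fun y z h => by
    have h1 : (y : L) - z ∈ T ⊓ N := ⟨h, N.sub_mem y.2 z.2⟩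
    rw [hTN] at h1
    exact Subtype.ext (sub_eq_zero.1 h1)
  choose φ hφ using hex
  let Φ : K →ₗ[L] L :=
    { toFun := fun x => φ x
      map_add' := fun x y => by
        rw [← Submodule.coe_add]
        refine congrArg Subtype.val (huniq _ _ ?_)
        have h1 := T.sub_mem (hφ (x + y)) (T.add_mem (hφ x) (hφ y))
        refine (congrArg (· ∈ T) ?_).mp h1
        simp only [Submodule.coe_add]
        abel
      map_smul' := fun c x => by
        refine (congrArg Subtype.val (huniq (φ (c • x)) (c • φ x) ?_)).trans rfl
        have h1 := T.sub_mem (hφ (c • x)) (T.smul_mem c (hφ x))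
        refine (congrArg (· ∈ T) ?_).mp h1
        simp only [Submodule.coe_smul, smul_add]
        abel }
  -- The ideal T consists of elements x + Φ(x). If the new form vanishes on it, then `fK` equals f ∘
  -- (-Φ), which was excluded.
  refine hfK ⟨-⟨Φ, fun x => (φ x).2⟩, LinearMap.ext fun x => ?_⟩
  have h1 := h0 _ (hφ x)
  rw [map_add, hf'K, hf'N _ (φ x).2] at h1
  have h2 : f (-(Φ x)) = fK x := by
    rw [map_neg]
    exact (eq_neg_of_add_eq_zero_left h1).symm
  exact h2

/-- A form vanishing on no nonzero left ideal makes a ↦ f(- a) injective, hence bijective;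
non-degeneracy in the other variable follows. -/
lemma nonempty_frobeniusForm_of_homDim_le
    (hdim : ∀ K : Submodule L L, homDim k L K ≤ Module.finrank k K) :
    Nonempty (FrobeniusForm k L) := by
  have : IsNoetherian L L := isNoetherian_of_tower k inferInstance
  have : IsArtinian L L := isArtinian_of_tower k inferInstance
  let T : Set (Submodule L L) := {N | ∃ f : L →ₗ[k] k, IsNondegOn f N}
  obtain ⟨N, ⟨f, hf⟩, hmax⟩ := WellFounded.has_min
    (wellFounded_gt (α := Submodule L L)) T ⟨⊥, 0, fun T hT _ => le_bot_iff.1 hT⟩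
  have hN : N = ⊤ := by
    by_contra h
    obtain ⟨N', hN'⟩ := exists_covBy_of_wellFoundedLT (a := N) (fun h' => h (isMax_iff_eq_top.1 h'))
    obtain ⟨f', hf'⟩ := exists_isNondegOn_of_covBy hdim hN' f hf
    exact hmax N' ⟨f', hf'⟩ hN'.lt
  subst hN
  let R : L →ₗ[k] (L →ₗ[k] k) := (LinearMap.mul k L).flip.compr₂ f
  have hR : Function.Injective R := by
    rw [injective_iff_map_eq_zero]
    intro a ha
    have h1 := hf (Submodule.span L {a}) le_top fun x hx => by
      obtain ⟨c, rfl⟩ := Submodule.mem_span_singleton.1 hx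
      exact LinearMap.congr_fun ha c
    exact Submodule.span_singleton_eq_bot.1 h1
  have hRs := (LinearMap.injective_iff_surjective_of_finrank_eq_finrank
    (Subspace.dual_finrank_eq (K := k) (V := L)).symm).1 hR
  have hinj : Function.Injective ((LinearMap.mul k L).compr₂ f) := by
    rw [injective_iff_map_eq_zero]
    refine fun x hx => eq_of_forall_dual (k := k) fun φ => ?_
    obtain ⟨y, rfl⟩ := hRs φ
    rw [map_zero]
    exact LinearMap.congr_fun hx y
  exact ⟨⟨f, hinj, (LinearMap.injective_iff_surjective_of_finrank_eq_finrank
    (Subspace.dual_finrank_eq (K := k) (V := L)).symm).1 hinj⟩⟩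

end FrobeniusExistence

lemma LeftComoduleAlgebra.nonempty_frobeniusForm {k : Type u} [Field k] {H : Type u} [Ring H]
    [HopfAlgebra k H] [FiniteDimensional k H] {L : Type u} [Ring L] [Algebra k L]
    [LeftComoduleAlgebra k H L] [FiniteDimensional k L]
    (hL : IsExactModuleCategory (FDMod k H) (FDMod k L)) : Nonempty (FrobeniusForm k L) :=
  nonempty_frobeniusForm_of_homDim_le fun K => homDim_le_finrank hL (FDMod.of k K)

/-! ### Elementwise formulas in the categories of modules -/

namespace FDMod

variable {k : Type u} [Field k] {H : Type u} [Ring H]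

local notation "Δ" => (Coalgebra.comul : H →ₗ[k] H ⊗[k] H)
local notation "S" => (HopfAlgebra.antipode k : H →ₗ[k] H)

section Tensor

variable [Bialgebra k H] {L : Type u} [Ring L] [Algebra k L] [LeftComoduleAlgebra k H L]

lemma tensor_ρ_tmul (X Y : FDMod k H) (h : H) (x : X) (y : Y) :
    (X ⊗ Y : FDMod k H).ρ h (x ⊗ₜ[k] y : X ⊗[k] Y) =
      (swd (Δ h) (fun a b => X.ρ a x ⊗ₜ[k] Y.ρ b y) : X ⊗[k] Y) := by
  refine (tens_ρ_tmul _ X Y h x y).trans ?_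
  change TensorProduct.map (X.orbit x) (Y.orbit y) (Δ h) = _
  conv_lhs => rw [← swd_tmul_self (Δ h), map_swd]
  rfl

lemma act_ρ_tmul (X : FDMod k H) (M : FDMod k L) (a : L) (x : X) (m : M) :
    (X ⊙ₗ M : FDMod k L).ρ a (x ⊗ₜ[k] m : X ⊗[k] M) =
      (swd (LeftComoduleAlgebra.coact (k := k) (H := H) a)
        (fun h l => X.ρ h x ⊗ₜ[k] M.ρ l m) : X ⊗[k] M) := by
  refine (tens_ρ_tmul _ X M a x m).trans ?_
  conv_lhs => rw [← swd_tmul_self (LeftComoduleAlgebra.coact (k := k) (H := H) a), map_swd]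
  rfl

end Tensor

section IHom

variable [Bialgebra k H] [FiniteDimensional k H]
variable {L : Type u} [Ring L] [Algebra k L] [LeftComoduleAlgebra k H L]

variable (H) in
/-- The space `Hom_L(H ⊙ₗ M, N)` that underlies `[M, N]`. -/
abbrev homSp (M N : FDMod k L) : Submodule k (free H M →ₗ[k] N) := homSubmodule (free H M) N

/-- The linear map `H ⊗ M → N` underlying an element of `[M, N]`. -/
def ihomFun (M N : FDMod k L) : IHom.obj (FDMod k H) M N →ₗ[k] (H ⊗[k] M →ₗ[k] N) :=
  (homSp H M N).subtype

/-- The morphism `H ⊙ₗ M ⟶ N` underlying an element of `[M, N]`. -/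
def ihomHom {M N : FDMod k L} (f : IHom.obj (FDMod k H) M N) : free H M ⟶ N :=
  ofLin (M := free H M) (N := N) (ihomFun (H := H) M N f) (show homSp H M N from f).2

/-- The element of `[M, N]` given by a morphism `H ⊙ₗ M ⟶ N`. -/
def ihomMk {M N : FDMod k L} (f : free H M ⟶ N) : IHom.obj (FDMod k H) M N :=
  (⟨lin f, lin_comm f⟩ : homSp H M N)

lemma ihomFun_injective (M N : FDMod k L) : Function.Injective (ihomFun (H := H) M N) :=
  Subtype.val_injective

lemma ihom_ext {M N : FDMod k L} {f g : IHom.obj (FDMod k H) M N}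
    (h : ∀ (c : H) (m : M), ihomFun M N f (c ⊗ₜ[k] m) = ihomFun M N g (c ⊗ₜ[k] m)) : f = g :=
  ihomFun_injective M N (TensorProduct.ext' h)

lemma ihomFun_pre {M M' : FDMod k L} (f : M ⟶ M') (N : FDMod k L) (u : IHom.obj (FDMod k H) M' N)
    (h : H) (m : M) : ihomFun M N (lin (IHom.pre (FDMod k H) f N) u) (h ⊗ₜ[k] m) =
      ihomFun M' N u (h ⊗ₜ[k] lin f m) := by
  refine congrArg (ihomFun M' N u) (?_ : (((1 : H) * h) ⊗ₜ[k] lin f m : H ⊗[k] M') = _)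
  rw [one_mul]

lemma ihomFun_post (M : FDMod k L) {N N' : FDMod k L} (g : N ⟶ N')
    (u : IHom.obj (FDMod k H) M N) (z : H ⊗[k] M) :
    ihomFun M N' (lin (IHom.post (FDMod k H) M g) u) z = lin g (ihomFun M N u z) := rfl

lemma ihomFun_ρ (M N : FDMod k L) (h c : H) (f : IHom.obj (FDMod k H) M N) (m : M) :
    ihomFun M N ((IHom.obj (FDMod k H) M N).ρ h f) (c ⊗ₜ[k] m) =
      ihomFun M N f ((c * h) ⊗ₜ[k] m) := rfl

lemma ihomFun_curry_tmul {X Y : FDMod k H} {M N : FDMod k L} (F : (X ⊗ Y) ⊙ₗ M ⟶ N) (x : X) (y : Y)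
    (h : H) (m : M) : ihomFun M N (lin (IHom.curry F) (x ⊗ₜ[k] y : X ⊗[k] Y)) (h ⊗ₜ[k] m) =
      swd (Δ h) (fun a b => lin F ((X.ρ a x ⊗ₜ[k] Y.ρ b y : X ⊗[k] Y) ⊗ₜ[k] m :
        (X ⊗[k] Y) ⊗[k] M)) := by
  let Φ : X ⊗[k] Y →ₗ[k] N := (show (X ⊗[k] Y) ⊗[k] M →ₗ[k] N from lin F) ∘ₗ
    (TensorProduct.mk k (X ⊗[k] Y) M).flip m
  exact (congrArg Φ (tensor_ρ_tmul X Y h x y)).trans (map_swd Φ _ _)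

lemma ihomFun_comp (M₁ M₂ M₃ : FDMod k L) (g : IHom.obj (FDMod k H) M₂ M₃)
    (f : IHom.obj (FDMod k H) M₁ M₂) (h : H) (m : M₁) :
    ihomFun M₁ M₃ (lin (IHom.comp (FDMod k H) M₁ M₂ M₃) (g ⊗ₜ[k] f)) (h ⊗ₜ[k] m) =
      swd (Δ h) (fun a b => ihomFun M₂ M₃ g (a ⊗ₜ[k] ihomFun M₁ M₂ f (b ⊗ₜ[k] m))) := by
  refine (ihomFun_curry_tmul _ g f h m).trans (swd_congr _ fun a b => ?_)
  have h1 : ∀ a b : H, ihomFun M₂ M₃ g (((1 : H) * a) ⊗ₜ[k] ihomFun M₁ M₂ f (((1 : H) * b) ⊗ₜ[k] m))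
      = ihomFun M₂ M₃ g (a ⊗ₜ[k] ihomFun M₁ M₂ f (b ⊗ₜ[k] m)) := fun a b => by
    rw [one_mul, one_mul]
  exact h1 a b

lemma ihomFun_leftStr (X : FDMod k H) (M N : FDMod k L) (x : X) (f : IHom.obj (FDMod k H) M N)
    (h : H) (m : M) :
    ihomFun M (X ⊙ₗ N) (lin (IHom.leftStr X M N) (x ⊗ₜ[k] f)) (h ⊗ₜ[k] m) =
      (swd (Δ h) (fun a b => X.ρ a x ⊗ₜ[k] ihomFun M N f (b ⊗ₜ[k] m)) : X ⊗[k] N) := by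
  refine (ihomFun_curry_tmul _ x f h m).trans (swd_congr _ fun a b => ?_)
  have h1 : ∀ a b : H, (X.ρ a x ⊗ₜ[k] ihomFun M N f (((1 : H) * b) ⊗ₜ[k] m) : X ⊗[k] N) =
      X.ρ a x ⊗ₜ[k] ihomFun M N f (b ⊗ₜ[k] m) := fun a b => by rw [one_mul]
  exact h1 a b

end IHom

section Dual

variable [HopfAlgebra k H]

/-- The functional underlying an element of the dual module. -/
def dualFun (X : FDMod k H) : (LDual.obj X : FDMod k H) ≃ₗ[k] (X →ₗ[k] k) := LinearEquiv.refl k _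

/-- The linear form underlying a pairing. -/
def pairFun {A B : FDMod k H} (p : A ⊗ B ⟶ 𝟙_ (FDMod k H)) : A ⊗[k] B →ₗ[k] k := lin p

lemma dualFun_ρ (X : FDMod k H) (h : H) (p : (LDual.obj X : FDMod k H)) (x : X) :
    dualFun X ((LDual.obj X : FDMod k H).ρ h p) x = dualFun X p (X.ρ (S h) x) := rfl

lemma dualFun_ofPairing {A B : FDMod k H} (p : A ⊗ B ⟶ 𝟙_ (FDMod k H)) (a : A) (b : B) :
    dualFun B (lin (LDual.ofPairing p) a) b = pairFun p (a ⊗ₜ[k] b) := by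
  let T : B ⊗[k] (B →ₗ[k] k) →ₗ[k] (B →ₗ[k] k) :=
    TensorProduct.lift (bilin (fun x (φ : B →ₗ[k] k) => pairFun p (a ⊗ₜ[k] x) • φ)
      (by fun_prop) (by fun_prop))
  have h1 : dualFun B (lin (LDual.ofPairing p) a) = T (coevaluation k B 1) := by
    have h2 : ∀ t : B ⊗[k] (B →ₗ[k] k), (TensorProduct.lid k (B →ₗ[k] k)) ((pairFun p).rTensor _
        ((TensorProduct.assoc k A B (B →ₗ[k] k)).symm (a ⊗ₜ[k] t))) = T t := by
      refine KLin.ext_tmul (by fun_prop) (by fun_prop) fun x φ => ?_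
      simp [T, bilin]
    exact h2 _
  rw [h1, coevaluation_apply_one, map_sum, LinearMap.sum_apply]
  simp only [T, TensorProduct.lift.tmul]
  change ∑ i, pairFun p (a ⊗ₜ[k] _) * (Module.Basis.ofVectorSpace k B).coord i b = _
  conv_rhs => rw [← (Module.Basis.ofVectorSpace k B).sum_repr b]
  rw [TensorProduct.tmul_sum, map_sum]
  refine Finset.sum_congr rfl fun i _ => ?_
  rw [TensorProduct.tmul_smul, map_smul, smul_eq_mul, mul_comm]
  rfl

lemma dualFun_map {X Y : FDMod k H} (f : X ⟶ Y) (p : (LDual.obj Y : FDMod k H)) (x : X) :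
    dualFun X (lin (LDual.map f) p) x = dualFun Y p (lin f x) :=
  dualFun_ofPairing _ _ _

lemma dualFun_tensor (X Y : FDMod k H) (q : (LDual.obj Y : FDMod k H))
    (p : (LDual.obj X : FDMod k H)) (x : X) (y : Y) :
    dualFun (X ⊗ Y) (lin (LDual.tensor X Y) (q ⊗ₜ[k] p :
      (LDual.obj Y : FDMod k H) ⊗[k] (LDual.obj X : FDMod k H))) (x ⊗ₜ[k] y : X ⊗[k] Y) =
      dualFun X p x * dualFun Y q y := by
  refine (dualFun_ofPairing (A := LDual.obj Y ⊗ LDual.obj X) (B := X ⊗ Y) _ _ _).trans ?_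
  exact (dualFun Y q).map_smul (dualFun X p x) y

lemma dualFun_unit (c d : k) :
    dualFun (𝟙_ (FDMod k H)) (lin (LDual.unit (FDMod k H)) (show unit k H from c))
      (show unit k H from d) = c * d :=
  dualFun_ofPairing _ _ _

/-- The canonical map `X → X^{**}`. -/
def bidual (X : FDMod k H) : X ≃ₗ[k] (LDual.obj (LDual.obj X) : FDMod k H) :=
  Module.evalEquiv k X

lemma dualFun_bidual (X : FDMod k H) (x : X) (p : (LDual.obj X : FDMod k H)) :
    dualFun (LDual.obj X) (bidual X x) p = dualFun X p x := rfl

variable [FiniteDimensional k H]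
variable {L : Type u} [Ring L] [Algebra k L] [LeftComoduleAlgebra k H L]

lemma ihomFun_rightStr (M N : FDMod k L) (X : FDMod k H) (f : IHom.obj (FDMod k H) M N)
    (p : (LDual.obj X : FDMod k H)) (h : H) (x : X) (m : M) :
    ihomFun (X ⊙ₗ M) N (lin (IHom.rightStr M N X) (f ⊗ₜ[k] p :
      IHom.obj (FDMod k H) M N ⊗[k] (LDual.obj X : FDMod k H)))
      (h ⊗ₜ[k] (x ⊗ₜ[k] m : X ⊗[k] M)) =
      swd (Δ h) (fun a b => ihomFun M N f (a ⊗ₜ[k] (dualFun X p (X.ρ (S b) x) • m))) := by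
  refine (ihomFun_curry_tmul (Y := LDual.obj X) (M := X ⊙ₗ M) _ f p h
    (x ⊗ₜ[k] m : X ⊗[k] M)).trans (swd_congr _ fun a b => ?_)
  have h1 : ∀ a b : H, ihomFun M N f (((1 : H) * a) ⊗ₜ[k] (dualFun X p (X.ρ (S b) x) • m)) =
      ihomFun M N f (a ⊗ₜ[k] (dualFun X p (X.ρ (S b) x) • m)) := fun a b => by rw [one_mul]
  exact h1 a b

end Dual

end FDMod

/-! ### Traces of semilinear endomorphisms of projective modules -/

namespace FDMod

section Trace

variable {k : Type u} [Field k] {L : Type u} [Ring L] [Algebra k L] [FiniteDimensional k L]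
variable (F : FrobeniusForm k L) {P Q : FDMod k L}

/-- The linear map underlying a morphism to the regular module. -/
def coordFun (f : P ⟶ regular k L) : P →ₗ[k] L := lin f

lemma coordFun_ρ (f : P ⟶ regular k L) (a : L) (x : P) :
    coordFun f (P.ρ a x) = a * coordFun f x := lin_comm f a x

/-- Linearity along the Nakayama automorphism. -/
def IsSemilinear (G : Q →ₗ[k] P) : Prop := ∀ a x, G (Q.ρ a x) = P.ρ (F.nakayama a) (G x)

/-- The trace `∑ λ(tⁱ(T(tᵢ)))`. -/
def ftrace {n : ℕ} (t : Fin n → P) (t' : Fin n → (P ⟶ regular k L)) : (P →ₗ[k] P) →ₗ[k] k :=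
  KLin.toLin (k := k) (f := fun T => ∑ i, F.form (coordFun (t' i) (T (t i)))) (by fun_prop)

lemma ftrace_apply {n : ℕ} (t : Fin n → P) (t' : Fin n → (P ⟶ regular k L)) (T : P →ₗ[k] P) :
    ftrace F t t' T = ∑ i, F.form (coordFun (t' i) (T (t i))) := rfl

variable {F} {n m : ℕ} {t : Fin n → P} {t' : Fin n → (P ⟶ regular k L)}
  {s : Fin m → Q} {s' : Fin m → (Q ⟶ regular k L)}

lemma IsDualBases.sum (ht : IsDualBases t t') (x : P) :
    ∑ i, P.ρ (coordFun (t' i) x) (t i) = x := ht x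

/-- Expanding f(tᵢ) in the basis s and G(sⱼ) in the basis t leads to the same double sum ∑
λ(tⁱ(G(sⱼ)) sʲ(f(tᵢ))). Semilinearity inserts a ν in the first expansion, which the Nakayama
identity removes. -/
lemma ftrace_comp_comm (ht : IsDualBases t t') (hs : IsDualBases s s') {G : Q →ₗ[k] P}
    (hG : IsSemilinear F G) (f : P →ₗ[k] Q) (hf : ∀ a x, f (P.ρ a x) = Q.ρ a (f x)) :
    ftrace F t t' (G ∘ₗ f) = ftrace F s s' (f ∘ₗ G) := by
  have e1 : ∀ i, F.form (coordFun (t' i) (G (f (t i)))) =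
      ∑ j, F.form (coordFun (t' i) (G (s j)) * coordFun (s' j) (f (t i))) := fun i => by
    conv_lhs => rw [← hs.sum (f (t i))]
    rw [map_sum, map_sum, map_sum]
    refine Finset.sum_congr rfl fun j _ => ?_
    rw [hG, coordFun_ρ, F.form_nakayama_mul]
  have e2 : ∀ j, F.form (coordFun (s' j) (f (G (s j)))) =
      ∑ i, F.form (coordFun (t' i) (G (s j)) * coordFun (s' j) (f (t i))) := fun j => by
    conv_lhs => rw [← ht.sum (G (s j))]
    rw [map_sum, map_sum, map_sum]
    refine Finset.sum_congr rfl fun i _ => ?_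
    rw [hf, coordFun_ρ]
  simp only [ftrace_apply, LinearMap.comp_apply, e1, e2]
  exact Finset.sum_comm

/-- Independence of the dual bases is cyclicity with the identity map. -/
lemma ftrace_eq (ht : IsDualBases t t') {s : Fin m → P} {s' : Fin m → (P ⟶ regular k L)}
    (hs : IsDualBases s s') {G : P →ₗ[k] P} (hG : IsSemilinear F G) :
    ftrace F t t' G = ftrace F s s' G :=
  ftrace_comp_comm ht hs hG LinearMap.id fun _ _ => rfl

/-- The map `x ↦ f(x) y`. -/
def rankOne (f : P ⟶ regular k L) : Q →ₗ[k] homSubmodule P Q :=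
  { toFun := fun y => ⟨Q.orbit y ∘ₗ coordFun f, fun a x => by
      rw [LinearMap.comp_apply, coordFun_ρ, LinearMap.comp_apply, orbit_apply, orbit_apply,
        map_mul]
      rfl⟩
    map_add' := fun x y => Subtype.ext (LinearMap.ext fun z => map_add (Q.ρ (coordFun f z)) x y)
    map_smul' := fun c y => Subtype.ext (LinearMap.ext fun z =>
      map_smul (Q.ρ (coordFun f z)) c y) }

lemma rankOne_apply (f : P ⟶ regular k L) (y : Q) (x : P) :
    (rankOne f y).1 x = Q.ρ (coordFun f x) y := rfl

lemma ftrace_comp_rankOne (ht : IsDualBases t t') {G : Q →ₗ[k] P} (hG : IsSemilinear F G)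
    (f : P ⟶ regular k L) (y : Q) :
    ftrace F t t' (G ∘ₗ (rankOne f y).1) = F.form (coordFun f (G y)) := by
  conv_rhs => rw [← ht.sum (G y)]
  rw [map_sum, map_sum, ftrace_apply]
  refine Finset.sum_congr rfl fun i _ => ?_
  rw [coordFun_ρ, LinearMap.comp_apply, rankOne_apply, hG, coordFun_ρ, F.form_nakayama_mul]

lemma sum_rankOne (ht : IsDualBases t t') (f : homSubmodule P Q) :
    ∑ j, rankOne (t' j) (f.1 (t j)) = f := by
  refine Subtype.ext (LinearMap.ext fun x => ?_)
  rw [AddSubmonoidClass.coe_finsetSum, LinearMap.sum_apply]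
  conv_rhs => rw [← ht.sum x, map_sum]
  exact Finset.sum_congr rfl fun j _ => (f.2 _ _).symm

/-- Rank-one maps suffice: they give λ(tʲ(G(y))) = 0 for all y, and replacing y by ay turns this
into λ(tʲ(G(y))a) = 0 for all a. -/
lemma eq_zero_of_ftrace_comp (ht : IsDualBases t t') {G : Q →ₗ[k] P} (hG : IsSemilinear F G)
    (h : ∀ f : homSubmodule P Q, ftrace F t t' (G ∘ₗ f.1) = 0) : G = 0 := by
  have h1 : ∀ j y, F.form (coordFun (t' j) (G y)) = 0 := fun j y => by
    rw [← ftrace_comp_rankOne ht hG, h]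
  have h2 : ∀ j y, coordFun (t' j) (G y) = 0 := fun j y => by
    refine F.eq_of_form_mul fun a => ?_
    rw [← F.form_nakayama_mul, ← coordFun_ρ, ← hG, h1, zero_mul, map_zero]
  ext y
  rw [← ht.sum (G y)]
  simp [h2]

/-- The coordinates of G are prescribed on rank-one maps: λ(cᵢ(y)a) must be the value of Ψ at
tⁱ(-)ay, and the Frobenius property solves for cᵢ(y). -/
lemma exists_ftrace_comp (ht : IsDualBases t t') (Ψ : homSubmodule P Q →ₗ[k] k) :
    ∃ G : Q →ₗ[k] P, IsSemilinear F G ∧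
      ∀ f : homSubmodule P Q, ftrace F t t' (G ∘ₗ f.1) = Ψ f := by
  let c : Fin n → Q →ₗ[k] L := fun i => KLin.toLin (k := k)
    (f := fun y => F.theta.symm (Ψ ∘ₗ rankOne (t' i) ∘ₗ Q.orbit y))
    ⟨fun y z => by
      rw [← map_add]
      congr 1
      ext a
      simp, fun r y => by
      rw [← map_smul]
      congr 1
      ext a
      simp⟩
  have hc : ∀ i y a, F.form (c i y * a) = Ψ (rankOne (t' i) (Q.ρ a y)) := fun i y a => by
    rw [← F.theta_apply]
    exact LinearMap.congr_fun (F.theta.apply_symm_apply _) a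
  let G : Q →ₗ[k] P := KLin.toLin (k := k) (f := fun y => ∑ i, P.ρ (c i y) (t i)) (by fun_prop)
  have hG : ∀ y, G y = ∑ i, P.ρ (c i y) (t i) := fun y => rfl
  refine ⟨G, fun a y => ?_, fun f => ?_⟩
  · rw [hG, hG, map_sum]
    refine Finset.sum_congr rfl fun i _ => ?_
    have : c i (Q.ρ a y) = F.nakayama a * c i y := F.eq_of_form_mul fun b => by
      rw [hc, mul_assoc, F.form_nakayama_mul, mul_assoc, hc, map_mul]
      rfl
    rw [this, map_mul]
    rfl
  · have h2 : ∀ j, Ψ (rankOne (t' j) (f.1 (t j))) =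
        ∑ i, F.form (c j (f.1 (t i)) * coordFun (t' i) (t j)) := fun j => by
      conv_lhs => rw [← ht.sum (t j)]
      rw [map_sum, map_sum, map_sum]
      refine Finset.sum_congr rfl fun i _ => ?_
      rw [hc, f.2]
    conv_rhs => rw [← sum_rankOne ht f, map_sum]
    simp only [h2, ftrace_apply, LinearMap.comp_apply, hG, map_sum, coordFun_ρ]
    exact Finset.sum_comm

end Trace

/-! ### The trace on H ⊗ M and the maps with values in Λ ⊗ M -/

section FreeTrace

open LeftComoduleAlgebra

variable {k : Type u} [Field k] {H : Type u} [Ring H] [HopfAlgebra k H] [FiniteDimensional k H]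
variable {L : Type u} [Ring L] [Algebra k L] [FiniteDimensional k L] [LeftComoduleAlgebra k H L]
variable (I : IntegralData k H) (F : FrobeniusForm k L)

local notation "Δ" => (Coalgebra.comul : H →ₗ[k] H ⊗[k] H)
local notation "ε" => (Coalgebra.counit : H →ₗ[k] k)

/-- `L`-linearity of a map `H ⊗ M → H ⊗ N`. -/
def IsFreeLinear {M N : FDMod k L} (f : H ⊗[k] M →ₗ[k] H ⊗[k] N) : Prop :=
  ∀ a z, f (freeAct M a z) = freeAct N a (f z)

/-- Linearity of a map `H ⊗ N → H ⊗ M` along the Nakayama automorphism. -/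
def IsFreeSemilinear {M N : FDMod k L} (G : H ⊗[k] N →ₗ[k] H ⊗[k] M) : Prop :=
  ∀ a z, G (freeAct N a z) = freeAct M (F.nakayama a) (G z)

/-- The linear map underlying a morphism of free modules. -/
def freeLin {M N : FDMod k L} (f : free H M ⟶ free H N) : H ⊗[k] M →ₗ[k] H ⊗[k] N := lin f

lemma isFreeLinear_freeLin {M N : FDMod k L} (f : free H M ⟶ free H N) :
    IsFreeLinear (freeLin f) := lin_comm f

variable (hL : IsExactModuleCategory (FDMod k H) (FDMod k L))

/-- The trace of a semilinear endomorphism of `H ⊗ M`. -/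
def freeTrace (M : FDMod k L) : (H ⊗[k] M →ₗ[k] H ⊗[k] M) →ₗ[k] k :=
  ftrace F (exists_isDualBases (projective_regular_act hL M)).choose_spec.choose
    (exists_isDualBases (projective_regular_act hL M)).choose_spec.choose_spec.choose

lemma freeTrace_spec (M : FDMod k L) : IsDualBases
    (exists_isDualBases (projective_regular_act hL M)).choose_spec.choose
    (exists_isDualBases (projective_regular_act hL M)).choose_spec.choose_spec.choose :=
  (exists_isDualBases (projective_regular_act hL M)).choose_spec.choose_spec.choose_spec

variable {F}

lemma freeTrace_eq (M : FDMod k L) {n : ℕ} {t : Fin n → free H M}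
    {t' : Fin n → (free H M ⟶ regular k L)} (ht : IsDualBases t t')
    {G : H ⊗[k] M →ₗ[k] H ⊗[k] M} (hG : IsFreeSemilinear F G) :
    freeTrace F hL M G = ∑ i, F.form (coordFun (t' i) (G (t i))) :=
  ftrace_eq (freeTrace_spec hL M) ht hG

lemma freeTrace_comp_comm {M N : FDMod k L} {G : H ⊗[k] N →ₗ[k] H ⊗[k] M}
    (hG : IsFreeSemilinear F G) {f : H ⊗[k] M →ₗ[k] H ⊗[k] N} (hf : IsFreeLinear f) :
    freeTrace F hL M (G ∘ₗ f) = freeTrace F hL N (f ∘ₗ G) :=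
  ftrace_comp_comm (freeTrace_spec hL M) (freeTrace_spec hL N) hG f hf

lemma eq_zero_of_freeTrace {M N : FDMod k L} {G : H ⊗[k] N →ₗ[k] H ⊗[k] M}
    (hG : IsFreeSemilinear F G)
    (h : ∀ f : H ⊗[k] M →ₗ[k] H ⊗[k] N, IsFreeLinear f → freeTrace F hL M (G ∘ₗ f) = 0) : G = 0 :=
  eq_zero_of_ftrace_comp (P := free H M) (Q := free H N) (freeTrace_spec hL M) hG
    fun f => h f.1 f.2

lemma exists_freeTrace_comp {M N : FDMod k L} (Ψ : homSubmodule (free H M) (free H N) →ₗ[k] k) :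
    ∃ G : H ⊗[k] N →ₗ[k] H ⊗[k] M, IsFreeSemilinear F G ∧
      ∀ f : homSubmodule (free H M) (free H N),
        freeTrace F hL M (G ∘ₗ (show H ⊗[k] M →ₗ[k] H ⊗[k] N from f.1)) = Ψ f :=
  exists_ftrace_comp (P := free H M) (Q := free H N) (F := F) (freeTrace_spec hL M) Ψ

/-- Right multiplication by `h` on `H ⊗ M`. -/
def freeMul (M : FDMod k L) (h : H) : H ⊗[k] M →ₗ[k] H ⊗[k] M :=
  (LinearMap.mulRight k h).rTensor M

lemma freeMul_tmul (M : FDMod k L) (h c : H) (m : M) :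
    freeMul M h (c ⊗ₜ[k] m) = (c * h) ⊗ₜ[k] m := rfl

lemma isFreeLinear_freeMul (M : FDMod k L) (h : H) : IsFreeLinear (freeMul M h) :=
  isFreeLinear_freeLin (rmul h ⊵ₗ M)

/-- An element of `H ⊗ M` on which `H` acts by the counit from the right is of the form
`Λ ⊗ m`. -/
lemma eq_integral_tmul (M : FDMod k L) (z : H ⊗[k] M)
    (hz : ∀ h, freeMul M h z = ε h • z) : z = I.integral ⊗ₜ[k] sliceL I.cointegral z := by
  -- This is the expansion h = ∑ λ(hS⁻¹(Λ₍₂₎))Λ₍₁₎ in the first factor. On an invariant element the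
  -- action of S⁻¹(Λ₍₂₎) reduces to ε(Λ₍₂₎), which leaves Λ.
  have h1 : ∀ z : H ⊗[k] M, swd (Δ I.integral) (fun a b => a ⊗ₜ[k] sliceL I.cointegral
      (freeMul M ((HopfAlgebra.antipodeEquiv (k := k) (H := H)).symm b) z)) = z := by
    refine KLin.ext_tmul (by fun_prop) (by fun_prop) fun h m => ?_
    have h2 := congrArg (fun y => y ⊗ₜ[k] m) (I.swd_cointegral_smul h)
    rw [KLin.map_swd (φ := fun y => y ⊗ₜ[k] m) (by fun_prop)] at h2
    refine Eq.trans (swd_congr _ fun a b => ?_) h2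
    rw [freeMul_tmul, sliceL_tmul, TensorProduct.smul_tmul]
  have h3 : ∀ b : H, ε ((HopfAlgebra.antipodeEquiv (k := k) (H := H)).symm b) = ε b := fun b => by
    conv_rhs => rw [← HopfAlgebra.antipode_antipodeEquiv_symm (k := k) b,
      HopfAlgebra.counit_antipode]
  conv_lhs => rw [← h1 z]
  have h4 := swd_counit_right (k := k) I.integral
    (f := fun a => a ⊗ₜ[k] sliceL I.cointegral z) (by fun_prop)
  refine Eq.trans (swd_congr _ fun a b => ?_) h4
  rw [hz, h3, map_smul, TensorProduct.tmul_smul]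

variable (F)

/-- The identification of the vector space underlying `Ser(M)` with `M`. -/
def serreEquiv (M : FDMod k L) : (serre I.modular F).obj M ≃ₗ[k] M := LinearEquiv.refl k _

lemma serreEquiv_ρ (M : FDMod k L) (a : L) (m : (serre I.modular F).obj M) :
    serreEquiv I F M (((serre I.modular F).obj M).ρ a m) =
      M.ρ (twistedNakayama I.modular F a) (serreEquiv I F M m) := rfl

variable {F}

/-- The map `z ↦ Λ ⊗ g(z)`. -/
def integralMap {M N : FDMod k L} (g : IHom.obj (FDMod k H) N ((serre I.modular F).obj M)) :
    H ⊗[k] N →ₗ[k] H ⊗[k] M :=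
  TensorProduct.mk k H M I.integral ∘ₗ (serreEquiv I F M).toLinearMap ∘ₗ ihomFun _ _ g

lemma integralMap_apply {M N : FDMod k L}
    (g : IHom.obj (FDMod k H) N ((serre I.modular F).obj M)) (z : H ⊗[k] N) :
    integralMap I g z = I.integral ⊗ₜ[k] serreEquiv I F M (ihomFun _ _ g z) := rfl

/-- This is the source of the modular function in ν': it converts the action on Λ ⊗ M into an action
on M. -/
lemma freeAct_integral_tmul (M : FDMod k L) (a : L) (m : M) :
    freeAct M a (I.integral ⊗ₜ[k] m) = I.integral ⊗ₜ[k] M.ρ (coactLeftHom I.modular a) m := by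
  rw [freeAct_tmul, coactLeftHom_eq_swd,
    KLin.map_swd (φ := fun y => I.integral ⊗ₜ[k] M.ρ y m) (by fun_prop)]
  refine swd_congr _ fun x l => ?_
  rw [I.mul_integral, map_smul, LinearMap.smul_apply, TensorProduct.smul_tmul]

lemma freeAct_nakayama_integral_tmul (M : FDMod k L) (a : L) (m : M) :
    freeAct M (F.nakayama a) (I.integral ⊗ₜ[k] m) =
      I.integral ⊗ₜ[k] M.ρ (twistedNakayama I.modular F a) m := by
  rw [freeAct_integral_tmul, twistedNakayama_apply]

lemma isFreeSemilinear_integralMap {M N : FDMod k L}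
    (g : IHom.obj (FDMod k H) N ((serre I.modular F).obj M)) :
    IsFreeSemilinear F (integralMap I g) := fun a z => by
  have h : ihomFun _ _ g (freeAct N a z) = ((serre I.modular F).obj M).ρ a (ihomFun _ _ g z) :=
    lin_comm (ihomHom g) a z
  rw [integralMap_apply, integralMap_apply, h, serreEquiv_ρ, freeAct_nakayama_integral_tmul]

lemma freeMul_comp_integralMap {M N : FDMod k L}
    (g : IHom.obj (FDMod k H) N ((serre I.modular F).obj M)) (h : H) :
    freeMul M h ∘ₗ integralMap I g = ε h • integralMap I g := by
  refine LinearMap.ext fun z => ?_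
  rw [LinearMap.comp_apply, integralMap_apply, freeMul_tmul, I.integral_mul]
  rfl

/-- A semilinear map that is invariant under `H` is of the form `z ↦ Λ ⊗ g(z)`. -/
lemma exists_eq_integralMap {M N : FDMod k L} {G : H ⊗[k] N →ₗ[k] H ⊗[k] M}
    (hG : IsFreeSemilinear F G) (h : ∀ x, freeMul M x ∘ₗ G = ε x • G) :
    ∃ g : IHom.obj (FDMod k H) N ((serre I.modular F).obj M), G = integralMap I g := by
  have h1 : ∀ z, G z = I.integral ⊗ₜ[k] sliceL I.cointegral (G z) := fun z =>
    eq_integral_tmul I M _ fun x => LinearMap.congr_fun (h x) z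
  have h2 : ∀ m : M, sliceL I.cointegral (I.integral ⊗ₜ[k] m) = m := fun m => by
    rw [sliceL_tmul, I.cointegral_integral, one_smul]
  have h3 : ∀ (a : L) (z : H ⊗[k] N), sliceL I.cointegral (G (freeAct N a z)) =
      M.ρ (twistedNakayama I.modular F a) (sliceL I.cointegral (G z)) := fun a z => by
    rw [hG, h1 z, freeAct_nakayama_integral_tmul, h2, h2]
  exact ⟨ihomMk (ofLin (M := free H N) (N := (serre I.modular F).obj M)
    (sliceL I.cointegral ∘ₗ G) fun a z => h3 a z), LinearMap.ext fun z => h1 z⟩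

lemma integralMap_injective {M N : FDMod k L}
    {g : IHom.obj (FDMod k H) N ((serre I.modular F).obj M)} (h : integralMap I g = 0) : g = 0 := by
  refine ihom_ext fun c n => ?_
  have h1 := congrArg (sliceL I.cointegral) (LinearMap.congr_fun h (c ⊗ₜ[k] n))
  rw [integralMap_apply, sliceL_tmul, I.cointegral_integral, one_smul] at h1
  refine (serreEquiv I F M).injective (h1.trans ?_)
  rw [LinearMap.zero_apply, map_zero, map_zero, LinearMap.zero_apply, map_zero]

end FreeTrace

end FDMod

/-! ### The relative Serre functor -/

namespace FDMod

open LeftComoduleAlgebra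

variable {k : Type u} [Field k] {H : Type u} [Ring H] [HopfAlgebra k H] [FiniteDimensional k H]
variable {L : Type u} [Ring L] [Algebra k L] [FiniteDimensional k L] [LeftComoduleAlgebra k H L]

local notation "Δ" => (Coalgebra.comul : H →ₗ[k] H ⊗[k] H)
local notation "ε" => (Coalgebra.counit : H →ₗ[k] k)
local notation "S" => (HopfAlgebra.antipode k : H →ₗ[k] H)

/-! ### The identification of H ⊗ [M, N] with [M, H ⊗ N] -/

section Shift

variable {M N : FDMod k L}

variable (M N) in
/-- The linear map `H ⊗ M → H ⊗ N` underlying an element of `[M, H ⊙ₗ N]`. -/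
def freeFun : IHom.obj (FDMod k H) M (free H N) →ₗ[k] (H ⊗[k] M →ₗ[k] H ⊗[k] N) :=
  ihomFun M (free H N)

lemma isFreeLinear_freeFun (f : IHom.obj (FDMod k H) M (free H N)) :
    IsFreeLinear (freeFun M N f) :=
  isFreeLinear_freeLin (ihomHom f)

lemma IsFreeLinear.exists_eq {f : H ⊗[k] M →ₗ[k] H ⊗[k] N} (hf : IsFreeLinear f) :
    ∃ f' : IHom.obj (FDMod k H) M (free H N), freeFun M N f' = f :=
  ⟨ihomMk (ofLin (M := free H M) (N := free H N) f hf), rfl⟩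

lemma freeFun_ext {f g : IHom.obj (FDMod k H) M (free H N)}
    (h : ∀ (c : H) (m : M), freeFun M N f (c ⊗ₜ[k] m) = freeFun M N g (c ⊗ₜ[k] m)) : f = g :=
  ihom_ext h

/-- The map `h ⊗ m ↦ h₁ c ⊗ f(h₂ ⊗ m)`. -/
def shift (c : H) (f : IHom.obj (FDMod k H) M N) : IHom.obj (FDMod k H) M (free H N) :=
  lin (IHom.leftStr (regular k H) M N)
    (c ⊗ₜ[k] f : H ⊗[k] (IHom.obj (FDMod k H) M N : FDMod k H))

/-- The linear map underlying `shift c f`. -/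
def shiftFun (c : H) (f : IHom.obj (FDMod k H) M N) : H ⊗[k] M →ₗ[k] H ⊗[k] N :=
  ihomFun M (free H N) (shift c f)

lemma shiftFun_tmul (c : H) (f : IHom.obj (FDMod k H) M N) (h : H) (m : M) :
    shiftFun c f (h ⊗ₜ[k] m) =
      swd (Δ h) (fun a b => (a * c) ⊗ₜ[k] ihomFun M N f (b ⊗ₜ[k] m)) :=
  ihomFun_leftStr (regular k H) M N c f h m

lemma isFreeLinear_shiftFun (c : H) (f : IHom.obj (FDMod k H) M N) : IsFreeLinear (shiftFun c f) :=
  isFreeLinear_freeFun _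

lemma freeFun_shift (c : H) (f : IHom.obj (FDMod k H) M N) :
    freeFun M N (shift c f) = shiftFun c f := rfl

@[fun_prop] lemma klin_shift_right {V : Type*} [AddCommGroup V] [Module k V] (c : H)
    {f : V → IHom.obj (FDMod k H) M N} (hf : KLin k f) : KLin k (fun x => shift c (f x)) := by
  unfold shift
  exact KLin.comp (f := lin (IHom.leftStr (regular k H) M N)) ((lin _).isLinear) (by fun_prop)

lemma shiftFun_comp_freeMul (c x : H) (f : IHom.obj (FDMod k H) M N) :
    shiftFun c f ∘ₗ freeMul M x = freeFun M N
      (swd (Δ x) fun a b => shift (a * c) ((IHom.obj (FDMod k H) M N).ρ b f)) := by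
  refine TensorProduct.ext' fun h m => ?_
  rw [LinearMap.comp_apply, freeMul_tmul, shiftFun_tmul, Bialgebra.comul_mul,
    swd_mul _ _ _ (by fun_prop) (by fun_prop), swd_comm,
    KLin.map_swd (φ := fun y => freeFun M N y (h ⊗ₜ[k] m)) (by fun_prop)]
  refine swd_congr _ fun a b => ?_
  rw [freeFun_shift, shiftFun_tmul]
  refine swd_congr _ fun y z => ?_
  rw [mul_assoc, ihomFun_ρ]

lemma shiftFun_eq_comp (c : H) (f : IHom.obj (FDMod k H) M N) :
    shiftFun c f = freeMul N c ∘ₗ shiftFun 1 f := by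
  refine TensorProduct.ext' fun h m => ?_
  rw [LinearMap.comp_apply, shiftFun_tmul, shiftFun_tmul, map_swd]
  refine swd_congr _ fun a b => ?_
  rw [freeMul_tmul, mul_one]

variable (H) in
/-- The map `h ⊗ n ↦ ε(h) n`. -/
def ihomUnit (N : FDMod k L) : IHom.obj (FDMod k H) N N :=
  lin (IHom.curry (λₗ[FDMod k H] N).hom) (show unit k H from (1 : k))

lemma ihomFun_ihomUnit (h : H) (n : N) : ihomFun N N (ihomUnit H N) (h ⊗ₜ[k] n) = ε h • n := by
  refine (?_ : _ = (ε h * 1) • n).trans (by rw [mul_one])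
  rfl

/-- The map `h ⊗ m ↦ ⟨p, S(h₁) f(h₂ ⊗ m)_H⟩ f(h₂ ⊗ m)_N`. -/
def unshift (p : H →ₗ[k] k)
    (f : IHom.obj (FDMod k H) M (free H N)) : IHom.obj (FDMod k H) M N :=
  lin (IHom.comp (FDMod k H) M (free H N) N)
    (lin (IHom.rightStr N N (regular k H)) (ihomUnit H N ⊗ₜ[k] (dualFun (regular k H)).symm p :
      IHom.obj (FDMod k H) N N ⊗[k] (LDual.obj (regular k H) : FDMod k H)) ⊗ₜ[k] f)

@[fun_prop] lemma klin_unshift (p : H →ₗ[k] k) :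
    KLin k (fun f : IHom.obj (FDMod k H) M (free H N) => unshift p f) := by
  unfold unshift
  fun_prop

lemma ihomFun_unshift (p : H →ₗ[k] k)
    (f : IHom.obj (FDMod k H) M (free H N)) (h : H) (m : M) :
    ihomFun M N (unshift p f) (h ⊗ₜ[k] m) = swd (Δ h) (fun a b =>
      sliceL (p ∘ₗ LinearMap.mulLeft k (S a))
        (ihomFun M (free H N) f (b ⊗ₜ[k] m))) := by
  let r : IHom.obj (FDMod k H) (free H N) N := lin (IHom.rightStr N N (regular k H))
    (ihomUnit H N ⊗ₜ[k] (dualFun (regular k H)).symm p :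
      IHom.obj (FDMod k H) N N ⊗[k] (LDual.obj (regular k H) : FDMod k H))
  have h1 : ∀ (a c : H) (n : N), ihomFun (free H N) N r (a ⊗ₜ[k] (c ⊗ₜ[k] n : H ⊗[k] N)) =
      p (S a * c) • n := fun a c n => by
    refine (ihomFun_rightStr N N (regular k H) _ _ a c n).trans ?_
    refine Eq.trans (swd_congr _ fun x y => ihomFun_ihomUnit x _) ?_
    exact swd_counit_left (k := k) a (f := fun y => p (S y * c) • n) (by fun_prop)
  refine (ihomFun_comp M (free H N) N r f h m).trans (swd_congr _ fun a b => ?_)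
  generalize (ihomFun M (free H N) f (b ⊗ₜ[k] m) : H ⊗[k] N) = z
  exact KLin.ext_tmul (k := k)
    (f := fun z => (ihomFun (free H N) N r : H ⊗[k] (H ⊗[k] N) →ₗ[k] N) (a ⊗ₜ[k] z))
    (g := fun z => sliceL (p ∘ₗ LinearMap.mulLeft k (S a)) z)
    (by fun_prop) (by fun_prop) (h1 a) z

/-- One half of the identification; S(h₍₁₎)h₍₂₎ cancels and leaves p(c). -/
lemma unshift_shift (p : H →ₗ[k] k) (c : H)
    (f : IHom.obj (FDMod k H) M N) :
    unshift p (shift c f) = p c • f := by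
  refine ihom_ext fun h m => ?_
  rw [ihomFun_unshift, map_smul, LinearMap.smul_apply]
  have h1 : ∀ b : H, ihomFun M (free H N) (shift c f) (b ⊗ₜ[k] m) =
      (swd (Δ b) (fun a b => (a * c) ⊗ₜ[k] ihomFun M N f (b ⊗ₜ[k] m)) : H ⊗[k] N) := fun b =>
    shiftFun_tmul c f b m
  simp only [h1, map_swd, sliceL_tmul, LinearMap.comp_apply, LinearMap.mulLeft_apply]
  rw [← swd_coassoc h (fun x y z => p (S x * (y * c)) •
    ihomFun M N f (z ⊗ₜ[k] m))]
  have h2 : ∀ a b : H, swd (Δ a) (fun x y => p (S x * (y * c)) •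
      ihomFun M N f (b ⊗ₜ[k] m)) = ε a • p c •
        ihomFun M N f (b ⊗ₜ[k] m) := fun a b => by
    simp only [← mul_assoc]
    rw [swd_antipode_mul (k := k) a (f := fun x => p (x * c) •
      ihomFun M N f (b ⊗ₜ[k] m)) (by fun_prop), one_mul]
  simp only [h2]
  exact swd_counit_left (k := k) h (f := fun b => p c •
    ihomFun M N f (b ⊗ₜ[k] m)) (by fun_prop)

lemma sum_tmul_sliceL_mulLeft {ι : Type*} [Fintype ι] (e : Module.Basis ι k H) (a c : H)
    (z : H ⊗[k] N) : ∑ i, (a * e i) ⊗ₜ[k] sliceL (e.coord i ∘ₗ LinearMap.mulLeft k c) z =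
      (LinearMap.mulLeft k (a * c)).rTensor N z := by
  refine KLin.ext_tmul (k := k) (f := fun z => ∑ i, (a * e i) ⊗ₜ[k]
    sliceL (e.coord i ∘ₗ LinearMap.mulLeft k c) z) (by fun_prop) (by fun_prop) (fun x n => ?_) z
  simp only [sliceL_tmul, LinearMap.comp_apply, LinearMap.mulLeft_apply, LinearMap.rTensor_tmul,
    TensorProduct.tmul_smul, TensorProduct.smul_tmul', ← TensorProduct.sum_tmul, mul_assoc]
  conv_rhs => rw [← e.sum_repr (c * x), Finset.mul_sum]
  simp only [mul_smul_comm]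
  rfl

/-- The other half; here h₍₁₎S(h₍₂₎) cancels. In particular the shifts span all linear maps H ⊗ M →
H ⊗ N. -/
lemma sum_shift_unshift {ι : Type*} [Fintype ι] (e : Module.Basis ι k H)
    (f : IHom.obj (FDMod k H) M (free H N)) :
    ∑ i, shift (e i) (unshift (e.coord i) f) = f := by
  refine freeFun_ext fun h m => ?_
  rw [map_sum, LinearMap.sum_apply]
  let fl : H ⊗[k] M →ₗ[k] H ⊗[k] N := freeFun M N f
  change ∑ i, shiftFun (e i) _ (h ⊗ₜ[k] m) = fl (h ⊗ₜ[k] m)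
  have h1 : ∀ i, shiftFun (e i) (unshift (e.coord i) f)
      (h ⊗ₜ[k] m) = swd (Δ h) (fun a b => swd (Δ b) fun c d => (a * e i) ⊗ₜ[k]
        sliceL (e.coord i ∘ₗ LinearMap.mulLeft k (S c)) (fl (d ⊗ₜ[k] m))) := fun i => by
    rw [shiftFun_tmul]
    refine swd_congr _ fun a b => ?_
    rw [ihomFun_unshift, KLin.map_swd (φ := fun n => (a * e i) ⊗ₜ[k] n) (by fun_prop)]
    rfl
  simp only [h1]
  have h2 : ∑ i, swd (Δ h) (fun a b => swd (Δ b) fun c d => (a * e i) ⊗ₜ[k]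
        sliceL (e.coord i ∘ₗ LinearMap.mulLeft k (S c)) (fl (d ⊗ₜ[k] m))) =
      swd (Δ h) (fun a b => swd (Δ b) fun c d =>
        (LinearMap.mulLeft k (a * S c)).rTensor N (fl (d ⊗ₜ[k] m))) := by
    simp only [← sum_tmul_sliceL_mulLeft e]
    unfold swd
    rw [Finset.sum_comm]
    refine Finset.sum_congr rfl fun x _ => ?_
    rw [Finset.sum_comm]
  rw [h2]
  have h3 : ∀ z : H ⊗[k] N, KLin k fun x : H => (LinearMap.mulLeft k x).rTensor N z := fun z =>
    (by fun_prop : KLin k fun x : H => LinearMap.rTensorHom N (LinearMap.mul k H x) z)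
  rw [← swd_coassoc h (fun a c d => (LinearMap.mulLeft k (a * S c)).rTensor N (fl (d ⊗ₜ[k] m)))
    (fun b c => (h3 _).comp (by fun_prop)) (fun a c => (h3 _).comp (by fun_prop))
    (fun a b => by fun_prop)]
  have h4 : ∀ a b : H, swd (Δ a) (fun x y => (LinearMap.mulLeft k (x * S y)).rTensor N
      (fl (b ⊗ₜ[k] m))) = ε a • fl (b ⊗ₜ[k] m) := fun a b => by
    rw [swd_mul_antipode (k := k) a (f := fun x => (LinearMap.mulLeft k x).rTensor N
      (fl (b ⊗ₜ[k] m))) (h3 _), LinearMap.mulLeft_one, LinearMap.rTensor_id, LinearMap.id_apply]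
  simp only [h4]
  exact swd_counit_left (k := k) h (f := fun b => fl (b ⊗ₜ[k] m)) (by fun_prop)

end Shift

end FDMod

/-! ### Serre duality -/

namespace FDMod

open LeftComoduleAlgebra

variable {k : Type u} [Field k] {H : Type u} [Ring H] [HopfAlgebra k H] [FiniteDimensional k H]
variable {L : Type u} [Ring L] [Algebra k L] [FiniteDimensional k L] [LeftComoduleAlgebra k H L]

local notation "S" => (HopfAlgebra.antipode k : H →ₗ[k] H)

variable (I : IntegralData k H) (F : FrobeniusForm k L)
variable (hL : IsExactModuleCategory (FDMod k H) (FDMod k L))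

@[fun_prop] lemma klin_integralMap {M N : FDMod k L} :
    KLin k (fun g : IHom.obj (FDMod k H) N ((serre I.modular F).obj M) => integralMap I g) :=
  ⟨fun g g' => LinearMap.ext fun z => TensorProduct.tmul_add I.integral (serreEquiv I F M
      (ihomFun _ _ g z)) (serreEquiv I F M (ihomFun _ _ g' z)),
    fun c g => LinearMap.ext fun z => TensorProduct.tmul_smul c I.integral (serreEquiv I F M
      (ihomFun _ _ g z))⟩

lemma integralMap_ρ {M N : FDMod k L} (h : H)
    (g : IHom.obj (FDMod k H) N ((serre I.modular F).obj M)) :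
    integralMap I ((IHom.obj (FDMod k H) N ((serre I.modular F).obj M)).ρ h g) =
      integralMap I g ∘ₗ freeMul N h := rfl

/-- The trace `[M, Ser(M)] → k`. -/
def serreTrace (M : FDMod k L) :
    IHom.obj (FDMod k H) M ((serre I.modular F).obj M) ⟶ 𝟙_ (FDMod k H) :=
  ofLin (M := IHom.obj (FDMod k H) M ((serre I.modular F).obj M)) (N := unit k H)
    (KLin.toLin (k := k) (f := fun ξ => freeTrace F hL M (integralMap I ξ)) (by fun_prop))
    fun h ξ => by
      refine (congrArg (freeTrace F hL M) (integralMap_ρ I F h ξ)).trans ?_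
      -- Cyclicity moves right multiplication by h from the source to the values in Λ ⊗ M, where it
      -- is ε(h).
      rw [freeTrace_comp_comm hL (isFreeSemilinear_integralMap I ξ) (isFreeLinear_freeMul M h),
        freeMul_comp_integralMap, map_smul]
      rfl

/-- The pairing `[N, Ser(M)] ⊗ [M, N] → k`. -/
def serrePairing (M N : FDMod k L) :
    IHom.obj (FDMod k H) N ((serre I.modular F).obj M) ⊗ IHom.obj (FDMod k H) M N ⟶
      𝟙_ (FDMod k H) :=
  IHom.comp (FDMod k H) M N ((serre I.modular F).obj M) ≫ serreTrace I F hL M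

lemma integralMap_comp {M N P : FDMod k L}
    (g : IHom.obj (FDMod k H) N ((serre I.modular F).obj M)) (f : IHom.obj (FDMod k H) P N) :
    integralMap I (lin (IHom.comp (FDMod k H) P N ((serre I.modular F).obj M)) (g ⊗ₜ[k] f)) =
      integralMap I g ∘ₗ shiftFun 1 f := by
  refine TensorProduct.ext' fun h m => ?_
  rw [LinearMap.comp_apply, shiftFun_tmul, map_swd]
  refine (congrArg (fun y => I.integral ⊗ₜ[k] serreEquiv I F M y)
    (ihomFun_comp P N ((serre I.modular F).obj M) g f h m)).trans ?_
  rw [KLin.map_swd (φ := fun y => I.integral ⊗ₜ[k] serreEquiv I F M y) (by fun_prop)]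
  refine swd_congr _ fun a b => ?_
  rw [mul_one, integralMap_apply]

lemma pairFun_serrePairing {M N : FDMod k L}
    (g : IHom.obj (FDMod k H) N ((serre I.modular F).obj M)) (f : IHom.obj (FDMod k H) M N) :
    pairFun (serrePairing I F hL M N) (g ⊗ₜ[k] f) =
      freeTrace F hL M (integralMap I g ∘ₗ shiftFun 1 f) :=
  congrArg (freeTrace F hL M) (integralMap_comp I F g f)

/-- The map `[N, Ser(M)] → [M, N]^*` induced by the pairing. -/
def serreDual (M N : FDMod k L) : IHom.obj (FDMod k H) N ((serre I.modular F).obj M) ⟶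
    LDual.obj (IHom.obj (FDMod k H) M N) :=
  LDual.ofPairing (serrePairing I F hL M N)

lemma dualFun_serreDual {M N : FDMod k L}
    (g : IHom.obj (FDMod k H) N ((serre I.modular F).obj M)) (f : IHom.obj (FDMod k H) M N) :
    dualFun _ (lin (serreDual I F hL M N) g) f =
      freeTrace F hL M (integralMap I g ∘ₗ shiftFun 1 f) :=
  (dualFun_ofPairing _ g f).trans (pairFun_serrePairing I F hL g f)

/-- By `H`-linearity, the pairing with [M, N] alone determines the traces against all shifts, hence
against all of Hom_L(H ⊗ M, H ⊗ N). -/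
lemma dualFun_serreDual_antipode {M N : FDMod k L} (c : H)
    (g : IHom.obj (FDMod k H) N ((serre I.modular F).obj M)) (f : IHom.obj (FDMod k H) M N) :
    dualFun _ (lin (serreDual I F hL M N) g) ((IHom.obj (FDMod k H) M N).ρ (S c) f) =
      freeTrace F hL M (integralMap I g ∘ₗ shiftFun c f) := by
  rw [← dualFun_ρ, ← lin_comm, dualFun_serreDual, integralMap_ρ, LinearMap.comp_assoc,
    ← shiftFun_eq_comp]

lemma ext_shift {M N : FDMod k L} {V : Type*} [AddCommGroup V] [Module k V]
    {Ψ Ψ' : IHom.obj (FDMod k H) M (free H N) →ₗ[k] V}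
    (h : ∀ c f, Ψ (shift c f) = Ψ' (shift c f)) : Ψ = Ψ' := by
  refine LinearMap.ext fun f => ?_
  rw [← sum_shift_unshift (Module.finBasis k H) f, map_sum, map_sum]
  exact Finset.sum_congr rfl fun i _ => h _ _

lemma eq_zero_of_freeTrace_shiftFun {M N : FDMod k L} {G : H ⊗[k] N →ₗ[k] H ⊗[k] M}
    (hG : IsFreeSemilinear F G)
    (h : ∀ c (f : IHom.obj (FDMod k H) M N), freeTrace F hL M (G ∘ₗ shiftFun c f) = 0) :
    G = 0 := by
  refine eq_zero_of_freeTrace hL hG fun f hf => ?_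
  obtain ⟨f, rfl⟩ := hf.exists_eq
  exact LinearMap.congr_fun (ext_shift (Ψ := freeTrace F hL M ∘ₗ
    LinearMap.llcomp k _ _ _ G ∘ₗ freeFun M N) (Ψ' := 0) fun c f => h c f) f

lemma eq_of_freeTrace_shiftFun {M N : FDMod k L} {G G' : H ⊗[k] N →ₗ[k] H ⊗[k] M}
    (hG : IsFreeSemilinear F G) (hG' : IsFreeSemilinear F G')
    (h : ∀ c (f : IHom.obj (FDMod k H) M N),
      freeTrace F hL M (G ∘ₗ shiftFun c f) = freeTrace F hL M (G' ∘ₗ shiftFun c f)) :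
    G = G' := by
  have h1 : G + (-1 : k) • G' = 0 := by
    refine eq_zero_of_freeTrace_shiftFun F hL (fun a z => ?_) fun c f => ?_
    · rw [LinearMap.add_apply, LinearMap.add_apply, LinearMap.smul_apply, LinearMap.smul_apply,
        map_add, map_smul, hG, hG']
    · rw [LinearMap.add_comp, LinearMap.smul_comp, map_add, map_smul, h, neg_one_smul,
        add_neg_cancel]
  refine LinearMap.ext fun z => ?_
  have h2 := LinearMap.congr_fun h1 z
  rw [LinearMap.add_apply, LinearMap.smul_apply, neg_one_smul, ← sub_eq_add_neg] at h2
  exact sub_eq_zero.1 h2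

lemma serreDual_injective (M N : FDMod k L) :
    Function.Injective (lin (serreDual I F hL M N)) := by
  rw [injective_iff_map_eq_zero]
  intro g hg
  refine integralMap_injective I (F := F)
    (eq_zero_of_freeTrace_shiftFun F hL (isFreeSemilinear_integralMap I g) fun c f => ?_)
  rw [← dualFun_serreDual_antipode, hg, map_zero, LinearMap.zero_apply]

/-- The extension of a functional from [M, N] to H ⊗ [M, N] that is forced by the previous formula.
-/
lemma exists_forall_shift {M N : FDMod k L} (p : IHom.obj (FDMod k H) M N →ₗ[k] k) :
    ∃ Ψ : IHom.obj (FDMod k H) M (free H N) →ₗ[k] k, ∀ c f, Ψ (shift c f) =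
      p ((IHom.obj (FDMod k H) M N).ρ (S c) f) := by
  let e := Module.finBasis k H
  let A := IHom.obj (FDMod k H) M N
  refine ⟨KLin.toLin (k := k) (f := fun f => ∑ i, p (A.ρ (S (e i)) (unshift (e.coord i) f)))
    (by fun_prop), fun c f => ?_⟩
  have : ∀ i, unshift (e.coord i) (shift c f) = e.repr c i • f := fun i => unshift_shift _ _ _
  rw [KLin.toLin_apply]
  conv_rhs => rw [← e.sum_repr c]
  simp only [this, map_smul, map_sum, LinearMap.smul_apply, LinearMap.sum_apply]
  rfl

/-- Extend the functional to Hom_L(H ⊗ M, H ⊗ N), represent the extension by a semilinear G through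
the trace, and show that G is invariant, hence of the form Λ ⊗ g. -/
lemma serreDual_surjective (M N : FDMod k L) :
    Function.Surjective (lin (serreDual I F hL M N)) := by
  intro p
  obtain ⟨Ψ, hΨ⟩ := exists_forall_shift (dualFun (IHom.obj (FDMod k H) M N) p)
  obtain ⟨G, hG, hGf⟩ := exists_freeTrace_comp hL (F := F) Ψ
  have hGf' : ∀ f, freeTrace F hL M (G ∘ₗ freeFun M N f) = Ψ f := hGf
  obtain ⟨g, hg⟩ := exists_eq_integralMap I hG fun x => by
    have hGs : ∀ c (f : IHom.obj (FDMod k H) M N), IsFreeSemilinear F (G ∘ₗ shiftFun c f) :=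
      fun c f a z => by rw [LinearMap.comp_apply, isFreeLinear_shiftFun, hG, LinearMap.comp_apply]
    -- By cyclicity, right multiplication by x on the values of G becomes composition of the shift
    -- with it on the source, and the trace becomes p(S(x₍₁₎c)x₍₂₎f) = p(S(c)S(x₍₁₎)x₍₂₎f) =
    -- ε(x)p(S(c)f).
    refine eq_of_freeTrace_shiftFun F hL (fun a z => ?_) (fun a z => ?_) fun c f => ?_
    · rw [LinearMap.comp_apply, hG, isFreeLinear_freeMul, LinearMap.comp_apply]
    · rw [LinearMap.smul_apply, hG, LinearMap.smul_apply, map_smul]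
    · rw [LinearMap.smul_comp, LinearMap.comp_assoc, map_smul,
        ← freeTrace_comp_comm hL (hGs c f) (isFreeLinear_freeMul M x), LinearMap.comp_assoc,
        shiftFun_comp_freeMul, hGf', ← freeFun_shift, hGf', map_swd, hΨ]
      have h1 := swd_antipode_mul (k := k) x (f := fun y => dualFun _ p
        ((IHom.obj (FDMod k H) M N).ρ (S c * y) f)) (by fun_prop)
      rw [mul_one] at h1
      refine Eq.trans (swd_congr _ fun a b => ?_) h1
      rw [hΨ, HopfAlgebra.antipode_mul_antidistrib, ← mul_assoc, map_mul _ _ b]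
      rfl
  refine ⟨g, (dualFun _).injective (LinearMap.ext fun f => ?_)⟩
  rw [dualFun_serreDual, ← hg, ← freeFun_shift, hGf', hΨ, HopfAlgebra.antipode_one, map_one]
  rfl

/-- The isomorphism `[M, N]^* ≅ [N, Ser(M)]`. -/
def serreIso (M N : FDMod k L) : LDual.obj (IHom.obj (FDMod k H) M N) ≅
    IHom.obj (FDMod k H) N ((serre I.modular F).obj M) :=
  (isoOfEquiv (LinearEquiv.ofBijective (lin (serreDual I F hL M N))
    ⟨serreDual_injective I F hL M N, serreDual_surjective I F hL M N⟩)
    (lin_comm (serreDual I F hL M N))).symm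

lemma serreDual_pre (M : FDMod k L) {N N' : FDMod k L} (u : N ⟶ N') :
    IHom.pre (FDMod k H) u ((serre I.modular F).obj M) ≫ serreDual I F hL M N =
      serreDual I F hL M N' ≫ LDual.map (IHom.post (FDMod k H) M u) := by
  refine hom_ext (LinearMap.ext fun g => (dualFun _).injective (LinearMap.ext fun f => ?_))
  refine (dualFun_serreDual I F hL _ f).trans (Eq.trans (congrArg _ ?_)
    ((dualFun_serreDual I F hL g _).symm.trans (dualFun_map _ _ f).symm))
  refine TensorProduct.ext' fun h m => ?_
  rw [LinearMap.comp_apply, LinearMap.comp_apply, shiftFun_tmul, shiftFun_tmul, map_swd, map_swd]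
  refine swd_congr _ fun a b => ?_
  rw [integralMap_apply, integralMap_apply, ihomFun_post]
  exact congrArg (fun y => I.integral ⊗ₜ[k] serreEquiv I F M y) (ihomFun_pre _ _ _ _ _)

lemma serreDual_post {M M' : FDMod k L} (u : M ⟶ M') (N : FDMod k L) :
    IHom.post (FDMod k H) N ((serre I.modular F).map u) ≫ serreDual I F hL M' N =
      serreDual I F hL M N ≫ LDual.map (IHom.pre (FDMod k H) u N) := by
  refine hom_ext (LinearMap.ext fun g => (dualFun _).injective (LinearMap.ext fun f => ?_))
  refine (dualFun_serreDual I F hL _ f).trans (Eq.trans ?_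
    ((dualFun_serreDual I F hL g _).symm.trans (dualFun_map _ _ f).symm))
  let v : H ⊗[k] M →ₗ[k] H ⊗[k] M' := freeLin (regular k H ⊴ₗ u)
  have hv : IsFreeLinear v := isFreeLinear_freeLin _
  have h1 : shiftFun 1 (lin (IHom.pre (FDMod k H) u N) f) = shiftFun 1 f ∘ₗ v := by
    refine TensorProduct.ext' fun h m => ?_
    refine (shiftFun_tmul _ _ _ _).trans (Eq.trans ?_ (shiftFun_tmul _ _ _ _).symm)
    refine swd_congr _ fun a b => ?_
    rw [ihomFun_pre]
  have h2 : v ∘ₗ integralMap I g = integralMap I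
      (lin (IHom.post (FDMod k H) N ((serre I.modular F).map u)) g) := rfl
  have h3 : IsFreeSemilinear F (integralMap I g ∘ₗ shiftFun 1 f) := fun a z => by
    rw [LinearMap.comp_apply, isFreeLinear_shiftFun, isFreeSemilinear_integralMap,
      LinearMap.comp_apply]
  rw [h1, ← LinearMap.comp_assoc, freeTrace_comp_comm hL h3 hv, ← LinearMap.comp_assoc, h2]
  rfl

/-- The relative Serre functor of the category of `L`-modules. -/
def serreStructure : RelativeSerreStructure (FDMod k H) (serre (H := H) (L := L) I.modular F) where
  iso M N := serreIso I F hL M N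
  naturality_right M {N N'} u := by
    rw [← Iso.inv_comp_eq, ← Category.assoc, ← Iso.eq_comp_inv]
    exact (serreDual_pre I F hL M u).symm
  naturality_left u N := by
    rw [← Iso.inv_comp_eq, ← Category.assoc, ← Iso.eq_comp_inv]
    exact (serreDual_post I F hL u N).symm

lemma serreStructure_pairing (M N : FDMod k L) :
    (serreStructure I F hL).pairing M N = serrePairing I F hL M N := by
  refine hom_ext (TensorProduct.ext' fun g f => ?_)
  exact dualFun_ofPairing (serrePairing I F hL M N) g f

end FDMod

/-! ### The twisted module structure -/

namespace FDMod

open LeftComoduleAlgebra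

variable {k : Type u} [Field k] {H : Type u} [Ring H] [HopfAlgebra k H]
variable {L : Type u} [Ring L] [Algebra k L]

/-- The action of the algebra `H ⊗ L` on `X ⊗ M`. -/
def tensorAct (X : FDMod k H) (M : FDMod k L) : H ⊗[k] L →ₐ[k] Module.End k (X ⊗[k] M) :=
  (Module.endTensorEndAlgHom (R := k) (S := k) (A := k) (M := X) (N := M)).comp
    (Algebra.TensorProduct.map X.ρ M.ρ)

local notation "Δ" => (Coalgebra.comul : H →ₗ[k] H ⊗[k] H)
local notation "ε" => (Coalgebra.counit : H →ₗ[k] k)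
local notation "S" => (HopfAlgebra.antipode k : H →ₗ[k] H)
local notation "δ" => (coact : L →ₐ[k] H ⊗[k] L)

lemma tensorAct_tmul (X : FDMod k H) (M : FDMod k L) (h : H) (l : L) (x : X) (m : M) :
    tensorAct X M (h ⊗ₜ[k] l) (x ⊗ₜ[k] m) = X.ρ h x ⊗ₜ[k] M.ρ l m := rfl

lemma tensorAct_eq_swd (X : FDMod k H) (M : FDMod k L) (t : H ⊗[k] L) (x : X) (m : M) :
    tensorAct X M t (x ⊗ₜ[k] m) = swd t (fun h l => X.ρ h x ⊗ₜ[k] M.ρ l m) := by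
  conv_lhs => rw [← swd_tmul_self t,
    KLin.map_swd (φ := fun t => tensorAct X M t (x ⊗ₜ[k] m)) (by fun_prop)]
  rfl

/-- The action of an invertible element. -/
def tensorActEquiv (X : FDMod k H) (M : FDMod k L) {W V : H ⊗[k] L} (h : W * V = 1) :
    X ⊗[k] M ≃ₗ[k] X ⊗[k] M :=
  LinearEquiv.ofBijective (tensorAct X M W) (by
    have h1 : tensorAct X M W ∘ₗ tensorAct X M V = LinearMap.id := by
      rw [← Module.End.mul_eq_comp, ← map_mul, h, map_one]; rfl
    have h2 : Function.Surjective (tensorAct X M W) := fun z =>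
      ⟨tensorAct X M V z, LinearMap.congr_fun h1 z⟩
    exact ⟨LinearMap.injective_iff_surjective.2 h2, h2⟩)

/-- The linear isomorphism `X ⊗ M → X^{**} ⊗ M`. -/
def bidualTensor (X : FDMod k H) (M : FDMod k L) :
    X ⊗[k] M ≃ₗ[k] (LDual.obj (LDual.obj X) : FDMod k H) ⊗[k] M :=
  TensorProduct.congr (bidual X) (LinearEquiv.refl k M)

lemma bidualTensor_tmul (X : FDMod k H) (M : FDMod k L) (x : X) (m : M) :
    bidualTensor X M (x ⊗ₜ[k] m) = bidual X x ⊗ₜ[k] m := rfl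

lemma map_bidual {X Y : FDMod k H} (f : X ⟶ Y) (x : X) :
    lin (LDual.map (LDual.map f)) (bidual X x) = bidual Y (lin f x) := by
  refine (dualFun (LDual.obj Y)).injective (LinearMap.ext fun p => ?_)
  rw [dualFun_map, dualFun_bidual, dualFun_bidual, dualFun_map]

lemma map_tensor_bidual (X Y : FDMod k H) (x : X) (y : Y) :
    lin (LDual.map (LDual.tensor X Y)) (bidual (X ⊗ Y : FDMod k H) (x ⊗ₜ[k] y : X ⊗[k] Y)) =
      lin (LDual.tensor (LDual.obj Y) (LDual.obj X)) (bidual X x ⊗ₜ[k] bidual Y y :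
        (LDual.obj (LDual.obj X) : FDMod k H) ⊗[k] (LDual.obj (LDual.obj Y) : FDMod k H)) := by
  refine (dualFun (LDual.obj Y ⊗ LDual.obj X)).injective (TensorProduct.ext' fun q p => ?_)
  refine (dualFun_map (LDual.tensor X Y) _ _).trans ((dualFun_bidual _ _ _).trans ?_)
  refine (dualFun_tensor X Y q p x y).trans (Eq.trans ?_ (dualFun_tensor _ _ _ _ _ _).symm)
  rw [dualFun_bidual, dualFun_bidual, mul_comm]

lemma map_unit_bidual (c : k) :
    lin (LDual.map (LDual.unit (FDMod k H))) (bidual (𝟙_ (FDMod k H)) (show unit k H from c)) =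
      lin (LDual.unit (FDMod k H)) (show unit k H from c) := by
  have h1 : ∀ d : k, dualFun (𝟙_ (FDMod k H)) (lin (LDual.map (LDual.unit (FDMod k H)))
      (bidual (𝟙_ (FDMod k H)) (show unit k H from c))) (show unit k H from d) =
      dualFun (𝟙_ (FDMod k H)) (lin (LDual.unit (FDMod k H)) (show unit k H from c))
        (show unit k H from d) := fun d => by
    rw [dualFun_map, dualFun_bidual, dualFun_unit, dualFun_unit, mul_comm]
  exact (dualFun (𝟙_ (FDMod k H))).injective (LinearMap.ext h1)

variable [FiniteDimensional k H] [FiniteDimensional k L] [LeftComoduleAlgebra k H L]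
variable (I : IntegralData k H) (F : FrobeniusForm k L)

/-- The isomorphism `X ⊗ M → X^{**} ⊗ M`, the action of `twistTensor`. -/
def twistEquiv (X : FDMod k H) (M : FDMod k L) :
    X ⊗[k] M ≃ₗ[k] (LDual.obj (LDual.obj X) : FDMod k H) ⊗[k] M :=
  tensorActEquiv X M (exists_twistTensor_mul_eq_one I F).choose_spec ≪≫ₗ bidualTensor X M

lemma twistEquiv_apply (X : FDMod k H) (M : FDMod k L) (z : X ⊗[k] M) :
    twistEquiv I F X M z = bidualTensor X M (tensorAct X M (twistTensor I F) z) := rfl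

lemma twistEquiv_tmul (X : FDMod k H) (M : FDMod k L) (x : X) (m : M) :
    twistEquiv I F X M (x ⊗ₜ[k] m) =
      swd (twistTensor I F) (fun h l => bidual X (X.ρ h x) ⊗ₜ[k] M.ρ l m) := by
  rw [twistEquiv_apply, tensorAct_eq_swd,
    KLin.map_swd (φ := fun z => bidualTensor X M z) (by fun_prop)]
  rfl

lemma act_serre_ρ_bidualTensor (X : FDMod k H) (M : FDMod k L) (a : L) (z : X ⊗[k] M) :
    (LDual.obj (LDual.obj X) ⊙ₗ (serre I.modular F).obj M : FDMod k L).ρ a (bidualTensor X M z) =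
      bidualTensor X M (swd (δ a) (fun h l =>
        tensorAct X M (S (S h) ⊗ₜ[k] twistedNakayama I.modular F l) z)) := by
  refine KLin.ext_tmul (k := k) (f := fun z => ((LDual.obj (LDual.obj X) ⊙ₗ
    (serre I.modular F).obj M : FDMod k L).ρ a (bidualTensor X M z) :
      (LDual.obj (LDual.obj X) : FDMod k H) ⊗[k] M))
    (g := fun z => bidualTensor X M (swd (δ a) (fun h l =>
        tensorAct X M (S (S h) ⊗ₜ[k] twistedNakayama I.modular F l) z)))
    (by fun_prop) (by fun_prop) (fun x m => ?_) z
  refine (act_ρ_tmul (LDual.obj (LDual.obj X)) ((serre I.modular F).obj M) a (bidual X x) m).trans ?_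
  rw [KLin.map_swd (φ := fun z => bidualTensor X M z) (by fun_prop)]
  rfl

/-- The action on X^{**} is through S², so linearity is the identity (S²(a₍₋₁₎) ⊗ ν'(a₍₀₎))W =
Wδ(ν'(a)). -/
lemma twistEquiv_ρ (X : FDMod k H) (M : FDMod k L) (a : L) (z : X ⊗[k] M) :
    twistEquiv I F X M (((serre I.modular F).obj (X ⊙ₗ M)).ρ a z) =
      (LDual.obj (LDual.obj X) ⊙ₗ (serre I.modular F).obj M : FDMod k L).ρ a
        (twistEquiv I F X M z) := by
  refine Eq.trans ?_ (act_serre_ρ_bidualTensor I F X M a _).symm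
  refine congrArg (bidualTensor X M) ?_
  have h1 := congrArg (fun t => tensorAct X M t z) (swd_twistedNakayama_mul_twistTensor I F a)
  rw [KLin.map_swd (φ := fun t => tensorAct X M t z) (by fun_prop)] at h1
  simp only [map_mul, Module.End.mul_apply] at h1
  exact h1.symm

/-- The isomorphism `Ser(X ⊙ₗ M) ≅ X^{**} ⊙ₗ Ser(M)`. -/
def twistIso (X : FDMod k H) (M : FDMod k L) : (serre I.modular F).obj (X ⊙ₗ M) ≅
    LDual.obj (LDual.obj X) ⊙ₗ (serre I.modular F).obj M :=
  isoOfEquiv (M := (serre I.modular F).obj (X ⊙ₗ M))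
    (N := LDual.obj (LDual.obj X) ⊙ₗ (serre I.modular F).obj M)
    (twistEquiv I F X M) (twistEquiv_ρ I F X M)

/-- Twisting by X ⊗ Y acts through Δ(W₁) ⊗ W₂. Twisting by X first lets W₂ act on Y ⊗ M through δ,
after which W acts on Y ⊗ M. The two agree by `swd_twistTensor_comul`. -/
lemma twistIso_assoc (X Y : FDMod k H) (M : FDMod k L) :
    (twistIso I F (X ⊗ Y) M).hom ≫ LDual.map (LDual.tensor X Y) ⊵ₗ (serre I.modular F).obj M =
      (serre I.modular F).map (αₗ X Y M).hom ≫ (twistIso I F X (Y ⊙ₗ M)).hom ≫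
        LDual.obj (LDual.obj X) ⊴ₗ (twistIso I F Y M).hom ≫
        (αₗ (LDual.obj (LDual.obj X)) (LDual.obj (LDual.obj Y)) ((serre I.modular F).obj M)).inv ≫
        LDual.tensor (LDual.obj Y) (LDual.obj X) ⊵ₗ (serre I.modular F).obj M := by
  let T : (LDual.obj (LDual.obj X) : FDMod k H) ⊗[k] (LDual.obj (LDual.obj Y) : FDMod k H) →ₗ[k]
      (LDual.obj (LDual.obj Y ⊗ LDual.obj X) : FDMod k H) :=
    lin (LDual.tensor (LDual.obj Y) (LDual.obj X))
  let E : (LDual.obj (LDual.obj X) : FDMod k H) ⊗[k]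
      ((LDual.obj (LDual.obj Y) : FDMod k H) ⊗[k] M) →ₗ[k]
      (LDual.obj (LDual.obj Y ⊗ LDual.obj X) : FDMod k H) ⊗[k] M :=
    T.rTensor M ∘ₗ (TensorProduct.assoc k _ _ M).symm.toLinearMap
  refine hom_ext (TensorProduct.ext_threefold fun x y m => ?_)
  have h := congrArg (fun t : H ⊗[k] (H ⊗[k] L) => swd t (fun c z =>
    E (bidual X (X.ρ c x) ⊗ₜ[k] bidualTensor Y M (tensorAct Y M z (y ⊗ₜ[k] m)))))
    (swd_twistTensor_comul I F)
  rw [swd_swd _ _ _ (by fun_prop) (by fun_prop), swd_swd _ _ _ (by fun_prop) (by fun_prop)] at h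
  have hl : (lin ((twistIso I F (X ⊗ Y) M).hom ≫
      LDual.map (LDual.tensor X Y) ⊵ₗ (serre I.modular F).obj M) ((x ⊗ₜ[k] y : X ⊗[k] Y) ⊗ₜ[k] m :
      (X ⊗[k] Y) ⊗[k] M) : (LDual.obj (LDual.obj Y ⊗ LDual.obj X) : FDMod k H) ⊗[k] M) =
      swd (twistTensor I F) (fun h l => swd (Δ h) fun c d =>
        E (bidual X (X.ρ c x) ⊗ₜ[k] bidualTensor Y M (tensorAct Y M (d ⊗ₜ[k] l) (y ⊗ₜ[k] m)))) := by
    let D : (LDual.obj (LDual.obj (X ⊗ Y)) : FDMod k H) →ₗ[k]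
      (LDual.obj (LDual.obj Y ⊗ LDual.obj X) : FDMod k H) := lin (LDual.map (LDual.tensor X Y))
    refine (congrArg (D.rTensor M) (twistEquiv_tmul I F (X ⊗ Y) M (x ⊗ₜ[k] y : X ⊗[k] Y) m)).trans ?_
    rw [map_swd]
    let B : X ⊗[k] Y →ₗ[k] (LDual.obj (LDual.obj Y ⊗ LDual.obj X) : FDMod k H) :=
      D ∘ₗ (bidual (X ⊗ Y)).toLinearMap
    refine swd_congr _ fun h l => ?_
    refine (congrArg (fun w => B w ⊗ₜ[k] M.ρ l m) (tensor_ρ_tmul X Y h x y)).trans ?_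
    rw [KLin.map_swd (φ := fun w => B w ⊗ₜ[k] M.ρ l m) (by fun_prop)]
    exact swd_congr _ fun c d => congrArg (fun w => w ⊗ₜ[k] M.ρ l m) (map_tensor_bidual X Y _ _)
  have hr : swd (twistTensor I F) (fun h l => swd (Δ h) fun c d =>
      E (bidual X (X.ρ c x) ⊗ₜ[k] bidualTensor Y M (tensorAct Y M (d ⊗ₜ[k] l) (y ⊗ₜ[k] m)))) =
      swd (twistTensor I F) (fun h l => E (bidual X (X.ρ h x) ⊗ₜ[k]
        bidualTensor Y M (tensorAct Y M (twistTensor I F * δ l) (y ⊗ₜ[k] m)))) := by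
    refine Eq.trans (swd_congr _ fun a b => ?_) (h.symm.trans ?_)
    · rw [swd_swd _ _ _ (by fun_prop) (by fun_prop)]
      refine swd_congr _ fun c d => ?_
      rw [swd_tmul _ _ _ (by fun_prop) (by fun_prop)]
    · refine swd_congr _ fun a b => ?_
      rw [swd_tmul _ _ _ (by fun_prop) (by fun_prop)]
  refine hl.trans (hr.trans ?_)
  let R := (twistEquiv I F Y M).toLinearMap.lTensor (LDual.obj (LDual.obj X) : FDMod k H)
  refine Eq.trans ?_ (congrArg (E ∘ₗ R)
    (twistEquiv_tmul I F X (Y ⊙ₗ M) x (y ⊗ₜ[k] m : Y ⊗[k] M))).symm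
  refine Eq.trans (swd_congr _ fun c l => ?_) (map_swd (E ∘ₗ R) _ _).symm
  rw [map_mul]
  rfl

lemma twistIso_unit (M : FDMod k L) :
    (twistIso I F (𝟙_ (FDMod k H)) M).hom ≫
      LDual.map (LDual.unit (FDMod k H)) ⊵ₗ (serre I.modular F).obj M =
      (serre I.modular F).map (λₗ[FDMod k H] M).hom ≫
        (λₗ[FDMod k H] ((serre I.modular F).obj M)).inv ≫
          LDual.unit (FDMod k H) ⊵ₗ (serre I.modular F).obj M := by
  let T : unit k H →ₗ[k] (LDual.obj (𝟙_ (FDMod k H)) : FDMod k H) := lin (LDual.unit (FDMod k H))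
  let D : (LDual.obj (LDual.obj (𝟙_ (FDMod k H))) : FDMod k H) →ₗ[k]
    (LDual.obj (𝟙_ (FDMod k H)) : FDMod k H) := lin (LDual.map (LDual.unit (FDMod k H)))
  refine hom_ext (TensorProduct.ext' fun c m => ?_)
  refine (congrArg (D.rTensor M) (twistEquiv_tmul I F (𝟙_ (FDMod k H)) M c m)).trans ?_
  rw [map_swd]
  have h1 : ∀ (h : H) (l : L), D.rTensor M (bidual (𝟙_ (FDMod k H))
      ((𝟙_ (FDMod k H) : FDMod k H).ρ h c) ⊗ₜ[k] M.ρ l m) = T c ⊗ₜ[k] M.ρ (ε h • l) m :=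
    fun h l => by
      refine (congrArg (fun w => w ⊗ₜ[k] M.ρ l m) (map_unit_bidual (ε h * (show k from c)))).trans ?_
      refine (congrArg (fun w => w ⊗ₜ[k] M.ρ l m) (T.map_smul (ε h) c)).trans ?_
      rw [map_smul, LinearMap.smul_apply, TensorProduct.smul_tmul]
  simp only [h1]
  rw [← KLin.map_swd (φ := fun l => T c ⊗ₜ[k] M.ρ l m) (by fun_prop), ← sliceL_eq_swd,
    sliceL_counit_twistTensor, map_one]
  have h2 : T (show k from c) = (show k from c) • T (1 : k) :=
    (congrArg T (mul_one (show k from c)).symm).trans (T.map_smul (show k from c) (1 : k))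
  exact (congrArg (fun w => w ⊗ₜ[k] m) h2).trans (TensorProduct.smul_tmul _ _ _)

/-- The twisted module structure of the relative Serre functor. -/
def twistStructure : TwistedModuleStructure (FDMod k H) (serre (H := H) (L := L) I.modular F) where
  iso X M := twistIso I F X M
  naturality_left {X X'} f M := by
    let D : (LDual.obj (LDual.obj X) : FDMod k H) →ₗ[k]
      (LDual.obj (LDual.obj X') : FDMod k H) := lin (LDual.map (LDual.map f))
    refine hom_ext (TensorProduct.ext' fun x m => ?_)
    refine (twistEquiv_tmul I F X' M (lin f x) m).trans (Eq.trans ?_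
      (congrArg (D.rTensor M) (twistEquiv_tmul I F X M x m)).symm)
    rw [map_swd]
    refine swd_congr _ fun h l => ?_
    rw [← lin_comm, ← map_bidual]
    rfl
  naturality_right X {M M'} g := by
    let G : M →ₗ[k] M' := lin g
    refine hom_ext (TensorProduct.ext' fun x m => ?_)
    refine (twistEquiv_tmul I F X M' x (lin g m)).trans (Eq.trans ?_
      (congrArg (G.lTensor _) (twistEquiv_tmul I F X M x m)).symm)
    rw [map_swd]
    refine swd_congr _ fun h l => ?_
    rw [← lin_comm]
    rfl
  associativity := twistIso_assoc I F
  unitality := twistIso_unit I F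

end FDMod

/-! ### Composition of internal Homs and the module structures -/

namespace FDMod

open LeftComoduleAlgebra

variable {k : Type u} [Field k] {H : Type u} [Ring H] [HopfAlgebra k H] [FiniteDimensional k H]
variable {L : Type u} [Ring L] [Algebra k L] [FiniteDimensional k L] [LeftComoduleAlgebra k H L]

local notation "Δ" => (Coalgebra.comul : H →ₗ[k] H ⊗[k] H)
local notation "ε" => (Coalgebra.counit : H →ₗ[k] k)
local notation "S" => (HopfAlgebra.antipode k : H →ₗ[k] H)

/-- The composition of elements of internal Homs. -/
def icomp {M₁ M₂ M₃ : FDMod k L} (g : IHom.obj (FDMod k H) M₂ M₃)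
    (f : IHom.obj (FDMod k H) M₁ M₂) : IHom.obj (FDMod k H) M₁ M₃ :=
  lin (IHom.comp (FDMod k H) M₁ M₂ M₃) (g ⊗ₜ[k] f)

/-- The element of `[M, X ⊙ₗ N]` defined by `x` and an element of `[M, N]`. -/
def ileft {M N : FDMod k L} {X : FDMod k H} (x : X) (f : IHom.obj (FDMod k H) M N) :
    IHom.obj (FDMod k H) M (X ⊙ₗ N) :=
  lin (IHom.leftStr X M N) (x ⊗ₜ[k] f)

/-- The element of `[X ⊙ₗ M, N]` defined by an element of `[M, N]` and `p ∈ X^*`. -/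
def iright {M N : FDMod k L} {X : FDMod k H} (f : IHom.obj (FDMod k H) M N)
    (p : (LDual.obj X : FDMod k H)) : IHom.obj (FDMod k H) (X ⊙ₗ M) N :=
  lin (IHom.rightStr M N X)
    (f ⊗ₜ[k] p : IHom.obj (FDMod k H) M N ⊗[k] (LDual.obj X : FDMod k H))

variable {M N M₁ M₂ M₃ M₄ : FDMod k L} {X : FDMod k H}

lemma ihomFun_icomp (g : IHom.obj (FDMod k H) M₂ M₃) (f : IHom.obj (FDMod k H) M₁ M₂) (h : H)
    (m : M₁) : ihomFun M₁ M₃ (icomp g f) (h ⊗ₜ[k] m) =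
      swd (Δ h) (fun a b => ihomFun M₂ M₃ g (a ⊗ₜ[k] ihomFun M₁ M₂ f (b ⊗ₜ[k] m))) :=
  ihomFun_comp _ _ _ g f h m

lemma ihomFun_ileft (x : X) (f : IHom.obj (FDMod k H) M N) (h : H) (m : M) :
    ihomFun M (X ⊙ₗ N) (ileft x f) (h ⊗ₜ[k] m) =
      (swd (Δ h) (fun a b => X.ρ a x ⊗ₜ[k] ihomFun M N f (b ⊗ₜ[k] m)) : X ⊗[k] N) :=
  ihomFun_leftStr X M N x f h m

lemma ihomFun_iright (f : IHom.obj (FDMod k H) M N) (p : (LDual.obj X : FDMod k H)) (h : H) (x : X)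
    (m : M) : ihomFun (X ⊙ₗ M) N (iright f p) (h ⊗ₜ[k] (x ⊗ₜ[k] m : X ⊗[k] M)) =
      swd (Δ h) (fun a b => ihomFun M N f (a ⊗ₜ[k] (dualFun X p (X.ρ (S b) x) • m))) :=
  ihomFun_rightStr M N X f p h x m

lemma icomp_assoc (u : IHom.obj (FDMod k H) M₃ M₄) (g : IHom.obj (FDMod k H) M₂ M₃)
    (f : IHom.obj (FDMod k H) M₁ M₂) : icomp u (icomp g f) = icomp (icomp u g) f := by
  refine ihom_ext fun h m => ?_
  rw [ihomFun_icomp, ihomFun_icomp]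
  simp only [ihomFun_icomp]
  rw [swd_coassoc h (fun a b c =>
    ihomFun M₃ M₄ u (a ⊗ₜ[k] ihomFun M₂ M₃ g (b ⊗ₜ[k] ihomFun M₁ M₂ f (c ⊗ₜ[k] m))))]
  refine swd_congr _ fun a b => ?_
  rw [KLin.map_swd (φ := fun y => ihomFun M₃ M₄ u (a ⊗ₜ[k] y)) (by fun_prop)]

lemma icomp_unit_left (f : IHom.obj (FDMod k H) M N) : icomp (ihomUnit H N) f = f := by
  refine ihom_ext fun h m => ?_
  rw [ihomFun_icomp]
  refine Eq.trans (swd_congr _ fun a b => ihomFun_ihomUnit a _) ?_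
  exact swd_counit_left (k := k) h (f := fun b => ihomFun M N f (b ⊗ₜ[k] m)) (by fun_prop)

lemma icomp_pre_post {N' : FDMod k L} (e : M ≅ N) (g : IHom.obj (FDMod k H) N M₃)
    (f : IHom.obj (FDMod k H) N' N) :
    icomp (lin (IHom.pre (FDMod k H) e.hom M₃) g) (lin (IHom.post (FDMod k H) N' e.inv) f) =
      icomp g f := by
  refine ihom_ext fun h m => ?_
  rw [ihomFun_icomp, ihomFun_icomp]
  refine swd_congr _ fun a b => ?_
  rw [ihomFun_pre, ihomFun_post]
  have h1 := LinearMap.congr_fun (congrArg lin e.inv_hom_id) (ihomFun N' N f (b ⊗ₜ[k] m))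
  exact congrArg (fun y => ihomFun N M₃ g (a ⊗ₜ[k] y)) h1

/-- Contraction of adjacent factors X^* and X inside a composition; the antipode in the right
structure cancels the action of `H` on x. -/
lemma icomp_iright_ileft (v : IHom.obj (FDMod k H) N M₃) (p : (LDual.obj X : FDMod k H)) (x : X)
    (f : IHom.obj (FDMod k H) M N) :
    icomp (iright v p) (ileft x f) = dualFun X p x • icomp v f := by
  refine ihom_ext fun h m => ?_
  rw [ihomFun_icomp, map_smul, LinearMap.smul_apply, ihomFun_icomp]
  let T : H → H → H → H → M₃ := fun a b c d =>
    dualFun X p (X.ρ (S b * c) x) • ihomFun N M₃ v (a ⊗ₜ[k] ihomFun M N f (d ⊗ₜ[k] m))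
  have h1 : ∀ a b : H, ihomFun (X ⊙ₗ N) M₃ (iright v p)
      (a ⊗ₜ[k] ihomFun M (X ⊙ₗ N) (ileft x f) (b ⊗ₜ[k] m)) =
      swd (Δ a) (fun a₁ a₂ => swd (Δ b) fun c d => T a₁ a₂ c d) := fun a b => by
    let φ : H ⊗[k] (X ⊗[k] N) →ₗ[k] M₃ := ihomFun (X ⊙ₗ N) M₃ (iright v p)
    let Φ : X ⊗[k] N →ₗ[k] M₃ := φ ∘ₗ TensorProduct.mk k H (X ⊗[k] N) a
    refine (congrArg Φ (ihomFun_ileft x f b m)).trans ((map_swd Φ _ _).trans ?_)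
    rw [swd_comm]
    refine swd_congr _ fun c d => (ihomFun_iright v p a _ _).trans (swd_congr _ fun a₁ a₂ => ?_)
    rw [TensorProduct.tmul_smul, map_smul]
    simp only [T, map_mul]
    rfl
  simp only [h1]
  rw [swd_coassoc h (fun a₁ a₂ b => swd (Δ b) fun c d => T a₁ a₂ c d)]
  have h2 : ∀ a b : H, swd (Δ b) (fun a₂ b' => swd (Δ b') fun c d => T a a₂ c d) =
      dualFun X p x • ihomFun N M₃ v (a ⊗ₜ[k] ihomFun M N f (b ⊗ₜ[k] m)) := fun a b => by
    rw [← swd_coassoc b (fun a₂ c d => T a a₂ c d)]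
    have h3 : ∀ y d : H, swd (Δ y) (fun a₂ c => T a a₂ c d) = ε y • dualFun X p x •
        ihomFun N M₃ v (a ⊗ₜ[k] ihomFun M N f (d ⊗ₜ[k] m)) := fun y d => by
      have h4 := swd_antipode_mul (k := k) y (f := fun z => dualFun X p (X.ρ z x) •
        ihomFun N M₃ v (a ⊗ₜ[k] ihomFun M N f (d ⊗ₜ[k] m))) (by fun_prop)
      rw [map_one] at h4
      exact h4
    simp only [h3]
    exact swd_counit_left (k := k) b (f := fun d => dualFun X p x •
      ihomFun N M₃ v (a ⊗ₜ[k] ihomFun M N f (d ⊗ₜ[k] m))) (by fun_prop)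
  simp only [h2]
  rw [KLin.map_swd (φ := fun y => dualFun X p x • y) (by fun_prop)]

/-- Every element of [X ⊗ M, N] is a sum of products of [M, N] and X^*: insert a basis of X and its
dual. This is what makes the twisted structure unique. -/
lemma sum_iright_icomp {ι : Type*} [Fintype ι] (e : Module.Basis ι k X)
    (f : IHom.obj (FDMod k H) (X ⊙ₗ M) N) :
    ∑ i, iright (icomp f (ileft (e i) (ihomUnit H M))) ((dualFun X).symm (e.coord i)) = f := by
  let φ : H ⊗[k] (X ⊗[k] M) →ₗ[k] N := ihomFun (X ⊙ₗ M) N f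
  have h1 : ∀ (y : X) (a : H) (m : M), ihomFun M N (icomp f (ileft y (ihomUnit H M)))
      (a ⊗ₜ[k] m) = swd (Δ a) (fun c d =>
        ihomFun (X ⊙ₗ M) N f (c ⊗ₜ[k] (X.ρ d y ⊗ₜ[k] m : X ⊗[k] M))) := fun y a m => by
    rw [ihomFun_icomp]
    refine swd_congr _ fun c d => ?_
    let Φ : X ⊗[k] M →ₗ[k] N := φ ∘ₗ TensorProduct.mk k H (X ⊗[k] M) c
    have h2 : (swd (Δ d) (fun r s => X.ρ r y ⊗ₜ[k] ihomFun M M (ihomUnit H M) (s ⊗ₜ[k] m)) :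
        X ⊗[k] M) = X.ρ d y ⊗ₜ[k] m := by
      simp only [ihomFun_ihomUnit, TensorProduct.tmul_smul]
      exact swd_counit_right (k := k) d (f := fun r => X.ρ r y ⊗ₜ[k] m) (by fun_prop)
    exact congrArg Φ ((ihomFun_ileft y (ihomUnit H M) d m).trans h2)
  have h2 : ∀ (h : H) (x : X) (m : M), ∑ i, ihomFun (X ⊙ₗ M) N
      (iright (icomp f (ileft (e i) (ihomUnit H M))) ((dualFun X).symm (e.coord i)))
        (h ⊗ₜ[k] (x ⊗ₜ[k] m : X ⊗[k] M)) =
      ihomFun (X ⊙ₗ M) N f (h ⊗ₜ[k] (x ⊗ₜ[k] m : X ⊗[k] M)) := fun h x m => by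
    let Φ : H → X →ₗ[k] N := fun c => φ ∘ₗ TensorProduct.mk k H (X ⊗[k] M) c ∘ₗ
      (TensorProduct.mk k X M).flip m
    have h3 : ∀ y, KLin k fun c => Φ c y := fun y =>
      (by fun_prop : KLin k fun c : H => φ (c ⊗ₜ[k] (y ⊗ₜ[k] m)))
    have h4 : ∀ i, ihomFun (X ⊙ₗ M) N
        (iright (icomp f (ileft (e i) (ihomUnit H M))) ((dualFun X).symm (e.coord i)))
          (h ⊗ₜ[k] (x ⊗ₜ[k] m : X ⊗[k] M)) =
        swd (Δ h) (fun a b => swd (Δ a) fun c d => Φ c (X.ρ d (e.coord i (X.ρ (S b) x) • e i))) :=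
      fun i => by
        rw [ihomFun_iright]
        refine swd_congr _ fun a b => ?_
        rw [TensorProduct.tmul_smul, map_smul, h1,
          KLin.map_swd (φ := fun y => dualFun X _ (X.ρ (S b) x) • y) (by fun_prop)]
        refine swd_congr _ fun c d => ?_
        rw [map_smul, map_smul]
        rfl
    simp only [h4]
    have h5 : ∑ i, swd (Δ h) (fun a b => swd (Δ a) fun c d =>
        Φ c (X.ρ d (e.coord i (X.ρ (S b) x) • e i))) =
        swd (Δ h) (fun a b => swd (Δ a) fun c d => Φ c (X.ρ (d * S b) x)) := by
      have h6 : ∀ b c d : H, ∑ i, Φ c (X.ρ d (e.coord i (X.ρ (S b) x) • e i)) =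
          Φ c (X.ρ (d * S b) x) := fun b c d => by
        rw [← map_sum, ← map_sum]
        refine congrArg (Φ c) ?_
        rw [map_mul]
        exact congrArg (X.ρ d) (e.sum_repr _)
      simp only [← h6]
      unfold swd
      rw [Finset.sum_comm]
      refine Finset.sum_congr rfl fun x _ => ?_
      rw [Finset.sum_comm]
    rw [h5, swd_coassoc h (fun c d b => Φ c (X.ρ (d * S b) x)) (fun _ _ => h3 _)]
    have h7 : ∀ c b : H, swd (Δ b) (fun d b' => Φ c (X.ρ (d * S b') x)) = ε b • Φ c x :=
      fun c b => by
        have h8 := swd_mul_antipode (k := k) b (f := fun z => Φ c (X.ρ z x)) (by fun_prop)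
        rw [map_one] at h8
        exact h8
    simp only [h7]
    exact swd_counit_right (k := k) h (f := fun c => Φ c x) (h3 x)
  refine ihom_ext fun h z => ?_
  rw [map_sum, LinearMap.sum_apply]
  let φ' : _ → H ⊗[k] (X ⊗[k] M) →ₗ[k] N := fun i => ihomFun (X ⊙ₗ M) N
    (iright (icomp f (ileft (e i) (ihomUnit H M))) ((dualFun X).symm (e.coord i)))
  exact KLin.ext_tmul (k := k) (f := fun z : X ⊗[k] M => ∑ i, φ' i (h ⊗ₜ[k] z))
    (g := fun z => φ (h ⊗ₜ[k] z)) (by fun_prop) (by fun_prop) (h2 h) z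

end FDMod

/-! ### Traces and contraction with elements of the dual -/

namespace FDMod

open LeftComoduleAlgebra HopfAlgebra

variable {k : Type u} [Field k] {H : Type u} [Ring H] [HopfAlgebra k H] [FiniteDimensional k H]
variable {L : Type u} [Ring L] [Algebra k L] [FiniteDimensional k L] [LeftComoduleAlgebra k H L]

local notation "Δ" => (Coalgebra.comul : H →ₗ[k] H ⊗[k] H)
local notation "S" => (HopfAlgebra.antipode k : H →ₗ[k] H)
local notation "S'" => (LinearEquiv.symm (antipodeEquiv (k := k) (H := H)))
local notation "δ" => (coact : L →ₐ[k] H ⊗[k] L)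

/-- The linear map `H ⊗ M → L` underlying a morphism of modules. -/
def freeCoord {M : FDMod k L} (t : free H M ⟶ regular k L) : H ⊗[k] M →ₗ[k] L := coordFun t

lemma freeCoord_freeAct {M : FDMod k L} (t : free H M ⟶ regular k L) (a : L) (z : H ⊗[k] M) :
    freeCoord t (freeAct M a z) = a * freeCoord t z := coordFun_ρ t a z

section Contraction

variable {M N : FDMod k L} {X : FDMod k H} (p : (LDual.obj X : FDMod k H))

variable (M) in
/-- The map `h ⊗ x ⊗ m ↦ h₁ ⊗ p(S(h₂) x) m`. -/
def contr : H ⊗[k] (X ⊙ₗ M : FDMod k L) →ₗ[k] H ⊗[k] M :=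
  freeFun (X ⊙ₗ M) M (iright (ihomMk (𝟙 (free H M))) p)

lemma isFreeLinear_contr : IsFreeLinear (contr M p) := isFreeLinear_freeFun _

lemma contr_tmul (h : H) (x : X) (m : M) : contr M p (h ⊗ₜ[k] (x ⊗ₜ[k] m : X ⊗[k] M)) =
    swd (Δ h) (fun a b => a ⊗ₜ[k] (dualFun X p (X.ρ (S b) x) • m)) :=
  ihomFun_iright (ihomMk (𝟙 (free H M))) p h x m

lemma shiftFun_iright (f : IHom.obj (FDMod k H) M N) :
    shiftFun 1 (iright f p) = shiftFun 1 f ∘ₗ contr M p := by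
  refine TensorProduct.ext' fun h z => ?_
  let φ : H ⊗[k] (X ⊗[k] M) →ₗ[k] H ⊗[k] N := shiftFun 1 (iright f p)
  let ψ : H ⊗[k] (X ⊗[k] M) →ₗ[k] H ⊗[k] N := shiftFun 1 f ∘ₗ contr M p
  have h1 : ∀ (x : X) (m : M), φ (h ⊗ₜ[k] (x ⊗ₜ[k] m)) = ψ (h ⊗ₜ[k] (x ⊗ₜ[k] m)) := fun x m => by
    refine (shiftFun_tmul 1 (iright f p) h _).trans (Eq.trans ?_
      (congrArg (shiftFun 1 f) (contr_tmul p h x m)).symm)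
    rw [map_swd]
    simp only [mul_one, shiftFun_tmul]
    rw [swd_coassoc h (fun a c b =>
      a ⊗ₜ[k] ihomFun M N f (c ⊗ₜ[k] (dualFun X p (X.ρ (S b) x) • m)))]
    refine swd_congr _ fun a b => ?_
    refine (congrArg (fun y => a ⊗ₜ[k] y) (ihomFun_iright f p b x m)).trans ?_
    rw [KLin.map_swd (φ := fun y => a ⊗ₜ[k] y) (by fun_prop)]
  exact KLin.ext_tmul (k := k) (f := fun z : X ⊗[k] M => φ (h ⊗ₜ[k] z))
    (g := fun z => ψ (h ⊗ₜ[k] z)) (by fun_prop) (by fun_prop) h1 z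

end Contraction

variable (I : IntegralData k H) (F : FrobeniusForm k L)

section Pairing

variable (M : FDMod k L) {X : FDMod k H} (p : (LDual.obj X : FDMod k H))

/-- The element `h ⊗ ξ ⊗ m ↦ ⟨S(h) ξ, p⟩ m` of `[X^{**} ⊙ₗ Ser(M), Ser(M)]`. -/
def bidualContr : IHom.obj (FDMod k H) (LDual.obj (LDual.obj X) ⊙ₗ (serre I.modular F).obj M)
    ((serre I.modular F).obj M) :=
  iright (ihomUnit H ((serre I.modular F).obj M)) (bidual (LDual.obj X) p)

/-- The linear map underlying `bidualContr`. -/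
def bidualContrFun : H ⊗[k] ((LDual.obj (LDual.obj X) : FDMod k H) ⊗[k] M) →ₗ[k] M :=
  (serreEquiv I F M).toLinearMap ∘ₗ ihomFun _ _ (bidualContr I F M p)

/-- The cube has two sources: one S from the right structure, and S² from the action on X^{**}. -/
lemma bidualContrFun_apply (h : H) (z : X ⊗[k] M) :
    bidualContrFun I F M p (h ⊗ₜ[k] bidualTensor X M z) =
      sliceL (dualFun X p ∘ₗ X.ρ (S (S (S h)))) z := by
  refine KLin.ext_tmul (k := k)
    (f := fun z => bidualContrFun I F M p (h ⊗ₜ[k] bidualTensor X M z))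
    (g := fun z => sliceL (dualFun X p ∘ₗ X.ρ (S (S (S h)))) z) (by fun_prop) (by fun_prop)
    (fun x m => ?_) z
  refine (congrArg (serreEquiv I F M) (ihomFun_iright (ihomUnit H ((serre I.modular F).obj M))
    (bidual (LDual.obj X) p) h (bidual X x) m)).trans ?_
  rw [sliceL_tmul]
  have h1 := swd_counit_left (k := k) h
    (f := fun b => dualFun X p (X.ρ (S (S (S b))) x) • m) (by fun_prop)
  refine Eq.trans ?_ h1
  rw [KLin.map_swd (φ := fun y => serreEquiv I F M y) (by fun_prop)]
  refine swd_congr _ fun a b => ?_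
  rw [ihomFun_ihomUnit, map_smul]
  rfl

/-- The element `h ⊗ n ↦ ⟨p, S³(h) -⟩ s(n)` of `[Ser(X ⊙ₗ M), Ser(M)]`. -/
def twistContr : IHom.obj (FDMod k H) ((serre I.modular F).obj (X ⊙ₗ M))
    ((serre I.modular F).obj M) :=
  lin (IHom.pre (FDMod k H) (twistIso I F X M).hom ((serre I.modular F).obj M))
    (bidualContr I F M p)

/-- The linear map underlying `twistContr`. -/
def twistContrFun : H ⊗[k] (X ⊗[k] M) →ₗ[k] M :=
  (serreEquiv I F M).toLinearMap ∘ₗ ihomFun _ _ (twistContr I F M p)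

lemma twistContrFun_apply (h : H) (z : X ⊗[k] M) :
    twistContrFun I F M p (h ⊗ₜ[k] z) =
      sliceL (dualFun X p ∘ₗ X.ρ (S (S (S h)))) (tensorAct X M (twistTensor I F) z) := by
  rw [← bidualContrFun_apply I F]
  exact congrArg (serreEquiv I F M) (ihomFun_pre (twistIso I F X M).hom _ (bidualContr I F M p) h z)

/-- The intertwining relation moves ν'(e) to the other side of W. The factors ν' and χ then become
actions on Λ ⊗ m, where the Nakayama identity brings the form into a slice of the form tensor; that
slice is known by its defining property. -/
lemma form_twistContr (τ : free H M ⟶ regular k L) (a : H) (e : L) (x : X) (m : M) :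
    F.form (freeCoord τ (I.integral ⊗ₜ[k] twistContrFun I F M p
      (a ⊗ₜ[k] tensorAct X M (δ (twistedNakayama I.modular F e)) (x ⊗ₜ[k] m)))) =
    dualFun X p (X.ρ (S (S (S (coactRight H (F.form ∘ₗ LinearMap.mulRight k e)
      (freeCoord τ (I.integral ⊗ₜ[k] m)) * a))) * I.distinguished) x) := by
  let c := freeCoord τ (I.integral ⊗ₜ[k] m)
  let q : H →ₗ[k] k := KLin.toLin (k := k)
    (f := fun u => dualFun X p (X.ρ (S (S (S u)) * I.distinguished) x)) (by fun_prop)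
  have h1 : ∀ l b, F.form (freeCoord τ (I.integral ⊗ₜ[k]
      M.ρ (twistedNakayama I.modular F l) (M.ρ (coactLeftHom I.modular b) m))) =
      F.form (b * (c * l)) := fun l b => by
    rw [← Module.End.mul_apply, ← map_mul, twistedNakayama_apply, ← map_mul,
      ← freeAct_integral_tmul, freeCoord_freeAct, mul_assoc, F.form_nakayama_mul, mul_assoc]
  have h0 : ∀ (t s : H ⊗[k] L) z, tensorAct X M t (tensorAct X M s z) = tensorAct X M (t * s) z :=
    fun t s z => by rw [map_mul]; rfl
  rw [twistContrFun_apply, h0, ← swd_twistedNakayama_mul_twistTensor,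
    KLin.map_swd (φ := fun y => F.form (freeCoord τ (I.integral ⊗ₜ[k]
      sliceL (dualFun X p ∘ₗ X.ρ (S (S (S a)))) (tensorAct X M y (x ⊗ₜ[k] m))))) (by fun_prop)]
  have h2 : ∀ h l, F.form (freeCoord τ (I.integral ⊗ₜ[k]
      sliceL (dualFun X p ∘ₗ X.ρ (S (S (S a)))) (tensorAct X M
        ((S (S h) ⊗ₜ[k] twistedNakayama I.modular F l) * twistTensor I F) (x ⊗ₜ[k] m)))) =
      q (coactRight H F.form (c * l) * S' h * a) := fun h l => by
    rw [← h0, tensorAct_eq_swd, twistTensor,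
      swd_map _ _ _ _ (by fun_prop) (by fun_prop),
      KLin.map_swd (φ := fun y => F.form (freeCoord τ (I.integral ⊗ₜ[k]
        sliceL (dualFun X p ∘ₗ X.ρ (S (S (S a)))) (tensorAct X M
          (S (S h) ⊗ₜ[k] twistedNakayama I.modular F l) y)))) (by fun_prop),
      ← sliceR_formTensor, sliceR_eq_swd,
      KLin.map_swd (φ := fun y => q (y * S' h * a)) (by fun_prop)]
    refine swd_congr _ fun b₁ b₂ => ?_
    rw [tensorAct_tmul, sliceL_tmul, TensorProduct.tmul_smul, map_smul, map_smul]
    refine (congrArg (fun y => _ • y) (h1 l b₂)).trans ?_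
    rw [smul_mul_assoc, smul_mul_assoc, map_smul, smul_eq_mul, smul_eq_mul, mul_comm]
    refine congrArg₂ (· * ·) rfl ?_
    simp only [q, KLin.toLin_apply, antipode_mul_antidistrib, map_mul, LinearMap.comp_apply,
      antipode_antipodeEquiv_symm, mul_assoc, LinearMap.mulRight_apply, Module.End.mul_apply]
  simp only [h2]
  rw [← KLin.map_swd (φ := fun y => q (y * a)) (by fun_prop),
    swd_coactRight_mul_antipodeEquiv_symm]
  rfl

end Pairing

/-- The functional `h ⊗ m ↦ Q(h₁) λ(t(h₂ ⊗ m))`. -/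
def coactPair {M : FDMod k L} (Q : H →ₗ[k] k) (t : free H M ⟶ regular k L) : H ⊗[k] M →ₗ[k] k :=
  KLin.toLin (k := k) (f := fun z => swd z fun h m => swd (Δ h) fun a b =>
    Q a * F.form (freeCoord t (b ⊗ₜ[k] m))) (by fun_prop)

lemma coactPair_tmul {M : FDMod k L} (Q : H →ₗ[k] k) (t : free H M ⟶ regular k L) (h : H) (m : M) :
    coactPair F Q t (h ⊗ₜ[k] m) =
      swd (Δ h) (fun a b => Q a * F.form (freeCoord t (b ⊗ₜ[k] m))) := by
  rw [coactPair, KLin.toLin_apply, swd_tmul _ _ _ (by fun_prop) (by fun_prop)]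

/-- Brings the functional into the shape produced by `form_twistContr`. Since t is `L`-linear, only
the outer part of the coaction of c remains visible to `Q`. -/
lemma coactPair_freeAct {M : FDMod k L} (Q : H →ₗ[k] k) (t : free H M ⟶ regular k L) (c : L) (h : H)
    (m : M) : coactPair F Q t (freeAct M c (h ⊗ₜ[k] m)) = swd (Δ h) (fun a b =>
      Q (coactRight H (F.form ∘ₗ LinearMap.mulRight k (freeCoord t (b ⊗ₜ[k] m))) c * a)) := by
  rw [freeAct_tmul, map_swd]
  simp only [coactPair_tmul, Bialgebra.comul_mul]
  have h1 : ∀ x l, swd (Δ x * Δ h) (fun a b => Q a * F.form (freeCoord t (b ⊗ₜ[k] M.ρ l m))) =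
      swd (Δ x) (fun u v => swd (Δ h) fun a b =>
        Q (u * a) * F.form (freeCoord t ((v * b) ⊗ₜ[k] M.ρ l m))) := fun x l =>
    swd_mul _ _ _ (by fun_prop) (by fun_prop)
  simp only [h1]
  rw [swd_coact_coassoc c (fun u v l => swd (Δ h) fun a b =>
    Q (u * a) * F.form (freeCoord t ((v * b) ⊗ₜ[k] M.ρ l m)))]
  have h2 : ∀ u l, swd (δ l) (fun v l' => swd (Δ h) fun a b =>
      Q (u * a) * F.form (freeCoord t ((v * b) ⊗ₜ[k] M.ρ l' m))) =
      swd (Δ h) (fun a b => Q (u * a) * F.form (l * freeCoord t (b ⊗ₜ[k] m))) := fun u l => by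
    rw [swd_comm]
    refine swd_congr _ fun a b => ?_
    rw [← freeCoord_freeAct, freeAct_tmul,
      KLin.map_swd (φ := fun z => Q (u * a) * F.form (freeCoord t z)) (by fun_prop)]
  simp only [h2]
  rw [swd_comm]
  refine swd_congr _ fun a b => ?_
  rw [coactRight_eq_swd, KLin.map_swd (φ := fun z => Q (z * a)) (by fun_prop)]
  refine swd_congr _ fun u l => ?_
  rw [smul_mul_assoc, map_smul, smul_eq_mul, mul_comm]
  rfl

section Trace

variable {I F} {M : FDMod k L} {X : FDMod k H} (p : (LDual.obj X : FDMod k H))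
variable (hL : IsExactModuleCategory (FDMod k H) (FDMod k L))

variable (I) in
/-- The functional `u ↦ ⟨p, S³(u) g x⟩`, where `g` is the distinguished group-like element. -/
def distinguishedFun (x : X) : H →ₗ[k] k :=
  KLin.toLin (k := k) (f := fun u => dualFun X p (X.ρ (S (S (S u)) * I.distinguished) x))
    (by fun_prop)

/-- The element `z ↦ t(z) n` of `[M, N]`. -/
def irank {N : FDMod k L} (t : free H M ⟶ regular k L) (n : N) : IHom.obj (FDMod k H) M N :=
  rankOne t n

/-- The rank-one trace formula gives ⟨p, S(Λ₍₂₎)x⟩λ(t(Λ₍₁₎ ⊗ m)), and S(Λ₍₂₎) ⊗ Λ₍₁₎ = S³(Λ₍₁₎)g ⊗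
Λ₍₂₎ puts it into the common form. -/
lemma freeTrace_contr_irank (t : free H M ⟶ regular k L) (x : X) (m : M) :
    freeTrace F hL M (contr M p ∘ₗ integralMap I
      (irank t (show (serre I.modular F).obj (X ⊙ₗ M) from (x ⊗ₜ[k] m : X ⊗[k] M)))) =
      coactPair F (distinguishedFun I p x) t (I.integral ⊗ₜ[k] m) := by
  let N := (serre I.modular F).obj (X ⊙ₗ M)
  let G : N →ₗ[k] H ⊗[k] M := contr M p ∘ₗ
    TensorProduct.mk k H (X ⊙ₗ M : FDMod k L) I.integral ∘ₗ (serreEquiv I F (X ⊙ₗ M)).toLinearMap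
  have hG : IsSemilinear F (Q := N) (P := free H M) G := fun a y => by
    have h1 := freeAct_nakayama_integral_tmul I (F := F) (X ⊙ₗ M) a (serreEquiv I F (X ⊙ₗ M) y)
    exact (congrArg (contr M p) h1.symm).trans (isFreeLinear_contr p _ _)
  refine (ftrace_comp_rankOne (freeTrace_spec hL M) hG t _).trans ?_
  refine (congrArg (fun y => F.form (freeCoord t y)) (contr_tmul p I.integral x m)).trans ?_
  rw [coactPair_tmul, KLin.map_swd (φ := fun y => F.form (freeCoord t y)) (by fun_prop)]
  let Ψ : H ⊗[k] H →ₗ[k] k := KLin.toLin (k := k) (f := fun y => swd y fun a b =>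
    dualFun X p (X.ρ a x) * F.form (freeCoord t (b ⊗ₜ[k] m))) (by fun_prop)
  have hΨ : ∀ a b, Ψ (a ⊗ₜ[k] b) = dualFun X p (X.ρ a x) * F.form (freeCoord t (b ⊗ₜ[k] m)) :=
    fun a b => swd_tmul a b (fun a b => dualFun X p (X.ρ a x) * F.form (freeCoord t (b ⊗ₜ[k] m)))
      (by fun_prop) (by fun_prop)
  have h2 := congrArg Ψ I.swd_antipode_tmul
  rw [map_swd, map_swd] at h2
  simp only [hΨ] at h2
  refine Eq.trans (swd_congr _ fun a b => ?_) h2.symm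
  rw [TensorProduct.tmul_smul, map_smul, map_smul, smul_eq_mul]

lemma form_twistContr_irank (t τ : free H M ⟶ regular k L) (x : X) (m : M) (z : H ⊗[k] M) :
    F.form (freeCoord τ (integralMap I (twistContr I F M p) (shiftFun 1
      (irank t (show (serre I.modular F).obj (X ⊙ₗ M) from (x ⊗ₜ[k] m : X ⊗[k] M))) z))) =
    coactPair F (distinguishedFun I p x) t
      (freeAct M (freeCoord τ (I.integral ⊗ₜ[k] m)) z) := by
  refine KLin.ext_tmul (k := k) (f := fun z => F.form (freeCoord τ (integralMap I
    (twistContr I F M p) (shiftFun 1 (irank t (show (serre I.modular F).obj (X ⊙ₗ M) from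
      (x ⊗ₜ[k] m : X ⊗[k] M))) z)))) (g := fun z => coactPair F (distinguishedFun I p x) t
      (freeAct M (freeCoord τ (I.integral ⊗ₜ[k] m)) z)) (by fun_prop) (by fun_prop)
      (fun h m' => ?_) z
  rw [coactPair_freeAct, shiftFun_tmul, KLin.map_swd (φ := fun y => F.form (freeCoord τ
    (integralMap I (twistContr I F M p) y))) (by fun_prop)]
  refine swd_congr _ fun a b => ?_
  rw [mul_one]
  exact form_twistContr I F M p τ a (freeCoord t (b ⊗ₜ[k] m')) x m

lemma freeTrace_twistContr_irank (t : free H M ⟶ regular k L) (x : X) (m : M) :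
    freeTrace F hL M (integralMap I (twistContr I F M p) ∘ₗ shiftFun 1
      (irank t (show (serre I.modular F).obj (X ⊙ₗ M) from (x ⊗ₜ[k] m : X ⊗[k] M)))) =
      coactPair F (distinguishedFun I p x) t (I.integral ⊗ₜ[k] m) := by
  have ht := freeTrace_spec hL M
  rw [freeTrace_eq hL M ht fun a z => by
    rw [LinearMap.comp_apply, isFreeLinear_shiftFun, isFreeSemilinear_integralMap,
      LinearMap.comp_apply]]
  refine Eq.trans (Finset.sum_congr rfl fun i _ =>
    form_twistContr_irank (I := I) (F := F) p t _ x m _) ?_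
  -- The dual-basis expansion of Λ ⊗ m: each summand is the functional at τⁱ(Λ ⊗ m)tᵢ.
  rw [← map_sum]
  exact congrArg (coactPair F (distinguishedFun I p x) t) (ht.sum (I.integral ⊗ₜ[k] m : H ⊗[k] M))

/-- Contraction with p on H ⊗ M corresponds, under the trace, to composition with contraction after
the twist by W. Rank-one maps suffice because dual bases write every map as a sum of them. -/
lemma freeTrace_contr_comp
    (f : IHom.obj (FDMod k H) M ((serre I.modular F).obj (X ⊙ₗ M))) :
    freeTrace F hL M (contr M p ∘ₗ integralMap I f) =
      freeTrace F hL M (integralMap I (twistContr I F M p) ∘ₗ shiftFun 1 f) := by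
  let N := (serre I.modular F).obj (X ⊙ₗ M)
  let Ψ₁ : homSubmodule (free H M) N →ₗ[k] k := freeTrace F hL M ∘ₗ
    LinearMap.llcomp k _ _ _ (contr M p) ∘ₗ KLin.toLin (klin_integralMap I F)
  let Ψ₂ : homSubmodule (free H M) N →ₗ[k] k := freeTrace F hL M ∘ₗ
    LinearMap.llcomp k _ _ _ (integralMap I (twistContr I F M p)) ∘ₗ
      KLin.toLin (k := k) (f := fun f => freeFun M N (shift 1 f)) (by fun_prop)
  have h1 : ∀ t : free H M ⟶ regular k L, Ψ₁ ∘ₗ rankOne t = Ψ₂ ∘ₗ rankOne t := fun t =>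
    TensorProduct.ext' fun x m => (freeTrace_contr_irank p hL t x m).trans
      (freeTrace_twistContr_irank p hL t x m).symm
  obtain ⟨n, s, t, h⟩ := exists_isDualBases (projective_regular_act hL M)
  have h2 : ∀ f : homSubmodule (free H M) N, Ψ₁ f = Ψ₂ f := fun f => by
    rw [← sum_rankOne h f, map_sum, map_sum]
    exact Finset.sum_congr rfl fun j _ => LinearMap.congr_fun (h1 (t j)) _
  exact h2 f

end Trace

end FDMod

/-! ### Compatibility with the bimodule structures -/

namespace FDMod

open LeftComoduleAlgebra

variable {k : Type u} [Field k] {H : Type u} [Ring H] [HopfAlgebra k H] [FiniteDimensional k H]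
variable {L : Type u} [Ring L] [Algebra k L] [FiniteDimensional k L] [LeftComoduleAlgebra k H L]
variable {I : IntegralData k H} {F : FrobeniusForm k L}
variable (hL : IsExactModuleCategory (FDMod k H) (FDMod k L))

lemma dualFun_serreDual_icomp {M N N' : FDMod k L}
    (g : IHom.obj (FDMod k H) N' ((serre I.modular F).obj M)) (w : IHom.obj (FDMod k H) N N')
    (f : IHom.obj (FDMod k H) M N) :
    dualFun _ (lin (serreDual I F hL M N) (icomp g w)) f =
      dualFun _ (lin (serreDual I F hL M N') g) (icomp w f) := by
  rw [dualFun_serreDual, dualFun_serreDual, ← integralMap_comp, ← integralMap_comp]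
  exact congrArg (fun y => freeTrace F hL M (integralMap I y)) (icomp_assoc g w f).symm

lemma dualFun_serreDual_iright {M N : FDMod k L} {X : FDMod k H}
    (g : IHom.obj (FDMod k H) N ((serre I.modular F).obj M)) (p : (LDual.obj X : FDMod k H))
    (x : X) (f : IHom.obj (FDMod k H) M N) :
    dualFun _ (lin (serreDual I F hL M (X ⊙ₗ N)) (iright g p)) (ileft x f) =
      dualFun X p x * dualFun _ (lin (serreDual I F hL M N) g) f := by
  have h1 := icomp_iright_ileft g p x f
  rw [dualFun_serreDual, dualFun_serreDual, ← integralMap_comp, ← integralMap_comp]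
  refine (congrArg (fun y => freeTrace F hL M (integralMap I y)) h1).trans ?_
  exact (freeTrace F hL M ∘ₗ KLin.toLin (klin_integralMap I F)).map_smul (dualFun X p x) _

/-- Put w = s⁻¹(x ⊗ g). Pairing w with fp is tr(wf · contraction). By cyclicity the contraction
moves to the front, by `freeTrace_contr_comp` it becomes composition with the twisted contraction,
and this composed with w is ⟨p, x⟩g. -/
lemma dualFun_serreDual_post {M N : FDMod k L} {X : FDMod k H} (x : X)
    (g : IHom.obj (FDMod k H) N ((serre I.modular F).obj M)) (f : IHom.obj (FDMod k H) M N)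
    (p : (LDual.obj X : FDMod k H)) :
    dualFun _ (lin (serreDual I F hL (X ⊙ₗ M) N) (lin (IHom.post (FDMod k H) N
      (twistIso I F X M).inv) (ileft (bidual X x) g))) (iright f p) =
      dualFun X p x * dualFun _ (lin (serreDual I F hL M N) g) f := by
  let w : IHom.obj (FDMod k H) N ((serre I.modular F).obj (X ⊙ₗ M)) :=
    lin (IHom.post (FDMod k H) N (twistIso I F X M).inv) (ileft (bidual X x) g)
  have hG : IsFreeSemilinear F (integralMap I w ∘ₗ shiftFun 1 f) := fun a z => by
    rw [LinearMap.comp_apply, isFreeLinear_shiftFun, isFreeSemilinear_integralMap,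
      LinearMap.comp_apply]
  have h1 : icomp (twistContr I F M p) w = dualFun X p x • g := by
    refine (icomp_pre_post (twistIso I F X M) (bidualContr I F M p) (ileft (bidual X x) g)).trans ?_
    refine (icomp_iright_ileft _ _ _ _).trans ?_
    rw [icomp_unit_left]
    rfl
  rw [dualFun_serreDual, shiftFun_iright, ← LinearMap.comp_assoc]
  refine (freeTrace_comp_comm hL hG (isFreeLinear_contr p)).trans ?_
  have h2 : integralMap I w ∘ₗ shiftFun 1 f = integralMap I (icomp w f) :=
    (integralMap_comp I F w f).symm
  refine (congrArg (fun y => freeTrace F hL M (contr M p ∘ₗ y)) h2).trans ?_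
  refine (freeTrace_contr_comp p hL (icomp w f)).trans ?_
  refine (dualFun_serreDual I F hL (twistContr I F M p) (icomp w f)).symm.trans ?_
  refine (dualFun_serreDual_icomp hL (twistContr I F M p) w f).symm.trans ?_
  rw [h1, map_smul, map_smul]
  rfl

lemma serreStructure_hom_serreDual {M N : FDMod k L}
    (g : IHom.obj (FDMod k H) N ((serre I.modular F).obj M)) :
    lin ((serreStructure I F hL).iso M N).hom (lin (serreDual I F hL M N) g) = g :=
  LinearMap.congr_fun (congrArg lin ((serreStructure I F hL).iso M N).inv_hom_id) g

lemma isBimoduleIso_right (X : FDMod k H) (M N : FDMod k L) :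
    LDual.tensor X (IHom.obj (FDMod k H) M N) =
      ((serreStructure I F hL).iso M N).hom ▷ LDual.obj X ≫
        IHom.rightStr N ((serre I.modular F).obj M) X ≫
        ((serreStructure I F hL).iso M (X ⊙ₗ N)).inv ≫ LDual.map (IHom.leftStr X M N) := by
  refine hom_ext (TensorProduct.ext' fun q p => ?_)
  obtain ⟨g, rfl⟩ := serreDual_surjective I F hL M N q
  refine (dualFun _).injective (TensorProduct.ext' fun x f => ?_)
  refine (dualFun_tensor X (IHom.obj (FDMod k H) M N) _ p x f).trans ?_
  refine (dualFun_serreDual_iright hL g p x f).symm.trans ?_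
  refine Eq.trans ?_ (dualFun_map (IHom.leftStr X M N) _ _).symm
  exact congrArg (fun y => dualFun _ (lin (serreDual I F hL M (X ⊙ₗ N)) (iright y p)) (ileft x f))
    (serreStructure_hom_serreDual hL g).symm

/-! ### The left compatibility on elements and its uniqueness -/

section LeftComparison

variable {X : FDMod k H} {M : FDMod k L} (N : FDMod k L)

/-- The map `X^{**} ⊗ [M, N]^* → ([M, N] ⊗ X^*)^*` induced by the left module structures and an
isomorphism `Ser(X ⊙ₗ M) ≅ X^{**} ⊙ₗ Ser(M)`. -/
def leftComparison (e : (serre I.modular F).obj (X ⊙ₗ M) ≅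
    LDual.obj (LDual.obj X) ⊙ₗ (serre I.modular F).obj M) :
    LDual.obj (LDual.obj X) ⊗ LDual.obj (IHom.obj (FDMod k H) M N) ⟶
      LDual.obj (IHom.obj (FDMod k H) M N ⊗ LDual.obj X) :=
  LDual.obj (LDual.obj X) ◁ ((serreStructure I F hL).iso M N).hom ≫
    IHom.leftStr (LDual.obj (LDual.obj X)) N ((serre I.modular F).obj M) ≫
    IHom.post (FDMod k H) N e.inv ≫
    ((serreStructure I F hL).iso (X ⊙ₗ M) N).inv ≫ LDual.map (IHom.rightStr M N X)

lemma dualFun_leftComparison (e : (serre I.modular F).obj (X ⊙ₗ M) ≅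
      LDual.obj (LDual.obj X) ⊙ₗ (serre I.modular F).obj M) (x : X)
    (g : IHom.obj (FDMod k H) N ((serre I.modular F).obj M)) (f : IHom.obj (FDMod k H) M N)
    (p : (LDual.obj X : FDMod k H)) :
    dualFun (IHom.obj (FDMod k H) M N ⊗ LDual.obj X) (lin (leftComparison hL N e)
      (bidual X x ⊗ₜ[k] lin (serreDual I F hL M N) g)) (f ⊗ₜ[k] p) =
    dualFun _ (lin (serreDual I F hL (X ⊙ₗ M) N) (lin (IHom.post (FDMod k H) N e.inv)
      (ileft (bidual X x) g))) (iright f p) := by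
  refine (dualFun_map (IHom.rightStr M N X) _ _).trans ?_
  exact congrArg (fun y => dualFun _ (lin (serreDual I F hL (X ⊙ₗ M) N)
    (lin (IHom.post (FDMod k H) N e.inv) (ileft (bidual X x) y))) (iright f p))
    (serreStructure_hom_serreDual hL g)

lemma dualFun_tensor_bidual (x : X) (q : (LDual.obj (IHom.obj (FDMod k H) M N) : FDMod k H))
    (f : IHom.obj (FDMod k H) M N) (p : (LDual.obj X : FDMod k H)) :
    dualFun (IHom.obj (FDMod k H) M N ⊗ LDual.obj X)
      (lin (LDual.tensor (IHom.obj (FDMod k H) M N) (LDual.obj X)) (bidual X x ⊗ₜ[k] q))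
        (f ⊗ₜ[k] p) = dualFun X p x * dualFun _ q f :=
  (dualFun_tensor (IHom.obj (FDMod k H) M N) (LDual.obj X) (bidual X x) q f p).trans (mul_comm _ _)

/-- The compatibility with the left module structures, in terms of elements. -/
lemma tensor_eq_leftComparison_iff (e : (serre I.modular F).obj (X ⊙ₗ M) ≅
      LDual.obj (LDual.obj X) ⊙ₗ (serre I.modular F).obj M) :
    LDual.tensor (IHom.obj (FDMod k H) M N) (LDual.obj X) = leftComparison hL N e ↔
    ∀ (x : X) (g : IHom.obj (FDMod k H) N ((serre I.modular F).obj M))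
      (f : IHom.obj (FDMod k H) M N) (p : (LDual.obj X : FDMod k H)),
      dualFun _ (lin (serreDual I F hL (X ⊙ₗ M) N) (lin (IHom.post (FDMod k H) N e.inv)
        (ileft (bidual X x) g))) (iright f p) =
      dualFun X p x * dualFun _ (lin (serreDual I F hL M N) g) f := by
  refine ⟨fun h x g f p => ?_, fun h => ?_⟩
  · have h1 := dualFun_leftComparison hL N e x g f p
    rw [← h] at h1
    exact h1.symm.trans (dualFun_tensor_bidual N x (lin (serreDual I F hL M N) g) f p)
  · refine hom_ext (TensorProduct.ext' fun ξ q => ?_)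
    obtain ⟨x, rfl⟩ := (bidual X).surjective ξ
    obtain ⟨g, rfl⟩ := serreDual_surjective I F hL M N q
    refine (dualFun _).injective (TensorProduct.ext' fun f p => ?_)
    exact (dualFun_tensor_bidual N x _ f p).trans
      ((h x g f p).symm.trans (dualFun_leftComparison hL N e x g f p).symm)

end LeftComparison

lemma isBimoduleIso_twistStructure :
    (serreStructure I F hL).IsBimoduleIso (twistStructure I F) :=
  ⟨fun _ _ N => (tensor_eq_leftComparison_iff hL N _).2 (dualFun_serreDual_post hL),
    isBimoduleIso_right hL⟩

lemma ihomFun_ileft_ihomUnit {Y : FDMod k H} {N : FDMod k L} (y : Y) (n : N) :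
    ihomFun N (Y ⊙ₗ N) (ileft y (ihomUnit H N)) (1 ⊗ₜ[k] n) = (y ⊗ₜ[k] n : Y ⊗[k] N) := by
  refine (ihomFun_ileft y (ihomUnit H N) 1 n).trans ?_
  rw [Bialgebra.comul_one, Algebra.TensorProduct.one_def,
    swd_tmul _ _ _ (by fun_prop) (by fun_prop), ihomFun_ihomUnit, Bialgebra.counit_one, one_smul,
    map_one]
  rfl

/-- Only N = Ser(M) with g the unit of [N, N] is needed. The products fp span [X ⊗ M, N], so
non-degeneracy identifies the images of x ⊗ 1 under both inverses, and evaluation at 1 ⊗ n recovers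
the maps. -/
lemma eq_of_isBimoduleIso {X : FDMod k H} {M : FDMod k L}
    {e e' : (serre I.modular F).obj (X ⊙ₗ M) ≅
      LDual.obj (LDual.obj X) ⊙ₗ (serre I.modular F).obj M}
    (h : ∀ (x : X) (g : IHom.obj (FDMod k H) ((serre I.modular F).obj M)
      ((serre I.modular F).obj M)) (f : IHom.obj (FDMod k H) M ((serre I.modular F).obj M))
      (p : (LDual.obj X : FDMod k H)),
      dualFun _ (lin (serreDual I F hL (X ⊙ₗ M) ((serre I.modular F).obj M))
        (lin (IHom.post (FDMod k H) _ e.inv) (ileft (bidual X x) g))) (iright f p) =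
      dualFun _ (lin (serreDual I F hL (X ⊙ₗ M) ((serre I.modular F).obj M))
        (lin (IHom.post (FDMod k H) _ e'.inv) (ileft (bidual X x) g))) (iright f p)) :
    e = e' := by
  let N := (serre I.modular F).obj M
  have h1 : ∀ x, lin (IHom.post (FDMod k H) _ e.inv) (ileft (bidual X x) (ihomUnit H N)) =
      lin (IHom.post (FDMod k H) _ e'.inv) (ileft (bidual X x) (ihomUnit H N)) := fun x => by
    refine serreDual_injective I F hL (X ⊙ₗ M) N ((dualFun _).injective (LinearMap.ext fun f => ?_))
    rw [← sum_iright_icomp (Module.finBasis k X) f, map_sum, map_sum]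
    exact Finset.sum_congr rfl fun i _ => h x _ _ _
  refine Iso.ext_inv (hom_ext (TensorProduct.ext' fun ξ n => ?_))
  obtain ⟨x, rfl⟩ := (bidual X).surjective ξ
  have h2 := congrArg (fun w => ihomFun N _ w ((1 : H) ⊗ₜ[k] n)) (h1 x)
  have h3 := ihomFun_ileft_ihomUnit (H := H) (bidual X x) n
  exact (congrArg (lin e.inv) h3).symm.trans (h2.trans (congrArg (lin e'.inv) h3))

lemma isBimoduleIso_iff (s : TwistedModuleStructure (FDMod k H) (serre (H := H) I.modular F)) :
    (serreStructure I F hL).IsBimoduleIso s ↔ s = twistStructure I F := by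
  refine ⟨fun h => ?_, fun h => h ▸ isBimoduleIso_twistStructure hL⟩
  -- The left compatibility alone determines the structure isomorphisms; the remaining fields are
  -- propositions.
  have h1 : s.iso = (twistStructure I F).iso := funext fun X => funext fun M =>
    eq_of_isBimoduleIso hL fun x g f p =>
      ((tensor_eq_leftComparison_iff hL _ _).1 (h.1 X M _) x g f p).trans
        (dualFun_serreDual_post hL x g f p).symm
  cases s
  cases h1
  rfl

lemma twistIso_hom_tmul {ι : Type*} [Fintype ι] [DecidableEq ι] {a : Module.Basis ι k L}
    {b : ι → L} (hab : ∀ i j, F.form (a i * b j) = if i = j then 1 else 0)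
    {n : ℕ} {Λ₁ Λ₂ Λ₃ : Fin n → H}
    (h : (Coalgebra.comul : H →ₗ[k] H ⊗[k] H).lTensor H (Coalgebra.comul I.integral) =
      ∑ p, Λ₁ p ⊗ₜ[k] (Λ₂ p ⊗ₜ[k] Λ₃ p)) (X : FDMod k H) (M : FDMod k L) (x : X) (m : M) :
    twistEquiv I F X M (x ⊗ₜ[k] m) = ∑ j, ∑ p, bidual X (X.ρ
      ((HopfAlgebra.antipode k : H →ₗ[k] H) ((HopfAlgebra.antipode k : H →ₗ[k] H)
        ((HopfAlgebra.antipode k : H →ₗ[k] H)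
          ((HopfAlgebra.antipode k : H →ₗ[k] H) (Λ₁ p) * coactRight H F.form (b j)))) *
        (HopfAlgebra.antipode k : H →ₗ[k] H) (Λ₃ p)) x) ⊗ₜ[k]
      M.ρ (coactLeft (I.cointegral ∘ₗ LinearMap.mulRight k (Λ₂ p)) (a j)) m := by
  rw [twistEquiv_apply, twistTensor_eq_sum I hab h]
  simp only [map_sum, LinearMap.sum_apply, tensorAct_tmul, bidualTensor_tmul]

end FDMod

end

theorem mainTheorem1 {k : Type u} [Field k] [IsAlgClosed k]
    {H : Type u} [Ring H] [HopfAlgebra k H] [FiniteDimensional k H]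
    {L : Type u} [Ring L] [Algebra k L] [FiniteDimensional k L] [LeftComoduleAlgebra k H L]
    (hL : IsExactModuleCategory (FDMod k H) (FDMod k L)) :
    -- the data that enter the formulas exist
    Nonempty (IntegralData k H) ∧ Nonempty (FrobeniusForm k L) ∧
    ∀ (I : IntegralData k H) (F : FrobeniusForm k L),
    -- the map by which the action is twisted is an automorphism
    Function.Bijective (twistedNakayama I.modular F) ∧
    -- `H ⊙ₗ M` has a pair of dual bases
    (∀ M : FDMod k L, ∃ (n : ℕ) (t : Fin n → (H ⊗[k] M))
      (t' : Fin n → ((FDMod.regular k H ⊙ₗ M) ⟶ FDMod.regular k L)),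
      ∀ x : H ⊗[k] M,
        ∑ i, ((FDMod.regular k H ⊙ₗ M).ρ (FDMod.lin (t' i) x : L) (t i) : H ⊗[k] M) = x) ∧
    ∃ (φ : RelativeSerreStructure (FDMod k H) (serre I.modular F))
      (s : TwistedModuleStructure (FDMod k H) (serre I.modular F))
      (tr : ∀ M : FDMod k L,
        IHom.obj (FDMod k H) M ((serre I.modular F).obj M) ⟶ 𝟙_ (FDMod k H)),
      -- `s` is the twisted module structure determined by `φ`
      (∀ s' : TwistedModuleStructure (FDMod k H) (serre I.modular F),
        φ.IsBimoduleIso s' ↔ s' = s) ∧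
      -- the formula for the twisted module structure; the family `Λ₁, Λ₂, Λ₃` expresses
      -- the twofold comultiplication of the integral
      (∀ (ι : Type) [Fintype ι] [DecidableEq ι] (a : Module.Basis ι k L) (b : ι → L),
        (∀ i j, F.form (a i * b j) = if i = j then 1 else 0) →
        ∀ (n : ℕ) (Λ₁ Λ₂ Λ₃ : Fin n → H),
        (Coalgebra.comul : H →ₗ[k] H ⊗[k] H).lTensor H (Coalgebra.comul I.integral) =
          ∑ p, Λ₁ p ⊗ₜ[k] (Λ₂ p ⊗ₜ[k] Λ₃ p) →
        ∀ (X : FDMod k H) (M : FDMod k L) (x : X) (m : M),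
          (FDMod.lin (s.iso X M).hom (x ⊗ₜ[k] m : X ⊗[k] M) :
            Module.Dual k (Module.Dual k X) ⊗[k] M) =
          ∑ j, ∑ p,
            (Module.Dual.eval k X (X.ρ
              ((HopfAlgebra.antipode k : H →ₗ[k] H) ((HopfAlgebra.antipode k : H →ₗ[k] H)
                ((HopfAlgebra.antipode k : H →ₗ[k] H)
                  ((HopfAlgebra.antipode k : H →ₗ[k] H) (Λ₁ p) * coactRight H F.form (b j)))) *
                (HopfAlgebra.antipode k : H →ₗ[k] H) (Λ₃ p)) x)) ⊗ₜ[k]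
            (M.ρ (coactLeft (I.cointegral ∘ₗ LinearMap.mulRight k (Λ₂ p)) (a j)) m)) ∧
      -- the formula for the trace
      (∀ (M : FDMod k L) (n : ℕ) (t : Fin n → (H ⊗[k] M))
        (t' : Fin n → ((FDMod.regular k H ⊙ₗ M) ⟶ FDMod.regular k L)),
        (∀ x : H ⊗[k] M,
          ∑ i, ((FDMod.regular k H ⊙ₗ M).ρ (FDMod.lin (t' i) x : L) (t i) : H ⊗[k] M) = x) →
        ∀ ξ : FDMod.homSubmodule (FDMod.regular k H ⊙ₗ M) ((serre I.modular F).obj M),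
          (FDMod.lin (tr M) ξ : k) =
            ∑ i, F.form (FDMod.lin (t' i) (I.integral ⊗ₜ[k] (ξ.1 (t i) : M) : H ⊗[k] M))) ∧
      -- `φ` is induced by the composition of internal Homs followed by the trace
      (∀ M N : FDMod k L,
        φ.pairing M N =
          IHom.comp (FDMod k H) M N ((serre I.modular F).obj M) ≫ tr M) := by
  refine ⟨HopfAlgebra.nonempty_integralData k H, LeftComoduleAlgebra.nonempty_frobeniusForm hL,
    fun I F => ⟨LeftComoduleAlgebra.twistedNakayama_bijective F I.modular, fun M => ?_,
      FDMod.serreStructure I F hL, FDMod.twistStructure I F, FDMod.serreTrace I F hL,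
      FDMod.isBimoduleIso_iff hL, fun ι _ _ a b hab n Λ₁ Λ₂ Λ₃ h X M x m => ?_,
      fun M n t t' ht ξ => ?_, FDMod.serreStructure_pairing I F hL⟩⟩
  · obtain ⟨n, t, t', h⟩ := FDMod.exists_isDualBases (FDMod.projective_regular_act hL M)
    exact ⟨n, t, t', h⟩
  · exact FDMod.twistIso_hom_tmul hab h X M x m
  -- The trace was defined by one choice of dual bases; semilinearity of Λ ⊗ ξ gives the same value
  -- for every choice.
  · exact FDMod.freeTrace_eq hL M ht (FDMod.isFreeSemilinear_integralMap I ξ)
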